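/- Let $\Bbbk$ be a field; algebras are unital associative $\Bbbk$-algebras and $\otimes=\otimes_{\Bbbk}$. **Definitions.** A *twisted generalized Weyl datum* (TGWD) of rank $n$ is a triple $(R,\sigma,t)$ with $R$ an algebra, $\sigma=(\sigma_1,\dots,\sigma_n)$ commuting $\Bbbk$-algebra automorphisms of $R$, and $t=(t_1,\dots,t_n)$ central elements of $R$. For $\mu=(\mu_{ij})\in M_n(\Bbbk^\times)$, $C_\mu(R,\sigma,t)$ is the algebra generated over $R$ by $X_1^\pm,\dots,X_n^\pm$ with relations $$X_i^{\pm}r=\sigma_i^{\pm1}(r)X_i^{\pm},\quad X_i^-X_i^+=t_i,\quad X_i^+X_i^-=\sigma_i(t_i),\quad X_i^+X_j^-=\mu_{ij}X_j^-X_i^+\ (i\ne j),$$ for $r\in R$. It is $\mathbb Z^n$-graded by $\deg r=0$, $\deg X_i^\pm=\pm e_i$. The TGWA $A_\mu(R,\sigma,t)$ is the quotient $C_\mu(R,\sigma,t)/\mathcal J$ (with the induced grading), where $\mathcal J$ is the sum of all graded two-sided ideals with zero component in degree $0$. The datum (and the TGWA) is *regular* if every $t_i$ is a regular element of $R$ (not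 a left or right zero divisor), and *$\mu$-consistent* if $R\to A_\mu(R,\sigma,t)$ is injective. A *twisting map* for algebras $(A,B)$ is a linear map $\tau:B\otimes A\to A\otimes B$ with $\tau(b\otimes1)=1\otimes b$ and $\tau(1\otimes a)=a\otimes 1$; it is *associative* if the product $(\mathrm{mult}_A\otimes \mathrm{mult}_B)\circ(\mathrm{id}_A\otimes\tau\otimes\mathrm{id}_B)$ on $A\otimes B$ is associative, and $A\otimes_\tau B$ then denotes $A\otimes B$ with this product. For graded $A,B$, $\tau$ is *graded* if $\tau(B_\beta\otimes A_\alpha)\subseteq A_\alpha\otimes B_\beta$ for all $\alpha,\beta$. **Hypotheses.** Let $m,n\ge0$. Let $(R,\sigma,t)$ be a regular, $\mu$-consistent TGWD of rank $m$, and put $C=C_\mu(R,\sigma,t)$, $A=A_\mu(R,\sigma,t)$, with generators $X_j^\pm$. Let $(S,\rho,h)$ be a regular, $\nu$-consistent TGWD of rank $n$, and put $D=C_\nu(S,\rho,h)$, $B=A_\nu(S,\rho,h)$, with generators $Y_i^\pm$. Suppose that the $\sigma_j$ and the $\rho_i$ are extended to automorphisms of $T=R\otimes S$, denoted by the same letters,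 all commuting with each other, with $\sigma_j(r\otimes1)=\sigma_j(r)\otimes1$, $\rho_i(1\otimes s)=1\otimes\rho_i(s)$, $\rho_i(R\otimes1)\subseteq R\otimes1$ and $\sigma_j(1\otimes S)\subseteq1\otimes S$. Let $q_{ij}^{(\pm,\pm)}\in\Bbbk^\times$ $(1\le i\le n,\ 1\le j\le m)$ be scalars such that, for all $i,j$, $$\rho_i(t_j\otimes1)=q_{ij}^{(+,-)}q_{ij}^{(+,+)}\,t_j\otimes1,\qquad \sigma_j(1\otimes h_i)=q_{ij}^{(-,-)}q_{ij}^{(+,-)}\,1\otimes h_i,\qquad q_{ij}^{(-,-)}q_{ij}^{(-,+)}q_{ij}^{(+,-)}q_{ij}^{(+,+)}=1.$$ **Conclusions.** 1. The extended $\rho_i$ and $\sigma_j$ are induced by automorphisms of $R$ and of $S$ respectively (again denoted $\rho_i$, $\sigma_j$). 2. There is exactly one linear map $\tau:D\otimes C\to C\otimes D$ such that $$\tau(sY_{\mathbf v}\otimes rX_{\mathbf u})=q_{(\mathbf v,\mathbf u)}\,\rho^{d(\mathbf v)}(r)X_{\mathbf u}\otimes\sigma^{-d(\mathbf u)}(s)Y_{\mathbf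 v}$$ for all $r\in R$, $s\in S$ and all finite sequences $\mathbf u$ in $\pm\{1,\dots,m\}$ and $\mathbf v$ in $\pm\{1,\dots,n\}$. Here $X_{\mathbf u}$ is the product of the $X_{|u|}^{\operatorname{sgn}u}$ over the entries $u$ of $\mathbf u$ in order, $d(\mathbf u)=\deg X_{\mathbf u}$, likewise $Y_{\mathbf v}$ and $d(\mathbf v)$, $\sigma^\alpha=\sigma_1^{\alpha_1}\cdots\sigma_m^{\alpha_m}$, $\rho^\beta=\rho_1^{\beta_1}\cdots\rho_n^{\beta_n}$, and $q_{(\mathbf v,\mathbf u)}$ is the product of $q_{|v|,|u|}^{(\operatorname{sgn}v,\operatorname{sgn}u)}$ over all entries $v$ of $\mathbf v$ and $u$ of $\mathbf u$. This $\tau$ is a graded, associative twisting map. It induces a map $B\otimes A\to A\otimes B$, also denoted $\tau$, which is again a graded, associative twisting map and the only linear map given by the same formula. 3. Let $\pi=(\sigma_1,\dots,\sigma_m,\rho_1,\dots,\rho_n)$, $w=(t_1\otimes1,\dots,t_m\otimes1,1\otimes h_1,\dots,1\otimes h_n)$, and let $\eta\in M_{m+n}(\Bbbk^\times)$ be $$\eta_{ij}=\begin{cases}\mu_{ij}&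 i,j\le m\\ \bigl(q_{j-m,i}^{(-,+)}\bigr)^{-1}& i\le m<j\\ q_{i-m,j}^{(+,-)}& j\le m<i\\ \nu_{i-m,j-m}& i,j>m.\end{cases}$$ Then $(T,\pi,w)$ is a regular, $\eta$-consistent TGWD of rank $m+n$, and there is an isomorphism of algebras $A_\eta(T,\pi,w)\cong A\otimes_\tau B$ which maps the image of $r\otimes s\in T$ to $r\otimes s$, the generators $Z_j^\pm$ with $j\le m$ to $X_j^\pm\otimes1$, and the generators $Z_{m+i}^\pm$ to $1\otimes Y_i^\pm$. -/

import Mathlib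

open scoped TensorProduct

/-- A twisted generalized Weyl datum of rank `n` over the field `k`: an `n`-tuple of commuting
algebra automorphisms of the `k`-algebra `R` and an `n`-tuple of central elements of `R`. -/
structure TGWD (k : Type*) [Field k] (R : Type*) [Ring R] [Algebra k R] (n : ℕ) where
  σ : Fin n → (R ≃ₐ[k] R)
  t : Fin n → R
  commute : ∀ i j, Commute (σ i) (σ j)
  central : ∀ i, t i ∈ Subalgebra.center k R

/-- For a tuple of (commuting) automorphisms, `autPow f α = f₁ ^ α₁ ⋯ fₙ ^ αₙ`. -/
def autPow {k : Type*} [Field k] {R : Type*} [Ring R] [Algebra k R] {n : ℕ}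
    (f : Fin n → (R ≃ₐ[k] R)) (α : Fin n → ℤ) : R ≃ₐ[k] R :=
  (List.ofFn fun i => f i ^ α i).prod

/-- A letter `(i, ε)` stands for the signed index `± i`; the sign `ε` is a unit of `ℤ`. -/
abbrev Letter (n : ℕ) : Type := Fin n × ℤˣ

/-- The degree `d(u) ∈ ℤⁿ` of a word `u` in the letters: the letter `± i` has degree `± eᵢ`. -/
def wordDeg {n : ℕ} (u : List (Letter n)) : Fin n → ℤ :=
  (u.map fun a => (Pi.single a.1 (a.2 : ℤ) : Fin n → ℤ)).sum

/-- The monomial `X_u = X_{u₁} ⋯ X_{uₗ}` of a word `u`. -/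
def wordProd {n : ℕ} {M : Type*} [Monoid M] (X : Fin n → ℤˣ → M) (u : List (Letter n)) : M :=
  (u.map fun a => X a.1 a.2).prod

namespace TGWD

section Construction

variable {k : Type*} [Field k] {R : Type*} [Ring R] [Algebra k R] {n : ℕ}

/-- `tᵢ` is a regular element (not a left or right zero divisor) for every `i`. -/
def IsRegular (D : TGWD k R n) : Prop := ∀ i, _root_.IsRegular (D.t i)

/-- The generators, in the free algebra, coming from the elements of `R`. -/
def freeBase (k : Type*) [Field k] {R : Type*} (n : ℕ) (r : R) :
    FreeAlgebra k (R ⊕ Letter n) :=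
  FreeAlgebra.ι k (Sum.inl r)

/-- The generators `Xᵢ^ε` in the free algebra. -/
def freeX (k : Type*) [Field k] (R : Type*) {n : ℕ} (i : Fin n) (ε : ℤˣ) :
    FreeAlgebra k (R ⊕ Letter n) :=
  FreeAlgebra.ι k (Sum.inr (i, ε))

/-- The relations of the twisted generalized Weyl construction. The first three say that `R` maps
to the quotient by a homomorphism of `k`-algebras. -/
inductive Rel (D : TGWD k R n) (μ : Matrix (Fin n) (Fin n) kˣ) :
    FreeAlgebra k (R ⊕ Letter n) → FreeAlgebra k (R ⊕ Letter n) → Prop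
  | base_add (r s : R) :
      Rel D μ (freeBase k n (r + s)) (freeBase k n r + freeBase k n s)
  | base_mul (r s : R) :
      Rel D μ (freeBase k n (r * s)) (freeBase k n r * freeBase k n s)
  | base_scalar (c : k) :
      Rel D μ (freeBase k n (algebraMap k R c)) (algebraMap k _ c)
  | X_base (i : Fin n) (ε : ℤˣ) (r : R) :
      Rel D μ (freeX k R i ε * freeBase k n r)
        (freeBase k n ((D.σ i ^ (ε : ℤ)) r) * freeX k R i ε)
  | neg_pos (i : Fin n) :
      Rel D μ (freeX k R i (-1) * freeX k R i 1) (freeBase k n (D.t i))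
  | pos_neg (i : Fin n) :
      Rel D μ (freeX k R i 1 * freeX k R i (-1)) (freeBase k n (D.σ i (D.t i)))
  | pos_neg_of_ne (i j : Fin n) (h : i ≠ j) :
      Rel D μ (freeX k R i 1 * freeX k R j (-1))
        ((μ i j : k) • (freeX k R j (-1) * freeX k R i 1))

/-- The twisted generalized Weyl construction `C_μ(R, σ, t)`. -/
def TGWC (D : TGWD k R n) (μ : Matrix (Fin n) (Fin n) kˣ) : Type _ := RingQuot (D.Rel μ)

variable (D : TGWD k R n) (μ : Matrix (Fin n) (Fin n) kˣ)

noncomputable instance : Ring (D.TGWC μ) := inferInstanceAs (Ring (RingQuot (D.Rel μ)))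

noncomputable instance : Algebra k (D.TGWC μ) :=
  inferInstanceAs (Algebra k (RingQuot (D.Rel μ)))

namespace TGWC

/-- The quotient map from the free algebra. -/
noncomputable def mk : FreeAlgebra k (R ⊕ Letter n) →ₐ[k] D.TGWC μ := RingQuot.mkAlgHom k (D.Rel μ)

variable {D μ} in
theorem mk_rel {x y : FreeAlgebra k (R ⊕ Letter n)} (h : D.Rel μ x y) : mk D μ x = mk D μ y :=
  RingQuot.mkAlgHom_rel k h

/-- The canonical map `R → C_μ(R, σ, t)`. -/
noncomputable def base : R →ₐ[k] D.TGWC μ :=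
  AlgHom.ofLinearMap
    { toFun := fun r => mk D μ (freeBase k n r)
      map_add' := fun r s => by rw [mk_rel (.base_add r s), map_add]
      map_smul' := fun c r => by
        rw [Algebra.smul_def, mk_rel (.base_mul _ _), map_mul, mk_rel (.base_scalar c),
          AlgHom.commutes, RingHom.id_apply, Algebra.smul_def] }
    (by
      change mk D μ (freeBase k n 1) = 1
      rw [← map_one (algebraMap k R), mk_rel (.base_scalar 1), map_one, map_one])
    (fun r s => by
      change mk D μ (freeBase k n (r * s)) = _
      rw [mk_rel (.base_mul r s), map_mul]
      rfl)

/-- The canonical generators `Xᵢ^ε` of `C_μ(R, σ, t)`. -/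
noncomputable def X (i : Fin n) (ε : ℤˣ) : D.TGWC μ := mk D μ (freeX k R i ε)

/-- The component of degree `g` of the `ℤⁿ`-grading on `C_μ(R, σ, t)` with `deg r = 0` and
`deg Xᵢ^± = ± eᵢ`: the span of the elements `r X_u` with `d(u) = g`. -/
noncomputable def gr (g : Fin n → ℤ) : Submodule k (D.TGWC μ) :=
  Submodule.span k {x | ∃ (r : R) (u : List (Letter n)), wordDeg u = g ∧
    x = base D μ r * wordProd (X D μ) u}

theorem X_mul_base (i : Fin n) (ε : ℤˣ) (r : R) :
    X D μ i ε * base D μ r = base D μ ((D.σ i ^ (ε : ℤ)) r) * X D μ i ε := by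
  change mk D μ _ * mk D μ _ = mk D μ _ * mk D μ _
  rw [← map_mul, ← map_mul]
  exact mk_rel (.X_base i ε r)

theorem wordProd_mul_base (u : List (Letter n)) (r : R) :
    ∃ r', wordProd (X D μ) u * base D μ r = base D μ r' * wordProd (X D μ) u := by
  induction u with
  | nil => exact ⟨r, by simp [wordProd]⟩
  | cons a u ih =>
    obtain ⟨r', h⟩ := ih
    refine ⟨(D.σ a.1 ^ (a.2 : ℤ)) r', ?_⟩
    simp only [wordProd, List.map_cons, List.prod_cons] at h ⊢
    rw [mul_assoc, h, ← mul_assoc, X_mul_base, mul_assoc]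

theorem base_mem (r : R) : base D μ r ∈ gr D μ 0 :=
  Submodule.subset_span ⟨r, [], by simp [wordDeg], by simp [wordProd]⟩

theorem wordProd_mem (u : List (Letter n)) : wordProd (X D μ) u ∈ gr D μ (wordDeg u) :=
  Submodule.subset_span ⟨1, u, rfl, by simp⟩

theorem X_mem (i : Fin n) (ε : ℤˣ) : X D μ i ε ∈ gr D μ (Pi.single i (ε : ℤ)) :=
  Submodule.subset_span ⟨1, [(i, ε)], by simp [wordDeg], by simp [wordProd]⟩

instance : SetLike.GradedMonoid (gr D μ) where
  one_mem := by
    rw [← map_one (base D μ)]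
    exact base_mem D μ 1
  mul_mem := by
    intro g h x y hx hy
    have key := Submodule.mul_mem_mul hx hy
    simp only [gr, Submodule.span_mul_span] at key
    refine Submodule.span_mono ?_ key
    rintro _ ⟨_, ⟨r, u, hu, rfl⟩, _, ⟨s, v, hv, rfl⟩, rfl⟩
    obtain ⟨s', hs⟩ := wordProd_mul_base D μ u s
    refine ⟨r * s', u ++ v, by simp [wordDeg, ← hu, ← hv], ?_⟩
    have : wordProd (X D μ) (u ++ v) = wordProd (X D μ) u * wordProd (X D μ) v := by
      simp [wordProd]
    rw [this, map_mul]
    simp only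
    rw [mul_assoc, ← mul_assoc (wordProd (X D μ) u), hs]
    simp only [mul_assoc]

/-- The algebra homomorphism to the direct sum of the homogeneous components. -/
noncomputable def decomposeFree :
    FreeAlgebra k (R ⊕ Letter n) →ₐ[k] DirectSum (Fin n → ℤ) (fun g => gr D μ g) :=
  FreeAlgebra.lift k (Sum.elim
    (fun r => DirectSum.of (fun g => gr D μ g) 0 ⟨base D μ r, base_mem D μ r⟩)
    (fun a => DirectSum.of (fun g => gr D μ g) _ ⟨X D μ a.1 a.2, X_mem D μ a.1 a.2⟩))

theorem of_eq_of {g h : Fin n → ℤ} (x : gr D μ g) (y : gr D μ h) (e : g = h)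
    (hxy : (x : D.TGWC μ) = y) :
    DirectSum.of (fun g => gr D μ g) g x = DirectSum.of (fun g => gr D μ g) h y := by
  subst e
  rw [Subtype.ext hxy]

theorem decomposeFree_base (r : R) : decomposeFree D μ (freeBase k n r) =
    DirectSum.of (fun g => gr D μ g) 0 ⟨base D μ r, base_mem D μ r⟩ := by
  simp [decomposeFree, freeBase]

theorem decomposeFree_X (i : Fin n) (ε : ℤˣ) : decomposeFree D μ (freeX k R i ε) =
    DirectSum.of (fun g => gr D μ g) _ ⟨X D μ i ε, X_mem D μ i ε⟩ := by
  simp [decomposeFree, freeX]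

theorem decomposeFree_rel ⦃x y : FreeAlgebra k (R ⊕ Letter n)⦄ (h : D.Rel μ x y) :
    decomposeFree D μ x = decomposeFree D μ y := by
  have hmk := mk_rel h
  cases h with
  | base_add r s =>
    rw [map_add, decomposeFree_base, decomposeFree_base, decomposeFree_base, ← map_add]
    exact of_eq_of D μ _ _ rfl (by simp)
  | base_mul r s =>
    rw [map_mul, decomposeFree_base, decomposeFree_base, decomposeFree_base, DirectSum.of_mul_of]
    exact of_eq_of D μ _ _ (by simp) (by simp)
  | base_scalar c =>
    rw [decomposeFree_base, AlgHom.commutes (decomposeFree D μ), DirectSum.algebraMap_apply]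
    exact of_eq_of D μ _ _ rfl (by simp [Algebra.algebraMap_eq_smul_one])
  | X_base i ε r =>
    rw [map_mul, map_mul, decomposeFree_base, decomposeFree_base, decomposeFree_X,
      DirectSum.of_mul_of, DirectSum.of_mul_of]
    exact of_eq_of D μ _ _ (by simp) (X_mul_base D μ i ε r)
  | neg_pos i =>
    rw [map_mul, decomposeFree_base, decomposeFree_X, decomposeFree_X, DirectSum.of_mul_of]
    refine of_eq_of D μ _ _ (by simp [← Pi.single_add]) ?_
    rw [map_mul] at hmk
    exact hmk
  | pos_neg i =>
    rw [map_mul, decomposeFree_base, decomposeFree_X, decomposeFree_X, DirectSum.of_mul_of]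
    refine of_eq_of D μ _ _ (by simp [← Pi.single_add]) ?_
    rw [map_mul] at hmk
    exact hmk
  | pos_neg_of_ne i j hij =>
    rw [map_mul, map_smul, map_mul, decomposeFree_X, decomposeFree_X, DirectSum.of_mul_of,
      DirectSum.of_mul_of, ← DirectSum.lof_eq_of k, ← DirectSum.lof_eq_of k, ← map_smul]
    refine of_eq_of D μ _ _ (add_comm _ _) ?_
    rw [map_mul, map_smul, map_mul] at hmk
    exact hmk

/-- The components `gr` form an algebra grading of the twisted generalized Weyl construction. -/
noncomputable instance : GradedAlgebra (gr D μ) :=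
  GradedAlgebra.ofAlgHom (gr D μ)
    (RingQuot.liftAlgHom k ⟨decomposeFree D μ, decomposeFree_rel D μ⟩ :
      RingQuot (D.Rel μ) →ₐ[k] _)
    (by
      apply RingQuot.ringQuot_ext'
      apply FreeAlgebra.hom_ext
      funext a
      rcases a with r | ⟨i, ε⟩
      · change DirectSum.coeAlgHom (gr D μ) (RingQuot.liftAlgHom k _
          (RingQuot.mkAlgHom k (D.Rel μ) (freeBase k n r))) = base D μ r
        rw [RingQuot.liftAlgHom_mkAlgHom_apply, decomposeFree_base, DirectSum.coeAlgHom_of]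
      · change DirectSum.coeAlgHom (gr D μ) (RingQuot.liftAlgHom k _
          (RingQuot.mkAlgHom k (D.Rel μ) (freeX k R i ε))) = X D μ i ε
        rw [RingQuot.liftAlgHom_mkAlgHom_apply, decomposeFree_X, DirectSum.coeAlgHom_of])
    (by
      set f : D.TGWC μ →ₐ[k] DirectSum (Fin n → ℤ) (fun g => gr D μ g) :=
        RingQuot.liftAlgHom k ⟨decomposeFree D μ, decomposeFree_rel D μ⟩ with hf
      have hb : ∀ r, f (base D μ r) =
          DirectSum.of (fun g => gr D μ g) 0 ⟨base D μ r, base_mem D μ r⟩ := fun r =>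
        (RingQuot.liftAlgHom_mkAlgHom_apply k _ _ _).trans (decomposeFree_base D μ r)
      have hX : ∀ i ε, f (X D μ i ε) =
          DirectSum.of (fun g => gr D μ g) _ ⟨X D μ i ε, X_mem D μ i ε⟩ := fun i ε =>
        (RingQuot.liftAlgHom_mkAlgHom_apply k _ _ _).trans (decomposeFree_X D μ i ε)
      have hw : ∀ u, f (wordProd (X D μ) u) =
          DirectSum.of (fun g => gr D μ g) _ ⟨wordProd (X D μ) u, wordProd_mem D μ u⟩ := by
        intro u
        induction u with
        | nil =>
          change f 1 = _
          rw [map_one, DirectSum.one_def]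
          exact of_eq_of D μ _ _ (by simp [wordDeg]) (by simp [wordProd])
        | cons a u ih =>
          have : wordProd (X D μ) (a :: u) = X D μ a.1 a.2 * wordProd (X D μ) u := by
            simp [wordProd]
          refine (congrArg f this).trans ?_
          rw [map_mul, ih, hX, DirectSum.of_mul_of]
          exact of_eq_of D μ _ _ (by simp [wordDeg]) this.symm
      rintro g ⟨x, hx⟩
      change f x = _
      induction hx using Submodule.span_induction with
      | mem x hx =>
        obtain ⟨r, u, hu, rfl⟩ := hx
        rw [map_mul, hb, hw, DirectSum.of_mul_of]
        exact of_eq_of D μ _ _ (by rw [zero_add, hu]) rfl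
      | zero =>
        rw [map_zero]
        exact (map_zero (DirectSum.of (fun g => gr D μ g) g)).symm
      | add x y hx hy ihx ihy =>
        rw [map_add, ihx, ihy, ← map_add]
        rfl
      | smul c x hx ih =>
        rw [map_smul, ih, ← DirectSum.lof_eq_of k, ← map_smul]
        rfl)

end TGWC

/-- The canonical ideal: the sum of all graded two-sided ideals with zero component in
degree `0`. -/
noncomputable def canonicalIdeal : Ideal (D.TGWC μ) :=
  sSup {J | J.IsTwoSided ∧ J.IsHomogeneous (TGWC.gr D μ) ∧ ∀ x ∈ J, x ∈ TGWC.gr D μ 0 → x = 0}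

instance : (D.canonicalIdeal μ).IsTwoSided where
  mul_mem_of_left := by
    intro a b ha
    rw [canonicalIdeal, sSup_eq_iSup'] at ha
    refine Submodule.iSup_induction _ (motive := fun a => a * b ∈ D.canonicalIdeal μ) ha ?_ ?_ ?_
    · rintro ⟨J, hJ⟩ x hx
      have := hJ.1
      exact (le_sSup hJ : J ≤ D.canonicalIdeal μ) (J.mul_mem_right b hx)
    · simp
    · intro x y hx hy
      rw [add_mul]
      exact add_mem hx hy

/-- The twisted generalized Weyl algebra `A_μ(R, σ, t)`. -/
def TGWA : Type _ := D.TGWC μ ⧸ D.canonicalIdeal μ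

noncomputable instance : Ring (D.TGWA μ) :=
  inferInstanceAs (Ring (D.TGWC μ ⧸ D.canonicalIdeal μ))

noncomputable instance : Algebra k (D.TGWA μ) :=
  inferInstanceAs (Algebra k (D.TGWC μ ⧸ D.canonicalIdeal μ))

namespace TGWA

/-- The quotient map `C_μ(R, σ, t) → A_μ(R, σ, t)`. -/
noncomputable def mk : D.TGWC μ →ₐ[k] D.TGWA μ := Ideal.Quotient.mkₐ k (D.canonicalIdeal μ)

/-- The canonical map `R → A_μ(R, σ, t)`. -/
noncomputable def base : R →ₐ[k] D.TGWA μ := (mk D μ).comp (TGWC.base D μ)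

/-- The canonical generators of `A_μ(R, σ, t)`. -/
noncomputable def X (i : Fin n) (ε : ℤˣ) : D.TGWA μ := mk D μ (TGWC.X D μ i ε)

/-- The component of degree `g` of the `ℤⁿ`-grading on `A_μ(R, σ, t)`. -/
noncomputable def gr (g : Fin n → ℤ) : Submodule k (D.TGWA μ) :=
  (TGWC.gr D μ g).map (mk D μ).toLinearMap

end TGWA

/-- `μ`-consistency: the canonical map `R → A_μ(R, σ, t)` is injective. -/
def IsConsistent : Prop := Function.Injective (TGWA.base D μ)

end Construction

end TGWD

section TwistedTensor

variable {k : Type*} [Field k] {A : Type*} [Ring A] [Algebra k A] {B : Type*} [Ring B] [Algebra k B]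

/-- The multiplication `(μ_A ⊗ μ_B) ∘ (id_A ⊗ τ ⊗ id_B)` on `A ⊗ B` given by a linear map
`τ : B ⊗ A → A ⊗ B`, with the associativity isomorphisms of `⊗` written out. -/
noncomputable def twistedMul (τ : B ⊗[k] A →ₗ[k] A ⊗[k] B) :
    (A ⊗[k] B) ⊗[k] (A ⊗[k] B) →ₗ[k] A ⊗[k] B :=
  TensorProduct.map (LinearMap.mul' k A) (LinearMap.mul' k B) ∘ₗ
    (TensorProduct.assoc k A A (B ⊗[k] B)).symm.toLinearMap ∘ₗ
    (TensorProduct.assoc k A B B).toLinearMap.lTensor A ∘ₗ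
    (τ.rTensor B).lTensor A ∘ₗ
    (TensorProduct.assoc k B A B).symm.toLinearMap.lTensor A ∘ₗ
    (TensorProduct.assoc k A B (A ⊗[k] B)).toLinearMap

theorem twistedMul_tmul (τ : B ⊗[k] A →ₗ[k] A ⊗[k] B) (a a' : A) (b b' : B) :
    twistedMul τ ((a ⊗ₜ b) ⊗ₜ (a' ⊗ₜ b')) =
      TensorProduct.map (LinearMap.mulLeft k a) (LinearMap.mulRight k b') (τ (b ⊗ₜ a')) := by
  simp only [twistedMul, LinearMap.comp_apply, LinearEquiv.coe_coe, TensorProduct.assoc_tmul,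
    LinearMap.lTensor_tmul, TensorProduct.assoc_symm_tmul, LinearMap.rTensor_tmul]
  induction τ (b ⊗ₜ a') using TensorProduct.induction_on with
  | zero => simp
  | tmul x y => simp
  | add x y hx hy => simp only [TensorProduct.add_tmul, TensorProduct.tmul_add, map_add, hx, hy]

variable (k A B) in
/-- A twisting map for `(A, B)` whose multiplication on `A ⊗ B` is associative. -/
structure TwistingMap where
  toLin : B ⊗[k] A →ₗ[k] A ⊗[k] B
  tmul_one : ∀ b : B, toLin (b ⊗ₜ 1) = 1 ⊗ₜ b
  one_tmul : ∀ a : A, toLin (1 ⊗ₜ a) = a ⊗ₜ 1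
  assoc : ∀ x y z : A ⊗[k] B,
    twistedMul toLin (twistedMul toLin (x ⊗ₜ y) ⊗ₜ z) =
      twistedMul toLin (x ⊗ₜ twistedMul toLin (y ⊗ₜ z))

/-- The twisted tensor product `A ⊗_τ B`: the vector space `A ⊗ B` with the twisted
multiplication. -/
def TwistingMap.TwistedTensor (_τ : TwistingMap k A B) : Type _ := A ⊗[k] B

namespace TwistingMap

variable (τ : TwistingMap k A B)

noncomputable instance : AddCommGroup τ.TwistedTensor := inferInstanceAs (AddCommGroup (A ⊗[k] B))

noncomputable instance : Module k τ.TwistedTensor := inferInstanceAs (Module k (A ⊗[k] B))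

/-- The identification of `A ⊗ B` with `A ⊗_τ B` as vector spaces. -/
noncomputable def of : A ⊗[k] B ≃ₗ[k] τ.TwistedTensor := LinearEquiv.refl k (A ⊗[k] B)

theorem twistedMul_one_left (x : A ⊗[k] B) : twistedMul τ.toLin ((1 ⊗ₜ 1) ⊗ₜ x) = x := by
  induction x using TensorProduct.induction_on with
  | zero => simp
  | tmul a b => simp [twistedMul_tmul, τ.one_tmul]
  | add x y hx hy => rw [TensorProduct.tmul_add, map_add, hx, hy]

theorem twistedMul_one_right (x : A ⊗[k] B) : twistedMul τ.toLin (x ⊗ₜ (1 ⊗ₜ 1)) = x := by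
  induction x using TensorProduct.induction_on with
  | zero => simp
  | tmul a b => simp [twistedMul_tmul, τ.tmul_one]
  | add x y hx hy => rw [TensorProduct.add_tmul, map_add, hx, hy]

noncomputable instance : Ring τ.TwistedTensor :=
  { (inferInstance : AddCommGroup τ.TwistedTensor) with
    mul := fun x y => twistedMul τ.toLin (TensorProduct.tmul k (x : A ⊗[k] B) (y : A ⊗[k] B))
    one := (1 : A) ⊗ₜ[k] (1 : B)
    mul_assoc := τ.assoc
    one_mul := τ.twistedMul_one_left
    mul_one := τ.twistedMul_one_right
    left_distrib := fun x y z => (congrArg _ (TensorProduct.tmul_add _ _ _)).trans (map_add _ _ _)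
    right_distrib := fun x y z => (congrArg _ (TensorProduct.add_tmul _ _ _)).trans (map_add _ _ _)
    zero_mul := fun x => (congrArg _ (TensorProduct.zero_tmul _ _)).trans (map_zero _)
    mul_zero := fun x => (congrArg _ (TensorProduct.tmul_zero _ _)).trans (map_zero _) }

noncomputable instance : Algebra k τ.TwistedTensor :=
  Algebra.ofModule
    (fun c x y => ((twistedMul τ.toLin).comp
      ((TensorProduct.mk k (A ⊗[k] B) (A ⊗[k] B)).flip y)).map_smul c x)
    (fun c x y => ((twistedMul τ.toLin).comp
      (TensorProduct.mk k (A ⊗[k] B) (A ⊗[k] B) x)).map_smul c y)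

end TwistingMap

/-- `τ : B ⊗ A → A ⊗ B` is graded: it maps `B_β ⊗ A_α` into `A_α ⊗ B_β`. -/
def IsGradedTwist {α β : Type*} (𝒜 : α → Submodule k A) (ℬ : β → Submodule k B)
    (τ : B ⊗[k] A →ₗ[k] A ⊗[k] B) : Prop :=
  ∀ i j, ∀ a ∈ 𝒜 i, ∀ b ∈ ℬ j,
    τ (b ⊗ₜ a) ∈ LinearMap.range (TensorProduct.mapIncl (𝒜 i) (ℬ j))

end TwistedTensor

section TwistFormula

/-- The scalar `q_{(v,u)} = ∏ q_{vᵢ,uⱼ}`; here `q i j ε δ` is `q_{ij}^{(ε,δ)}`. -/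
def wordScalar {G : Type*} [CommMonoid G] {m n : ℕ} (q : Fin n → Fin m → ℤˣ → ℤˣ → G)
    (v : List (Letter n)) (u : List (Letter m)) : G :=
  (v.map fun b => (u.map fun a => q b.1 a.1 b.2 a.2).prod).prod

/-- The formula `τ(s Y_v ⊗ r X_u) = q_{(v,u)} ρ^{d(v)}(r) X_u ⊗ σ^{-d(u)}(s) Y_v`, for algebras
`A` and `B` with maps `R → A`, `S → B`, families of elements `Xⱼ^±` of `A` and `Yᵢ^±` of `B`,
automorphisms `ρᵢ` of `R` and `σⱼ` of `S`, and scalars `q_{ij}^{(±,±)}`. -/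
def TwistFormula {k : Type*} [Field k] {R S A B : Type*} [Ring R] [Algebra k R] [Ring S]
    [Algebra k S] [Ring A] [Algebra k A] [Ring B] [Algebra k B] {m n : ℕ}
    (iR : R →ₐ[k] A) (X : Fin m → ℤˣ → A) (iS : S →ₐ[k] B) (Y : Fin n → ℤˣ → B)
    (ρ : Fin n → (R ≃ₐ[k] R)) (σ : Fin m → (S ≃ₐ[k] S))
    (q : Fin n → Fin m → ℤˣ → ℤˣ → kˣ) (τ : B ⊗[k] A →ₗ[k] A ⊗[k] B) : Prop :=
  ∀ (r : R) (s : S) (u : List (Letter m)) (v : List (Letter n)),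
    τ ((iS s * wordProd Y v) ⊗ₜ (iR r * wordProd X u)) =
      ((wordScalar q v u : kˣ) : k) •
        ((iR (autPow ρ (wordDeg v) r) * wordProd X u) ⊗ₜ
          (iS (autPow σ (-wordDeg u) s) * wordProd Y v))

end TwistFormula

namespace TGWD

section TensorDatum

variable {k : Type*} [Field k] {R : Type*} [Ring R] [Algebra k R] {S : Type*} [Ring S]
  [Algebra k S] {m n : ℕ}

/-- An extension of the automorphisms `σⱼ` of `R` and `ρᵢ` of `S` to commuting automorphisms of
`R ⊗ S` with `σⱼ(1 ⊗ S) ⊆ 1 ⊗ S` and `ρᵢ(R ⊗ 1) ⊆ R ⊗ 1`. -/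
structure Extension (D : TGWD k R m) (E : TGWD k S n) where
  σ : Fin m → (R ⊗[k] S ≃ₐ[k] R ⊗[k] S)
  ρ : Fin n → (R ⊗[k] S ≃ₐ[k] R ⊗[k] S)
  σ_extends : ∀ j r, σ j (r ⊗ₜ 1) = D.σ j r ⊗ₜ 1
  ρ_extends : ∀ i s, ρ i (1 ⊗ₜ s) = 1 ⊗ₜ E.σ i s
  σ_stable : ∀ j s, ∃ s', σ j (1 ⊗ₜ s) = 1 ⊗ₜ s'
  ρ_stable : ∀ i r, ∃ r', ρ i (r ⊗ₜ 1) = r' ⊗ₜ 1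
  commute_σ : ∀ j j', Commute (σ j) (σ j')
  commute_ρ : ∀ i i', Commute (ρ i) (ρ i')
  commute_σ_ρ : ∀ j i, Commute (σ j) (ρ i)

theorem tmul_mem_center {r : R} {s : S} (hr : r ∈ Subalgebra.center k R)
    (hs : s ∈ Subalgebra.center k S) : r ⊗ₜ[k] s ∈ Subalgebra.center k (R ⊗[k] S) := by
  rw [Subalgebra.mem_center_iff] at *
  intro x
  induction x using TensorProduct.induction_on with
  | zero => simp
  | tmul a b => simp [hr, hs]
  | add x y hx hy => rw [add_mul, mul_add, hx, hy]

/-- The datum `(R ⊗ S, π, w)` of rank `m + n` with `π = (σ₁, …, σₘ, ρ₁, …, ρₙ)` and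
`w = (t₁ ⊗ 1, …, tₘ ⊗ 1, 1 ⊗ h₁, …, 1 ⊗ hₙ)`. -/
def Extension.datum {D : TGWD k R m} {E : TGWD k S n} (F : Extension D E) :
    TGWD k (R ⊗[k] S) (m + n) where
  σ := Fin.append F.σ F.ρ
  t := Fin.append (fun j => D.t j ⊗ₜ 1) (fun i => 1 ⊗ₜ E.t i)
  commute := fun a b => by
    induction a using Fin.addCases <;> induction b using Fin.addCases <;>
      simp only [Fin.append_left, Fin.append_right]
    · exact F.commute_σ _ _
    · exact F.commute_σ_ρ _ _
    · exact (F.commute_σ_ρ _ _).symm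
    · exact F.commute_ρ _ _
  central := fun a => by
    induction a using Fin.addCases <;> simp only [Fin.append_left, Fin.append_right]
    · exact tmul_mem_center (D.central _) (one_mem _)
    · exact tmul_mem_center (one_mem _) (E.central _)

/-- The parameter matrix `η` in block form: `μ` and `ν` on the diagonal, the entry
`(q_{ji}^{(-,+)})⁻¹` in row `i ≤ m` and column `m + j`, and the entry `q_{ij}^{(+,-)}` in row
`m + i` and column `j ≤ m`. -/
def tensorParameter {G : Type*} [Group G] (μ : Matrix (Fin m) (Fin m) G)
    (ν : Matrix (Fin n) (Fin n) G) (q : Fin n → Fin m → ℤˣ → ℤˣ → G) :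
    Matrix (Fin (m + n)) (Fin (m + n)) G :=
  Fin.append
    (fun i => Fin.append (fun j => μ i j) (fun j => (q j i (-1) 1)⁻¹))
    (fun i => Fin.append (fun j => q i j 1 (-1)) (fun j => ν i j))

end TensorDatum

end TGWD

/-! The twist is encoded in a left action. If `C ⊗_τ D` exists, then `D` acts on it by left
multiplication: `s ∈ S` sends `c ⊗ d`, with `c` of degree `g`, to `c ⊗ σ^{-g}(s) d`, and `Yᵢ^δ` acts
as a rescaling endomorphism of `C` (`ρᵢ^δ` on `R`, `Xⱼ^ε ↦ q Xⱼ^ε`) tensored with left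
multiplication by `Yᵢ^δ`. Conversely, these operators on `C ⊗ D` satisfy the relations of `D`
(`satisfies_act`): the eigenvalue conditions on the `tⱼ` make the rescalings well defined, and those
on the `hᵢ` give the relations for `Yᵢ^- Yᵢ^+` and `Yᵢ^+ Yᵢ^-`. The universal property of `D` yields
the action, and `τ(d ⊗ c) = d · (c ⊗ 1)`. The action commutes with right multiplication by `D`, so
the twisted product is `(c ⊗ d) z = c (d · z)`, and associativity reduces to `(d · y) z = d · (y
z)`, which is checked for generators `d` (`twistedMul_act`).

Descent to the quotients rests on `mem_canonicalIdeal_iff`: an element lies in the canonical ideal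
exactly when all its two-sided multiples have zero component in degree `0`. Hence surjective graded
endomorphisms, in particular the rescalings, preserve the ideal. Since the component of degree `0`
is the image of `R` (`exists_eq_base`), the criterion also turns questions about the ideal into
questions about `R`.

For the last conclusion, the universal property gives a graded surjection `Ψ` (`tensorHom`) from
`C_η` onto `A ⊗_τ B`, and its kernel is the canonical ideal. If `Ψ x = 0`, the degree `0` component
of `b x c` comes from `T` and is killed by `Ψ`; by consistency `T → A ⊗ B` is injective, so that
component vanishes. Conversely, a homogeneous element of the ideal is brought to degree `0`, where
the ideal is zero, by multiplying with a word in the `X` on the left and a word in the `Y` on the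
right. By regularity and consistency these multiplications are injective on `A ⊗ B`, so `Ψ` kills
the element. -/

section Words

/-! ### Words, degrees and opposite pairs -/

variable {n : ℕ}

@[simp] theorem wordDeg_nil : wordDeg ([] : List (Letter n)) = 0 := by simp [wordDeg]

theorem wordDeg_cons (a : Letter n) (u : List (Letter n)) :
    wordDeg (a :: u) = Pi.single a.1 (a.2 : ℤ) + wordDeg u := by simp [wordDeg]

theorem wordDeg_singleton (i : Fin n) (ε : ℤˣ) : wordDeg [(i, ε)] = Pi.single i (ε : ℤ) := by
  simp [wordDeg]

theorem wordDeg_append (u v : List (Letter n)) : wordDeg (u ++ v) = wordDeg u + wordDeg v := by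
  simp [wordDeg]

@[simp] theorem wordProd_nil {M : Type*} [Monoid M] (X : Fin n → ℤˣ → M) :
    wordProd X [] = 1 := by simp [wordProd]

theorem wordProd_cons {M : Type*} [Monoid M] (X : Fin n → ℤˣ → M) (a : Letter n)
    (u : List (Letter n)) : wordProd X (a :: u) = X a.1 a.2 * wordProd X u := by simp [wordProd]

theorem wordProd_append {M : Type*} [Monoid M] (X : Fin n → ℤˣ → M) (u v : List (Letter n)) :
    wordProd X (u ++ v) = wordProd X u * wordProd X v := by simp [wordProd]

theorem map_wordProd {M N : Type*} [Monoid M] [Monoid N] {F : Type*} [FunLike F M N]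
    [MonoidHomClass F M N] (f : F) (X : Fin n → ℤˣ → M) (u : List (Letter n)) :
    f (wordProd X u) = wordProd (fun i ε => f (X i ε)) u := by
  simp [wordProd, map_list_prod, Function.comp_def]

/-- Every degree is the degree of a word. -/
theorem exists_wordDeg_eq (g : Fin n → ℤ) : ∃ u : List (Letter n), wordDeg u = g := by
  have single_nat : ∀ (i : Fin n) (ε : ℤˣ) (N : ℕ), ∃ u : List (Letter n),
      wordDeg u = Pi.single i ((ε : ℤ) * N) := by
    intro i ε N
    induction N with
    | zero => exact ⟨[], by simp⟩
    | succ N ih =>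
      obtain ⟨u, hu⟩ := ih
      refine ⟨(i, ε) :: u, ?_⟩
      rw [wordDeg_cons, hu, ← Pi.single_add]
      congr 1
      push_cast
      ring
  have single : ∀ (i : Fin n) (z : ℤ), ∃ u : List (Letter n), wordDeg u = Pi.single i z := by
    intro i z
    rcases Int.eq_nat_or_neg z with ⟨N, rfl | rfl⟩
    · obtain ⟨u, hu⟩ := single_nat i 1 N
      exact ⟨u, by simpa using hu⟩
    · obtain ⟨u, hu⟩ := single_nat i (-1) N
      exact ⟨u, by simpa using hu⟩
  rw [← Finset.univ_sum_single g]
  induction (Finset.univ : Finset (Fin n)) using Finset.induction_on with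
  | empty => exact ⟨[], by simp⟩
  | insert i s hi ih =>
    obtain ⟨u, hu⟩ := ih
    obtain ⟨v, hv⟩ := single i (g i)
    exact ⟨v ++ u, by rw [wordDeg_append, hu, hv, Finset.sum_insert hi]⟩

/-- A word has an opposite pair if some index occurs in it with both signs. -/
def HasOppositePair (w : List (Letter n)) : Prop := ∃ i ε, (i, ε) ∈ w ∧ (i, -ε) ∈ w

/-- If some index occurred with only one sign, the corresponding coordinate of the degree could not
cancel. This drives the reduction of words of degree `0` to elements of `R`. -/
theorem hasOppositePair_of_wordDeg_eq_zero {w : List (Letter n)} (hw : w ≠ [])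
    (h : wordDeg w = 0) : HasOppositePair w := by
  obtain ⟨⟨i, ε⟩, hi⟩ := List.exists_mem_of_ne_nil w hw
  refine ⟨i, ε, hi, ?_⟩
  by_contra hn
  -- Multiplying the `i`-th coordinate by `ε` treats both signs at once. The weak inequality is
  -- carried along because a tail need not contain `(i, ε)`.
  have key : ∀ u : List (Letter n), (i, -ε) ∉ u →
      0 ≤ (ε : ℤ) * wordDeg u i ∧ ((i, ε) ∈ u → 0 < (ε : ℤ) * wordDeg u i) := by
    intro u
    induction u with
    | nil => simp
    | cons a u ih =>
      intro ha
      simp only [List.mem_cons, not_or] at ha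
      obtain ⟨h0, h1⟩ := ih ha.2
      obtain ⟨j, δ⟩ := a
      by_cases hj : j = i
      · subst hj
        have hδ : δ = ε := by
          by_contra hne
          exact ha.1 (by rw [Int.units_ne_iff_eq_neg.mp hne])
        subst hδ
        have e : (δ : ℤ) * wordDeg ((j, δ) :: u) j = 1 + δ * wordDeg u j := by
          simp [wordDeg_cons, mul_add]
        rw [e]
        exact ⟨by omega, fun _ => by omega⟩
      · have e : wordDeg ((j, δ) :: u) i = wordDeg u i := by
          simp [wordDeg_cons, Ne.symm hj]
        rw [e]
        refine ⟨h0, fun hm => h1 ?_⟩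
        rcases List.mem_cons.mp hm with hm | hm
        · exact absurd (congrArg Prod.fst hm).symm hj
        · exact hm
  have := (key w hn).2 hi
  simp [h] at this

end Words

/-! ### Powers of commuting automorphisms -/

section AutPow

/-- Only the commutation of the `f i` with the `g j` matters: the first `g` is moved past the
remaining `f`, and the order within each family is kept. -/
theorem List.prod_ofFn_mul_of_commute {M : Type*} [Monoid M] {n : ℕ} {f g : Fin n → M}
    (h : ∀ i j, Commute (f i) (g j)) :
    (List.ofFn fun i => f i * g i).prod = (List.ofFn f).prod * (List.ofFn g).prod := by
  induction n with
  | zero => simp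
  | succ n ih =>
    simp only [List.ofFn_succ, List.prod_cons]
    rw [ih fun i j => h _ _]
    have : Commute (List.ofFn fun i : Fin n => f i.succ).prod (g 0) := by
      apply Commute.list_prod_left
      intro x hx
      obtain ⟨i, rfl⟩ := (List.mem_ofFn' _ _).mp hx
      exact h _ _
    rw [mul_assoc, mul_assoc, ← mul_assoc (g 0), ← this.eq, mul_assoc]

theorem List.prod_ofFn_eq_of_forall_ne {M : Type*} [Monoid M] {n : ℕ} {f : Fin n → M} (i : Fin n)
    (h : ∀ j, j ≠ i → f j = 1) : (List.ofFn f).prod = f i := by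
  induction n with
  | zero => exact i.elim0
  | succ n ih =>
    rw [List.ofFn_succ, List.prod_cons]
    by_cases hi : i = 0
    · subst hi
      rw [List.prod_eq_one, mul_one]
      intro x hx
      obtain ⟨j, rfl⟩ := (List.mem_ofFn' _ _).mp hx
      exact h _ (Fin.succ_ne_zero j)
    · obtain ⟨i', rfl⟩ := Fin.exists_succ_eq.mpr hi
      rw [h 0 (Fin.succ_ne_zero i').symm, one_mul]
      exact ih i' fun j hj => h _ fun e => hj (Fin.succ_injective _ e)

variable {k : Type*} [Field k] {R : Type*} [Ring R] [Algebra k R] {n : ℕ}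
  {f : Fin n → (R ≃ₐ[k] R)}

theorem autPow_zero : autPow f 0 = 1 :=
  List.prod_eq_one fun x hx => by
    obtain ⟨i, rfl⟩ := (List.mem_ofFn' _ _).mp hx
    simp

theorem autPow_single (i : Fin n) (e : ℤ) : autPow f (Pi.single i e) = f i ^ e := by
  rw [autPow, List.prod_ofFn_eq_of_forall_ne i fun j hj => by simp [hj]]
  simp

theorem autPow_add (hf : ∀ i j, Commute (f i) (f j)) (α β : Fin n → ℤ) :
    autPow f (α + β) = autPow f α * autPow f β := by
  simp only [autPow, Pi.add_apply, zpow_add]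
  exact List.prod_ofFn_mul_of_commute fun i j => (hf i j).zpow_zpow _ _

theorem Commute.autPow_right {φ : R ≃ₐ[k] R} (h : ∀ i, Commute φ (f i)) (α : Fin n → ℤ) :
    Commute φ (autPow f α) := by
  apply Commute.list_prod_right
  intro x hx
  obtain ⟨i, rfl⟩ := (List.mem_ofFn' _ _).mp hx
  exact (h i).zpow_right _

theorem autPow_wordDeg_cons (hf : ∀ i j, Commute (f i) (f j)) (a : Letter n)
    (u : List (Letter n)) (r : R) :
    autPow f (wordDeg (a :: u)) r = (f a.1 ^ (a.2 : ℤ)) (autPow f (wordDeg u) r) := by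
  rw [wordDeg_cons, autPow_add hf, autPow_single, AlgEquiv.mul_apply]

/-- Eigenvectors of the automorphisms are eigenvectors of their powers. -/
theorem AlgEquiv.zpow_apply_eq_smul {φ : R ≃ₐ[k] R} {x : R} {c : kˣ} (h : φ x = (c : k) • x)
    (z : ℤ) : (φ ^ z) x = ((c ^ z : kˣ) : k) • x := by
  have hinv : φ⁻¹ x = ((c⁻¹ : kˣ) : k) • x := by
    apply φ.injective
    rw [map_smul, h, smul_smul, ← Units.val_mul, inv_mul_cancel, Units.val_one, one_smul,
      ← AlgEquiv.mul_apply, mul_inv_cancel, AlgEquiv.one_apply]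
  induction z with
  | zero => simp
  | succ z ih =>
    rw [zpow_add_one, AlgEquiv.mul_apply, h, map_smul, ih, smul_smul, ← Units.val_mul,
      zpow_add_one, mul_comm]
  | pred z ih =>
    rw [zpow_sub_one, AlgEquiv.mul_apply, hinv, map_smul, ih, smul_smul, ← Units.val_mul,
      zpow_sub_one, mul_comm]

end AutPow

namespace TGWD

variable {k : Type*} [Field k] {R : Type*} [Ring R] [Algebra k R] {n : ℕ}

namespace TGWC

/-! ### Universal property of the construction -/

section Lift

variable {D : TGWD k R n} {μ : Matrix (Fin n) (Fin n) kˣ} {A : Type*} [Ring A] [Algebra k A]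

/-- The relations of the twisted generalized Weyl construction, for a homomorphism `φ : R → A` and
elements `xᵢ^ε` of `A`. -/
structure Satisfies (D : TGWD k R n) (μ : Matrix (Fin n) (Fin n) kˣ) (φ : R →ₐ[k] A)
    (x : Fin n → ℤˣ → A) : Prop where
  mul_base : ∀ i ε r, x i ε * φ r = φ ((D.σ i ^ (ε : ℤ)) r) * x i ε
  neg_pos : ∀ i, x i (-1) * x i 1 = φ (D.t i)
  pos_neg : ∀ i, x i 1 * x i (-1) = φ (D.σ i (D.t i))
  pos_neg_of_ne : ∀ i j, i ≠ j → x i 1 * x j (-1) = (μ i j : k) • (x j (-1) * x i 1)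

variable (D μ) in
theorem satisfies : Satisfies D μ (base D μ) (X D μ) where
  mul_base := X_mul_base D μ
  neg_pos i := by
    change mk D μ _ * mk D μ _ = mk D μ _
    rw [← map_mul]
    exact mk_rel (.neg_pos i)
  pos_neg i := by
    change mk D μ _ * mk D μ _ = mk D μ _
    rw [← map_mul]
    exact mk_rel (.pos_neg i)
  pos_neg_of_ne i j h := by
    change mk D μ _ * mk D μ _ = (μ i j : k) • (mk D μ _ * mk D μ _)
    rw [← map_mul, ← map_mul, ← map_smul]
    exact mk_rel (.pos_neg_of_ne i j h)

theorem Satisfies.liftFree_rel {φ : R →ₐ[k] A} {x : Fin n → ℤˣ → A} (h : Satisfies D μ φ x)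
    ⦃a b : FreeAlgebra k (R ⊕ Letter n)⦄ (hab : D.Rel μ a b) :
    FreeAlgebra.lift k (Sum.elim φ fun a : Letter n => x a.1 a.2) a =
      FreeAlgebra.lift k (Sum.elim φ fun a : Letter n => x a.1 a.2) b := by
  cases hab with
  | base_add r s => simp [freeBase]
  | base_mul r s => simp [freeBase]
  | base_scalar c => simp [freeBase]
  | X_base i ε r => simpa [freeBase, freeX] using h.mul_base i ε r
  | neg_pos i => simpa [freeBase, freeX] using h.neg_pos i
  | pos_neg i => simpa [freeBase, freeX] using h.pos_neg i
  | pos_neg_of_ne i j hij => simpa [freeBase, freeX] using h.pos_neg_of_ne i j hij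

/-- The universal property of the twisted generalized Weyl construction. -/
noncomputable def lift {φ : R →ₐ[k] A} {x : Fin n → ℤˣ → A} (h : Satisfies D μ φ x) :
    D.TGWC μ →ₐ[k] A :=
  (RingQuot.liftAlgHom k ⟨FreeAlgebra.lift k (Sum.elim φ fun a : Letter n => x a.1 a.2),
    h.liftFree_rel⟩ : RingQuot (D.Rel μ) →ₐ[k] A)

@[simp] theorem lift_base {φ : R →ₐ[k] A} {x : Fin n → ℤˣ → A} (h : Satisfies D μ φ x) (r : R) :
    lift h (base D μ r) = φ r :=
  (RingQuot.liftAlgHom_mkAlgHom_apply k _ _ _).trans (by simp [freeBase])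

@[simp] theorem lift_X {φ : R →ₐ[k] A} {x : Fin n → ℤˣ → A} (h : Satisfies D μ φ x) (i : Fin n)
    (ε : ℤˣ) : lift h (X D μ i ε) = x i ε :=
  (RingQuot.liftAlgHom_mkAlgHom_apply k _ _ _).trans (by simp [freeX])

/-- Letters of opposite sign and different index commute up to a scalar. -/
theorem Satisfies.exists_mul_eq_smul {φ : R →ₐ[k] A} {x : Fin n → ℤˣ → A} (h : Satisfies D μ φ x)
    {i j : Fin n} (hij : i ≠ j) (ε : ℤˣ) : ∃ c : k, x i ε * x j (-ε) = c • (x j (-ε) * x i ε) := by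
  rcases Int.units_eq_one_or ε with rfl | rfl
  · exact ⟨_, h.pos_neg_of_ne i j hij⟩
  · refine ⟨((μ j i)⁻¹ : kˣ), ?_⟩
    rw [neg_neg, h.pos_neg_of_ne j i hij.symm, smul_smul, ← Units.val_mul, inv_mul_cancel,
      Units.val_one, one_smul]

end Lift

/-! ### Spanning sets and induction principles -/

section Span

variable (D : TGWD k R n) (μ : Matrix (Fin n) (Fin n) kˣ)

/-- Makes the automorphism explicit and shows that it depends on the word only through its degree,
so that it makes sense for homogeneous elements. -/
theorem wordProd_mul_base_eq (u : List (Letter n)) (r : R) :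
    wordProd (X D μ) u * base D μ r =
      base D μ (autPow D.σ (wordDeg u) r) * wordProd (X D μ) u := by
  induction u with
  | nil => simp [autPow_zero]
  | cons a u ih =>
    rw [wordProd_cons, autPow_wordDeg_cons D.commute, mul_assoc, ih, ← mul_assoc, X_mul_base,
      mul_assoc]

variable {D μ}

/-- Induction over the spanning set of a homogeneous component. -/
theorem gr_induction {g : Fin n → ℤ} {p : D.TGWC μ → Prop}
    (mem : ∀ r u, wordDeg u = g → p (base D μ r * wordProd (X D μ) u)) (zero : p 0)
    (add : ∀ x y, p x → p y → p (x + y)) (smul : ∀ (c : k) x, p x → p (c • x))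
    {x : D.TGWC μ} (hx : x ∈ gr D μ g) : p x := by
  induction hx using Submodule.span_induction with
  | mem x hx => obtain ⟨r, u, hu, rfl⟩ := hx; exact mem r u hu
  | zero => exact zero
  | add x y _ _ hx hy => exact add x y hx hy
  | smul c x _ hx => exact smul c x hx

/-- Induction over homogeneous elements. -/
theorem homogeneous_induction {p : D.TGWC μ → Prop} (mem : ∀ g, ∀ x ∈ gr D μ g, p x)
    (add : ∀ x y, p x → p y → p (x + y)) (x : D.TGWC μ) : p x := by
  induction x using DirectSum.Decomposition.inductionOn (gr D μ) with
  | zero => exact mem 0 0 (zero_mem _)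
  | homogeneous x => exact mem _ x x.2
  | add x y hx hy => exact add x y hx hy

/-- Induction over the spanning set `r X_u`. -/
theorem span_induction {p : D.TGWC μ → Prop} (mem : ∀ r u, p (base D μ r * wordProd (X D μ) u))
    (add : ∀ x y, p x → p y → p (x + y)) (smul : ∀ (c : k) x, p x → p (c • x))
    (x : D.TGWC μ) : p x :=
  homogeneous_induction (fun _ _ hx => gr_induction (fun r u _ => mem r u)
    (by simpa using mem 0 []) add smul hx) add x

theorem base_mul_wordProd_mem (r : R) (u : List (Letter n)) :
    base D μ r * wordProd (X D μ) u ∈ gr D μ (wordDeg u) :=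
  Submodule.subset_span ⟨r, u, rfl, rfl⟩

/-- The induction principle for generators. -/
theorem generator_induction {p : D.TGWC μ → Prop} (hbase : ∀ r, p (base D μ r))
    (hX : ∀ i ε, p (X D μ i ε)) (mul : ∀ x y, p x → p y → p (x * y))
    (add : ∀ x y, p x → p y → p (x + y)) (x : D.TGWC μ) : p x := by
  refine span_induction (fun r u => mul _ _ (hbase r) ?_) add (fun c x hx => ?_) x
  · induction u with
    | nil => simpa using hbase 1
    | cons a u ih => rw [wordProd_cons]; exact mul _ _ (hX _ _) ih
  -- Scalars are images of elements of `R`, so closure under scalar multiplication follows from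
  -- closure under products.
  · rw [Algebra.smul_def, ← AlgHom.commutes (base D μ)]
    exact mul _ _ (hbase _) hx

/-- Homogeneous elements commute with central elements of `R` up to the grading automorphism. -/
theorem mul_base_of_mem {g : Fin n → ℤ} {x : D.TGWC μ} (hx : x ∈ gr D μ g) {t : R}
    (ht : t ∈ Subalgebra.center k R) :
    x * base D μ t = base D μ (autPow D.σ g t) * x := by
  refine gr_induction (p := fun x => x * base D μ t = base D μ (autPow D.σ g t) * x)
    (fun r u hu => ?_) (by simp) (fun x y hx hy => ?_) (fun c x hx => ?_) hx
  -- An automorphism maps the center to itself, so the twisted `t` may be moved past the coefficient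
  -- `r`.
  · have : autPow D.σ g t * r = r * autPow D.σ g t := by
      obtain ⟨r', rfl⟩ := (autPow D.σ g).surjective r
      rw [← map_mul, ← map_mul, (Subalgebra.mem_center_iff.mp ht r')]
    rw [mul_assoc, wordProd_mul_base_eq, hu, ← mul_assoc, ← map_mul, ← this, map_mul, mul_assoc]
  · rw [add_mul, hx, hy, mul_add]
  · rw [smul_mul_assoc, hx, mul_smul_comm]

end Span

/-! ### The component of degree zero -/

section DegreeZero

theorem _root_.Int.units_ne_neg_self (ε : ℤˣ) : ε ≠ -ε := by
  rcases Int.units_eq_one_or ε with rfl | rfl <;> decide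

variable {D : TGWD k R n} {μ : Matrix (Fin n) (Fin n) kˣ}

/-- A letter commutes up to a scalar with a word of letters of opposite sign and different index. -/
theorem X_mul_wordProd {a : Letter n} {u : List (Letter n)}
    (h : ∀ b ∈ u, a.1 ≠ b.1 ∧ b.2 = -a.2) :
    ∃ c : k, X D μ a.1 a.2 * wordProd (X D μ) u = c • (wordProd (X D μ) u * X D μ a.1 a.2) := by
  induction u with
  | nil => exact ⟨1, by simp⟩
  | cons b u ih =>
    obtain ⟨c, hc⟩ := ih fun b hb => h b (List.mem_cons_of_mem _ hb)
    obtain ⟨hb1, hb2⟩ := h b List.mem_cons_self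
    obtain ⟨c', hc'⟩ := (satisfies D μ).exists_mul_eq_smul hb1 a.2
    refine ⟨c' * c, ?_⟩
    rw [wordProd_cons, hb2, ← mul_assoc, hc', smul_mul_assoc, mul_assoc, hc, mul_smul_comm,
      smul_smul, mul_assoc]

/-- Mirror image of `X_mul_wordProd`. The scalars are not recorded as units, so each direction has
to be provided separately; the same holds in `wordProd_sort`. -/
theorem wordProd_mul_X {a : Letter n} {u : List (Letter n)}
    (h : ∀ b ∈ u, a.1 ≠ b.1 ∧ b.2 = -a.2) :
    ∃ c : k, wordProd (X D μ) u * X D μ a.1 a.2 = c • (X D μ a.1 a.2 * wordProd (X D μ) u) := by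
  induction u with
  | nil => exact ⟨1, by simp⟩
  | cons b u ih =>
    obtain ⟨c, hc⟩ := ih fun b hb => h b (List.mem_cons_of_mem _ hb)
    obtain ⟨hb1, hb2⟩ := h b List.mem_cons_self
    obtain ⟨c', hc'⟩ := (satisfies D μ).exists_mul_eq_smul hb1.symm b.2
    rw [hb2, neg_neg] at hc'
    refine ⟨c * c', ?_⟩
    rw [wordProd_cons, hb2, mul_assoc, hc, mul_smul_comm, ← mul_assoc, hc', smul_mul_assoc,
      smul_smul, mul_assoc]

/-- A word without opposite pairs can be sorted by sign, up to a scalar, in both directions. -/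
theorem wordProd_sort {u : List (Letter n)} (hu : ¬ HasOppositePair u) (ε : ℤˣ) :
    (∃ c : k, wordProd (X D μ) u =
      c • (wordProd (X D μ) (u.filter (·.2 = -ε)) * wordProd (X D μ) (u.filter (·.2 = ε)))) ∧
    (∃ c : k, wordProd (X D μ) (u.filter (·.2 = -ε)) * wordProd (X D μ) (u.filter (·.2 = ε)) =
      c • wordProd (X D μ) u) := by
  induction u with
  | nil => exact ⟨⟨1, by simp⟩, ⟨1, by simp⟩⟩
  | cons a u ih =>
    obtain ⟨⟨c, hc⟩, ⟨d, hd⟩⟩ := ih fun ⟨i, δ, h1, h2⟩ =>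
      hu ⟨i, δ, List.mem_cons_of_mem _ h1, List.mem_cons_of_mem _ h2⟩
    by_cases ha : a.2 = ε
    · have hne : a.2 ≠ -ε := by rw [ha]; exact Int.units_ne_neg_self ε
      -- A letter of sign `-ε` with the index of `a` would form an opposite pair with `a`. So `a`
      -- can be moved past all letters of sign `-ε`.
      have hw : ∀ b ∈ u.filter (·.2 = -ε), a.1 ≠ b.1 ∧ b.2 = -a.2 := by
        intro b hb
        obtain ⟨hbu, hb⟩ := List.mem_filter.mp hb
        have hb' : b.2 = -ε := by simpa using hb
        refine ⟨fun e => hu ⟨a.1, a.2, List.mem_cons_self, List.mem_cons_of_mem _ ?_⟩,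
          by rw [hb', ha]⟩
        rw [ha, ← hb', e]
        exact hbu
      obtain ⟨p, hp⟩ := X_mul_wordProd (D := D) (μ := μ) hw
      obtain ⟨p', hp'⟩ := wordProd_mul_X (D := D) (μ := μ) hw
      have h1 : (a :: u).filter (·.2 = -ε) = u.filter (·.2 = -ε) := by simp [hne]
      have h2 : (a :: u).filter (·.2 = ε) = a :: u.filter (·.2 = ε) := by simp [ha]
      rw [h1, h2]
      constructor
      · refine ⟨c * p, ?_⟩
        rw [wordProd_cons, hc, mul_smul_comm, ← mul_assoc, hp, smul_mul_assoc, smul_smul,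
          mul_assoc, wordProd_cons]
      · refine ⟨p' * d, ?_⟩
        rw [wordProd_cons, ← mul_assoc, hp', smul_mul_assoc, mul_assoc, hd, mul_smul_comm,
          smul_smul, ← wordProd_cons]
    -- Here `a` already belongs at the front, and no letter has to be moved.
    · have ha' : a.2 = -ε := Int.units_ne_iff_eq_neg.mp ha
      have hne : (-ε) ≠ ε := fun h => Int.units_ne_neg_self ε h.symm
      simp only [List.filter_cons, ha', hne, decide_false, Bool.false_eq_true, if_false,
        decide_true, if_true]
      constructor
      · refine ⟨c, ?_⟩
        rw [wordProd_cons, hc, mul_smul_comm, wordProd_cons, mul_assoc]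
      · refine ⟨d, ?_⟩
        rw [wordProd_cons, mul_assoc, hd, mul_smul_comm, wordProd_cons]

/-- Opposite letters cancel. -/
theorem exists_X_mul_X_neg (i : Fin n) (ε : ℤˣ) :
    ∃ r, X D μ i ε * X D μ i (-ε) = base D μ r := by
  rcases Int.units_eq_one_or ε with rfl | rfl
  · exact ⟨_, (satisfies D μ).pos_neg i⟩
  · exact ⟨_, (satisfies D μ).neg_pos i⟩

/-- Generators of equal sign need not commute, so the outer letters cannot simply pass the word.
Instead it is sorted as `N * P`, with signs `-ε` in `N` and `ε` in `P`: `Xᵢ^ε` passes `N`, `Xᵢ^{-ε}`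
passes `P`, they meet and collapse to an element of `R`, which is moved out past `N`; then `N * P`
is unsorted. -/
theorem X_mul_wordProd_mul_X_neg {u : List (Letter n)} (hu : ¬ HasOppositePair u) {i : Fin n}
    (hi : ∀ b ∈ u, i ≠ b.1) (ε : ℤˣ) :
    ∃ r, X D μ i ε * (wordProd (X D μ) u * X D μ i (-ε)) = base D μ r * wordProd (X D μ) u := by
  obtain ⟨⟨c, hc⟩, ⟨d, hd⟩⟩ := wordProd_sort (D := D) (μ := μ) hu ε
  obtain ⟨r, hr⟩ := exists_X_mul_X_neg (D := D) (μ := μ) i ε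
  obtain ⟨p, hp⟩ := X_mul_wordProd (D := D) (μ := μ) (a := (i, ε)) (u := u.filter (·.2 = -ε))
    fun b hb => ⟨hi b (List.mem_filter.mp hb).1, by simpa using (List.mem_filter.mp hb).2⟩
  obtain ⟨p', hp'⟩ := wordProd_mul_X (D := D) (μ := μ) (a := (i, -ε)) (u := u.filter (·.2 = ε))
    fun b hb => ⟨hi b (List.mem_filter.mp hb).1, by simpa using (List.mem_filter.mp hb).2⟩
  simp only at hp hp'
  set N := wordProd (X D μ) (u.filter (·.2 = -ε))
  set P := wordProd (X D μ) (u.filter (·.2 = ε))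
  refine ⟨(c * p' * p * d) • autPow D.σ (wordDeg (u.filter (·.2 = -ε))) r, ?_⟩
  calc X D μ i ε * (wordProd (X D μ) u * X D μ i (-ε))
      = c • (X D μ i ε * (N * (P * X D μ i (-ε)))) := by
        rw [hc, smul_mul_assoc, mul_smul_comm, mul_assoc]
    _ = (c * p') • ((X D μ i ε * N) * X D μ i (-ε) * P) := by
        rw [hp']; simp only [mul_smul_comm, smul_smul, mul_assoc]
    _ = (c * p' * p) • (N * (X D μ i ε * X D μ i (-ε)) * P) := by
        rw [hp]; simp only [smul_mul_assoc, smul_smul, mul_assoc]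
    _ = (c * p' * p) • (base D μ (autPow D.σ (wordDeg (u.filter (·.2 = -ε))) r) * (N * P)) := by
        rw [hr, wordProd_mul_base_eq]; simp only [P, N, mul_assoc]
    _ = _ := by rw [hd, mul_smul_comm, smul_smul, map_smul, smul_mul_assoc]

/-- A word with an opposite pair can be shortened. -/
theorem exists_shorter {w : List (Letter n)} (hw : HasOppositePair w) :
    ∃ r w', wordProd (X D μ) w = base D μ r * wordProd (X D μ) w' ∧ w'.length < w.length ∧
      wordDeg w' = wordDeg w := by
  induction w with
  | nil => obtain ⟨i, ε, h, -⟩ := hw; simp at h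
  | cons a w ih =>
    by_cases h : HasOppositePair w
    · obtain ⟨r, w', h1, h2, h3⟩ := ih h
      refine ⟨(D.σ a.1 ^ (a.2 : ℤ)) r, a :: w', ?_, by simpa using h2, ?_⟩
      · rw [wordProd_cons, h1, ← mul_assoc, X_mul_base, mul_assoc, wordProd_cons]
      · rw [wordDeg_cons, h3, wordDeg_cons]
    -- The tail has no opposite pair, so the pair must involve the first letter. The next line
    -- splits the tail at the first occurrence of the opposite letter.
    · have hmem : (a.1, -a.2) ∈ w := by
        obtain ⟨i, ε, h1, h2⟩ := hw
        rcases List.mem_cons.mp h1 with h1 | h1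
        · subst h1
          rcases List.mem_cons.mp h2 with h2 | h2
          · exact absurd (congrArg Prod.snd h2).symm (Int.units_ne_neg_self ε)
          · exact h2
        · rcases List.mem_cons.mp h2 with h2 | h2
          · subst h2
            simpa using h1
          · exact absurd ⟨i, ε, h1, h2⟩ h
      obtain ⟨p, s, rfl, hap⟩ := List.eq_append_cons_of_mem hmem
      -- A letter of index `a.1` before the split has neither sign: `-a.2` is excluded by the choice
      -- of the first occurrence, `a.2` because it would give an opposite pair in the tail.
      have hp : ∀ b ∈ p, a.1 ≠ b.1 := by
        rintro ⟨i, δ⟩ hb rfl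
        by_cases hδ : δ = -a.2
        · subst hδ
          exact hap hb
        · have hδ' : δ = a.2 := by rw [Int.units_ne_iff_eq_neg.mp hδ, neg_neg]
          subst hδ'
          exact h ⟨a.1, a.2, List.mem_append_left _ hb, hmem⟩
      obtain ⟨r, hr⟩ := X_mul_wordProd_mul_X_neg (D := D) (μ := μ) (u := p)
        (fun ⟨i, ε, h1, h2⟩ => h ⟨i, ε, List.mem_append_left _ h1, List.mem_append_left _ h2⟩)
        hp a.2
      refine ⟨r, p ++ s, ?_, by simp, ?_⟩
      · rw [wordProd_cons, wordProd_append, wordProd_cons, wordProd_append,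
          ← mul_assoc (wordProd _ p), ← mul_assoc, hr, mul_assoc]
      · simp only [wordDeg_cons, wordDeg_append, Units.val_neg, Pi.single_neg]
        abel

/-- The component of degree `0` is the image of `R`. -/
theorem wordProd_mem_range (w : List (Letter n)) (hw : wordDeg w = 0) :
    ∃ r, wordProd (X D μ) w = base D μ r := by
  induction h : w.length using Nat.strong_induction_on generalizing w with
  | _ N ih =>
    by_cases hnil : w = []
    · exact ⟨1, by simp [hnil]⟩
    · obtain ⟨r, w', h1, h2, h3⟩ := exists_shorter (D := D) (μ := μ)
        (hasOppositePair_of_wordDeg_eq_zero hnil hw)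
      obtain ⟨r', hr'⟩ := ih _ (h ▸ h2) w' (h3.trans hw) rfl
      exact ⟨r * r', by rw [h1, hr', map_mul]⟩

/-- Brings the degree `0` components tested by the canonical ideal into `R`, where regularity and
consistency apply. -/
theorem exists_eq_base {x : D.TGWC μ} (hx : x ∈ gr D μ 0) : ∃ r, x = base D μ r := by
  refine gr_induction (p := fun x => ∃ r, x = base D μ r) (fun r u hu => ?_) ⟨0, by simp⟩ ?_ ?_ hx
  · obtain ⟨r', hr'⟩ := wordProd_mem_range (D := D) (μ := μ) u hu
    exact ⟨r * r', by rw [hr', map_mul]⟩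
  · rintro _ _ ⟨r, rfl⟩ ⟨s, rfl⟩
    exact ⟨r + s, by simp⟩
  · rintro c _ ⟨r, rfl⟩
    exact ⟨c • r, by simp⟩

end DegreeZero
end TGWC
end TGWD

namespace TGWD

variable {k : Type*} [Field k] {R : Type*} [Ring R] [Algebra k R] {n : ℕ}

namespace TGWC

/-! ### Homogeneous components -/

section Projections

variable (D : TGWD k R n) (μ : Matrix (Fin n) (Fin n) kˣ)

/-- The projection onto a homogeneous component. -/
noncomputable def proj (g : Fin n → ℤ) : D.TGWC μ →ₗ[k] D.TGWC μ := GradedAlgebra.proj (gr D μ) g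

variable {D μ}

theorem proj_mem (g : Fin n → ℤ) (x : D.TGWC μ) : proj D μ g x ∈ gr D μ g :=
  SetLike.coe_mem (DirectSum.decompose (gr D μ) x g)

theorem proj_of_mem {g : Fin n → ℤ} {x : D.TGWC μ} (hx : x ∈ gr D μ g) : proj D μ g x = x :=
  DirectSum.decompose_of_mem_same _ hx

theorem proj_of_mem_ne {g h : Fin n → ℤ} {x : D.TGWC μ} (hx : x ∈ gr D μ g) (hgh : g ≠ h) :
    proj D μ h x = 0 :=
  DirectSum.decompose_of_mem_ne _ hx hgh

theorem mul_mem_gr {g h : Fin n → ℤ} {x y : D.TGWC μ} (hx : x ∈ gr D μ g) (hy : y ∈ gr D μ h) :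
    x * y ∈ gr D μ (g + h) := SetLike.mul_mem_graded hx hy

theorem proj_mul_left {h : Fin n → ℤ} {b : D.TGWC μ} (hb : b ∈ gr D μ h) (g : Fin n → ℤ)
    (x : D.TGWC μ) : proj D μ (h + g) (b * x) = b * proj D μ g x := by
  induction x using homogeneous_induction with
  | mem l x hx =>
    by_cases hl : l = g
    · subst hl
      rw [proj_of_mem hx, proj_of_mem (mul_mem_gr hb hx)]
    · rw [proj_of_mem_ne hx hl, mul_zero,
        proj_of_mem_ne (mul_mem_gr hb hx) fun e => hl (add_left_cancel e)]
  | add x y hx hy => rw [mul_add, map_add, hx, hy, map_add, mul_add]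

theorem proj_mul_right {h : Fin n → ℤ} {c : D.TGWC μ} (hc : c ∈ gr D μ h) (g : Fin n → ℤ)
    (x : D.TGWC μ) : proj D μ (g + h) (x * c) = proj D μ g x * c := by
  induction x using homogeneous_induction with
  | mem l x hx =>
    by_cases hl : l = g
    · subst hl
      rw [proj_of_mem hx, proj_of_mem (mul_mem_gr hx hc)]
    · rw [proj_of_mem_ne hx hl, zero_mul,
        proj_of_mem_ne (mul_mem_gr hx hc) fun e => hl (add_right_cancel e)]
  | add x y hx hy => rw [add_mul, map_add, hx, hy, map_add, add_mul]

/-- An element is determined by its homogeneous components. -/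
theorem mem_of_forall_proj_mem {N : AddSubmonoid (D.TGWC μ)} {x : D.TGWC μ}
    (h : ∀ g, proj D μ g x ∈ N) : x ∈ N := by
  classical
  rw [← DirectSum.sum_support_decompose (gr D μ) x]
  exact sum_mem fun g _ => h g

theorem map_proj {R' : Type*} [Ring R'] [Algebra k R'] {E : TGWD k R' n}
    {ν : Matrix (Fin n) (Fin n) kˣ} {f : D.TGWC μ →ₗ[k] E.TGWC ν}
    (hf : ∀ g, ∀ x ∈ gr D μ g, f x ∈ gr E ν g) (g : Fin n → ℤ) (x : D.TGWC μ) :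
    f (proj D μ g x) = proj E ν g (f x) := by
  induction x using homogeneous_induction with
  | mem l x hx =>
    by_cases hl : l = g
    · subst hl
      rw [proj_of_mem hx, proj_of_mem (hf _ _ hx)]
    · rw [proj_of_mem_ne hx hl, proj_of_mem_ne (hf _ _ hx) hl, map_zero]
  | add x y hx hy => simp only [map_add, hx, hy]

end Projections

/-! ### The canonical ideal: criterion, consistency and cancellation -/

section CanonicalIdeal

variable {D : TGWD k R n} {μ : Matrix (Fin n) (Fin n) kˣ}

/-- The projection is additive, and it vanishes on each summand because the summand is homogeneous
with no nonzero elements of degree `0`. So the sum inherits the defining property. -/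
theorem proj_zero_eq_zero_of_mem {x : D.TGWC μ} (hx : x ∈ D.canonicalIdeal μ) :
    proj D μ 0 x = 0 := by
  rw [canonicalIdeal, sSup_eq_iSup'] at hx
  refine Submodule.iSup_induction _ (motive := fun x => proj D μ 0 x = 0) hx ?_ (map_zero _) ?_
  · intro J y hyJ
    obtain ⟨-, hJ, hJ0⟩ := J.2
    exact hJ0 _ (hJ 0 hyJ) (proj_mem 0 y)
  · intro x y hx hy
    rw [map_add, hx, hy, add_zero]

/-- If all two-sided multiples of `x` have zero component in degree `0`, the same holds for the
homogeneous components of `x`. -/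
theorem proj_zero_mul_proj_mul {x : D.TGWC μ} (hx : ∀ b c, proj D μ 0 (b * x * c) = 0)
    (g : Fin n → ℤ) (b c : D.TGWC μ) : proj D μ 0 (b * proj D μ g x * c) = 0 := by
  induction b using homogeneous_induction with
  | mem h b hb =>
    induction c using homogeneous_induction with
    | mem l c hc =>
      -- For homogeneous `b`, `c` of degrees `h`, `l`, the element `b x_g c` is the component of `b
      -- x c` of degree `h + g + l`.
      rw [← proj_mul_left hb, ← proj_mul_right hc]
      by_cases e : h + g + l = 0
      · rw [e, hx, map_zero]
      · exact proj_of_mem_ne (proj_mem _ _) e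
    | add x y hx hy => rw [mul_add, map_add, hx, hy, add_zero]
  | add x y hx hy => rw [add_mul, add_mul, map_add, hx, hy, add_zero]

/-- The elements satisfying the criterion form a homogeneous two-sided ideal, and `b = c = 1` shows
that it meets degree `0` trivially. So it is one of the ideals being summed, and it contains all of
them. -/
theorem mem_canonicalIdeal_iff {x : D.TGWC μ} :
    x ∈ D.canonicalIdeal μ ↔ ∀ b c, proj D μ 0 (b * x * c) = 0 := by
  refine ⟨fun hx b c => proj_zero_eq_zero_of_mem
    (Ideal.mul_mem_right c _ (Ideal.mul_mem_left _ b hx)), fun hx => ?_⟩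
  let K : Ideal (D.TGWC μ) :=
    { carrier := {x | ∀ b c, proj D μ 0 (b * x * c) = 0}
      add_mem' := fun hx hy b c => by rw [mul_add, add_mul, map_add, hx, hy, add_zero]
      zero_mem' := fun b c => by simp
      smul_mem' := fun a x hx b c => by
        rw [smul_eq_mul, ← mul_assoc b a x]
        exact hx _ _ }
  have hK : K.IsTwoSided ∧ K.IsHomogeneous (gr D μ) ∧ ∀ x ∈ K, x ∈ gr D μ 0 → x = 0 := by
    refine ⟨⟨fun {a} b ha d c => ?_⟩, fun g a ha => proj_zero_mul_proj_mul ha g,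
      fun a ha ha0 => ?_⟩
    · rw [← mul_assoc, mul_assoc _ b c]
      exact ha d (b * c)
    · have := ha 1 1
      rwa [one_mul, mul_one, proj_of_mem ha0] at this
  exact (le_sSup hK : K ≤ D.canonicalIdeal μ) hx

theorem proj_mem_canonicalIdeal {x : D.TGWC μ} (hx : x ∈ D.canonicalIdeal μ) (g : Fin n → ℤ) :
    proj D μ g x ∈ D.canonicalIdeal μ :=
  mem_canonicalIdeal_iff.mpr (proj_zero_mul_proj_mul (mem_canonicalIdeal_iff.mp hx) g)

theorem eq_zero_of_mem_canonicalIdeal {x : D.TGWC μ} (hx : x ∈ D.canonicalIdeal μ)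
    (hx0 : x ∈ gr D μ 0) : x = 0 := by
  rw [← proj_of_mem hx0, proj_zero_eq_zero_of_mem hx]

theorem _root_.TGWD.TGWA.mk_eq_zero_iff {x : D.TGWC μ} :
    TGWA.mk D μ x = 0 ↔ x ∈ D.canonicalIdeal μ := Ideal.Quotient.eq_zero_iff_mem

variable (D μ) in
theorem _root_.TGWD.TGWA.mk_surjective : Function.Surjective (TGWA.mk D μ) :=
  Ideal.Quotient.mk_surjective

/-- The canonical ideal meets degree `0` only in `0`, so passing to the quotient kills nothing
further in the image of `R`. -/
theorem _root_.TGWD.isConsistent_iff_injective :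
    D.IsConsistent μ ↔ Function.Injective (base D μ) := by
  refine ⟨fun h => Function.Injective.of_comp (f := TGWA.mk D μ) h, fun h => ?_⟩
  rw [IsConsistent, injective_iff_map_eq_zero]
  intro r hr
  exact (map_eq_zero_iff _ h).mp
    (eq_zero_of_mem_canonicalIdeal (TGWA.mk_eq_zero_iff.mp hr) (base_mem D μ r))

/-- Graded surjective homomorphisms preserve the canonical ideals. -/
theorem map_mem_canonicalIdeal {f : D.TGWC μ →ₐ[k] D.TGWC μ} (hs : Function.Surjective f)
    (hf : ∀ g, ∀ x ∈ gr D μ g, f x ∈ gr D μ g) {x : D.TGWC μ} (hx : x ∈ D.canonicalIdeal μ) :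
    f x ∈ D.canonicalIdeal μ := by
  rw [mem_canonicalIdeal_iff]
  intro b c
  -- Surjectivity is needed here: the test multipliers must themselves be images.
  obtain ⟨b, rfl⟩ := hs b
  obtain ⟨c, rfl⟩ := hs c
  rw [← map_mul, ← map_mul]
  refine (map_proj (f := f.toLinearMap) hf 0 _).symm.trans ?_
  rw [mem_canonicalIdeal_iff.mp hx, map_zero]

section Regular

theorem _root_.IsRegular.map_algEquiv {R' : Type*} [Ring R'] [Algebra k R'] {t : R}
    (ht : _root_.IsRegular t) (φ : R ≃ₐ[k] R') :
    _root_.IsRegular (φ t) := by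
  constructor
  · intro a b h
    apply φ.symm.injective
    apply ht.left
    apply φ.injective
    simpa using h
  · intro a b h
    apply φ.symm.injective
    apply ht.right
    apply φ.injective
    simpa using h

theorem _root_.Subalgebra.map_mem_center {t : R} (ht : t ∈ Subalgebra.center k R)
    (φ : R ≃ₐ[k] R) : φ t ∈ Subalgebra.center k R := by
  rw [Subalgebra.mem_center_iff] at ht ⊢
  intro r
  obtain ⟨r, rfl⟩ := φ.surjective r
  rw [← map_mul, ht, map_mul]

/-- For `b` of degree `g`, the degree `0` component of `b t x c` is `σ^g(t)` times that of `b x c`.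
The latter lies in `R`, and consistency lets the regular factor be cancelled there. -/
theorem mem_of_base_mul_mem (hμ : D.IsConsistent μ) {t : R} (ht : t ∈ Subalgebra.center k R)
    (hreg : _root_.IsRegular t)
    {x : D.TGWC μ} (hx : base D μ t * x ∈ D.canonicalIdeal μ) : x ∈ D.canonicalIdeal μ := by
  rw [mem_canonicalIdeal_iff] at hx ⊢
  intro b c
  induction b using homogeneous_induction with
  | mem g b hb =>
    have h := hx b c
    rw [← mul_assoc b, mul_base_of_mem hb ht, mul_assoc _ b, mul_assoc,
      ← zero_add (0 : Fin n → ℤ), proj_mul_left (base_mem D μ _)] at h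
    obtain ⟨r, hr⟩ := exists_eq_base (proj_mem 0 (b * x * c))
    rw [hr, ← map_mul, map_eq_zero_iff _ (isConsistent_iff_injective.mp hμ)] at h
    rw [hr]
    -- Pulling `r` back along `σ^g` leaves `t` itself, rather than its image, to be cancelled.
    obtain ⟨r, rfl⟩ := (autPow D.σ g).surjective r
    rw [← map_mul, map_eq_zero_iff _ (autPow D.σ g).injective] at h
    rw [hreg.left.mul_left_eq_zero_iff.mp h, map_zero, map_zero]
  | add x y hx hy => rw [add_mul, add_mul, map_add, hx, hy, add_zero]

/-- On the component of degree `g`, right multiplication by `t` is left multiplication by `σ^g(t)`,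
again central and regular. -/
theorem mem_of_mul_base_mem (hμ : D.IsConsistent μ) {t : R} (ht : t ∈ Subalgebra.center k R)
    (hreg : _root_.IsRegular t)
    {x : D.TGWC μ} (hx : x * base D μ t ∈ D.canonicalIdeal μ) : x ∈ D.canonicalIdeal μ := by
  refine mem_of_forall_proj_mem (N := (D.canonicalIdeal μ).toAddSubmonoid) fun g => ?_
  have h := proj_mem_canonicalIdeal hx (g + 0)
  rw [proj_mul_right (base_mem D μ t), mul_base_of_mem (proj_mem g x) ht] at h
  exact mem_of_base_mul_mem hμ (Subalgebra.map_mem_center ht _) (hreg.map_algEquiv _) h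

theorem exists_X_neg_mul_X (hD : D.IsRegular) (i : Fin n) (ε : ℤˣ) :
    ∃ t ∈ Subalgebra.center k R, _root_.IsRegular t ∧
    X D μ i (-ε) * X D μ i ε = base D μ t := by
  rcases Int.units_eq_one_or ε with rfl | rfl
  · exact ⟨_, D.central i, hD i, (satisfies D μ).neg_pos i⟩
  · exact ⟨_, Subalgebra.map_mem_center (D.central i) _, (hD i).map_algEquiv _,
      (satisfies D μ).pos_neg i⟩

/-- The generators are not left zero divisors modulo the canonical ideal. -/
theorem mem_of_X_mul_mem (hD : D.IsRegular) (hμ : D.IsConsistent μ) {i : Fin n} {ε : ℤˣ}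
    {x : D.TGWC μ}
    (hx : X D μ i ε * x ∈ D.canonicalIdeal μ) : x ∈ D.canonicalIdeal μ := by
  obtain ⟨t, ht, hreg, h⟩ := exists_X_neg_mul_X hD (μ := μ) i ε
  refine mem_of_base_mul_mem hμ ht hreg ?_
  rw [← h, mul_assoc]
  exact Ideal.mul_mem_left _ _ hx

/-- The generators are not right zero divisors modulo the canonical ideal. -/
theorem mem_of_mul_X_mem (hD : D.IsRegular) (hμ : D.IsConsistent μ) {i : Fin n} {ε : ℤˣ}
    {x : D.TGWC μ}
    (hx : x * X D μ i ε ∈ D.canonicalIdeal μ) : x ∈ D.canonicalIdeal μ := by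
  -- The sign is reversed: cancelling on the right uses `Xᵢ^ε Xᵢ^{-ε}`.
  obtain ⟨t, ht, hreg, h⟩ := exists_X_neg_mul_X hD (μ := μ) i (-ε)
  refine mem_of_mul_base_mem hμ ht hreg ?_
  rw [← h, neg_neg, ← mul_assoc]
  exact Ideal.mul_mem_right _ _ hx

end Regular

end CanonicalIdeal

/-! ### Rescaling endomorphisms -/

section Scale

variable {D : TGWD k R n} (μ : Matrix (Fin n) (Fin n) kˣ)

/-- Data of an automorphism of `C_μ(R, σ, t)` which restricts to `R` and rescales the
generators. -/
structure IsScaling (D : TGWD k R n) (φ : R ≃ₐ[k] R) (c : Fin n → ℤˣ → kˣ) : Prop where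
  commute : ∀ i, Commute φ (D.σ i)
  map_t : ∀ i, φ (D.t i) = ((c i (-1) * c i 1 : kˣ) : k) • D.t i

variable {φ : R ≃ₐ[k] R} {c : Fin n → ℤˣ → kˣ}

/-- The eigenvalue condition is what `Xᵢ^- Xᵢ^+ = tᵢ` demands after rescaling, and with the
commutation of `φ` and `σᵢ` it also gives `Xᵢ^+ Xᵢ^- = σᵢ(tᵢ)`. In the relation for `i ≠ j` both
sides scale by the same factor. -/
theorem IsScaling.satisfies (h : IsScaling D φ c) :
    Satisfies D μ ((base D μ).comp φ.toAlgHom) fun i ε => (c i ε : k) • X D μ i ε where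
  mul_base i ε r := by
    have := DFunLike.congr_fun ((h.commute i).zpow_right (ε : ℤ)).eq r
    simp only [AlgEquiv.mul_apply] at this
    simp [X_mul_base, this]
  neg_pos i := by
    simp [(TGWC.satisfies D μ).neg_pos, h.map_t, smul_smul, mul_comm]
  pos_neg i := by
    have := DFunLike.congr_fun (h.commute i).eq (D.t i)
    simp only [AlgEquiv.mul_apply, h.map_t] at this
    simp [(TGWC.satisfies D μ).pos_neg, this, smul_smul, mul_comm]
  pos_neg_of_ne i j hij := by
    simp only [smul_mul_assoc, mul_smul_comm, (TGWC.satisfies D μ).pos_neg_of_ne i j hij]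
    simp only [smul_smul]
    congr 1
    ring

/-- The endomorphism of `C_μ(R, σ, t)` with `r ↦ φ r` and `Xᵢ^ε ↦ cᵢ^ε Xᵢ^ε`. -/
noncomputable def scale (h : IsScaling D φ c) : D.TGWC μ →ₐ[k] D.TGWC μ := lift (h.satisfies μ)

@[simp] theorem scale_base (h : IsScaling D φ c) (r : R) :
    scale μ h (base D μ r) = base D μ (φ r) := lift_base _ r

@[simp] theorem scale_X (h : IsScaling D φ c) (i : Fin n) (ε : ℤˣ) :
    scale μ h (X D μ i ε) = (c i ε : k) • X D μ i ε := lift_X _ i ε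

theorem scale_wordProd (h : IsScaling D φ c) (u : List (Letter n)) :
    scale μ h (wordProd (X D μ) u) =
      (((u.map fun a => c a.1 a.2).prod : kˣ) : k) • wordProd (X D μ) u := by
  induction u with
  | nil => simp
  | cons a u ih =>
    simp [wordProd_cons, ih, smul_smul, mul_comm]

theorem scale_mem (h : IsScaling D φ c) (g : Fin n → ℤ) (x : D.TGWC μ) (hx : x ∈ gr D μ g) :
    scale μ h x ∈ gr D μ g := by
  refine gr_induction (p := fun x => scale μ h x ∈ gr D μ g) (fun r u hu => ?_) (by simp)
    (fun x y hx hy => ?_) (fun a x hx => ?_) hx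
  · rw [map_mul, scale_base, scale_wordProd, mul_smul_comm]
    exact Submodule.smul_mem _ _ (hu ▸ base_mul_wordProd_mem _ _)
  · rw [map_add]
    exact add_mem hx hy
  · rw [map_smul]
    exact Submodule.smul_mem _ _ hx

theorem scale_surjective (h : IsScaling D φ c) : Function.Surjective (scale μ h) := by
  intro x
  induction x using generator_induction with
  | hbase r => exact ⟨base D μ (φ.symm r), by simp⟩
  | hX i ε => exact ⟨((c i ε)⁻¹ : kˣ) • X D μ i ε, by simp [Units.smul_def]⟩
  | mul x y hx hy =>
    obtain ⟨x, rfl⟩ := hx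
    obtain ⟨y, rfl⟩ := hy
    exact ⟨x * y, map_mul _ _ _⟩
  | add x y hx hy =>
    obtain ⟨x, rfl⟩ := hx
    obtain ⟨y, rfl⟩ := hy
    exact ⟨x + y, map_add _ _ _⟩

theorem scale_mem_canonicalIdeal (h : IsScaling D φ c) {x : D.TGWC μ}
    (hx : x ∈ D.canonicalIdeal μ) : scale μ h x ∈ D.canonicalIdeal μ :=
  map_mem_canonicalIdeal (scale_surjective μ h) (scale_mem μ h) hx

end Scale

end TGWC
end TGWD

section TensorExt

variable {k : Type*} [Field k] {R : Type*} [Ring R] [Algebra k R] {m : ℕ}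
  {D : TGWD k R m} {μ : Matrix (Fin m) (Fin m) kˣ} {M N : Type*} [AddCommGroup M] [Module k M]
  [AddCommGroup N] [Module k N]

/-- Linear maps on `C ⊗ M` are determined by their values on the tensors `r X_u ⊗ x`. -/
theorem TGWD.TGWC.tensor_ext {f g : D.TGWC μ ⊗[k] M →ₗ[k] N}
    (h : ∀ r u x, f ((base D μ r * wordProd (X D μ) u) ⊗ₜ x) =
      g ((base D μ r * wordProd (X D μ) u) ⊗ₜ x)) : f = g := by
  refine TensorProduct.ext' fun c x => ?_
  induction c using span_induction with
  | mem r u => exact h r u x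
  | add c d hc hd => simp only [TensorProduct.add_tmul, map_add, hc, hd]
  | smul a c hc => simp only [← TensorProduct.smul_tmul', map_smul, hc]

theorem TGWD.TGWC.tensor_ext_homogeneous {f g : D.TGWC μ ⊗[k] M →ₗ[k] N}
    (h : ∀ l, ∀ c ∈ gr D μ l, ∀ x, f (c ⊗ₜ x) = g (c ⊗ₜ x)) : f = g :=
  tensor_ext fun r u => h _ _ (base_mul_wordProd_mem r u)

end TensorExt

/-! ### The twisting map on constructions, via an action on `C ⊗ D` -/

namespace TGWD

variable {k : Type*} [Field k] {R : Type*} [Ring R] [Algebra k R] {S : Type*} [Ring S]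
  [Algebra k S] {m n : ℕ}

/-- Automorphisms `ρᵢ` of `R`, `σⱼ` of `S` and scalars `q` defining a twisting map between the
constructions for the data `D` and `E`. -/
structure TwistData (D : TGWD k R m) (E : TGWD k S n) (ρ : Fin n → (R ≃ₐ[k] R))
    (σ : Fin m → (S ≃ₐ[k] S)) (q : Fin n → Fin m → ℤˣ → ℤˣ → kˣ) : Prop where
  ρ_scaling : ∀ i (δ : ℤˣ), TGWC.IsScaling D (ρ i ^ (δ : ℤ)) fun j ε => q i j δ ε
  -- The exponent is `-ε` because `s` is moved to the right: `s Xⱼ^ε = Xⱼ^ε σⱼ^{-ε}(s)`.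
  σ_scaling : ∀ j (ε : ℤˣ), TGWC.IsScaling E (σ j ^ (-(ε : ℤ))) fun i δ => q i j δ ε
  ρ_commute : ∀ i i', Commute (ρ i) (ρ i')
  σ_commute : ∀ j j', Commute (σ j) (σ j')

namespace TwistData

variable {D : TGWD k R m} {μ : Matrix (Fin m) (Fin m) kˣ} {E : TGWD k S n}
  {ν : Matrix (Fin n) (Fin n) kˣ} {ρ : Fin n → (R ≃ₐ[k] R)} {σ : Fin m → (S ≃ₐ[k] S)}
  {q : Fin n → Fin m → ℤˣ → ℤˣ → kˣ}

section Action

variable (D μ E ν σ) in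
/-- The action of `s ∈ S` on `C ⊗ D` by left multiplication. -/
noncomputable def actBase (s : S) : Module.End k (D.TGWC μ ⊗[k] E.TGWC ν) :=
  -- The operator depends on the degree of the first factor, so it is defined on each component of
  -- `C` and reassembled.
  TensorProduct.lift ((DirectSum.toModule k _ _ fun g =>
    ((TensorProduct.mk k (D.TGWC μ) (E.TGWC ν)).compl₂
      (LinearMap.mulLeft k (TGWC.base E ν (autPow σ (-g) s)))) ∘ₗ (TGWC.gr D μ g).subtype) ∘ₗ
        (DirectSum.decomposeLinearEquiv (TGWC.gr D μ)).toLinearMap)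

theorem actBase_tmul (s : S) {g : Fin m → ℤ} {c : D.TGWC μ} (hc : c ∈ TGWC.gr D μ g)
    (d : E.TGWC ν) :
    actBase D μ E ν σ s (c ⊗ₜ d) = c ⊗ₜ (TGWC.base E ν (autPow σ (-g) s) * d) := by
  lift c to TGWC.gr D μ g using hc
  simp [actBase]

variable (D μ E ν σ) in
/-- The action of `S` on `C ⊗ D` as a homomorphism of algebras. -/
noncomputable def actBaseHom : S →ₐ[k] Module.End k (D.TGWC μ ⊗[k] E.TGWC ν) :=
  AlgHom.ofLinearMap
    { toFun := actBase D μ E ν σ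
      map_add' := fun s t => TGWC.tensor_ext_homogeneous fun l c hc x => by
        rw [LinearMap.add_apply, actBase_tmul _ hc, actBase_tmul _ hc, actBase_tmul _ hc, map_add,
          map_add, add_mul, TensorProduct.tmul_add]
      map_smul' := fun a s => TGWC.tensor_ext_homogeneous fun l c hc x => by
        rw [RingHom.id_apply, LinearMap.smul_apply, actBase_tmul _ hc, actBase_tmul _ hc, map_smul,
          map_smul, smul_mul_assoc, TensorProduct.tmul_smul] }
    (TGWC.tensor_ext_homogeneous fun l c hc x => by
      change actBase D μ E ν σ 1 (c ⊗ₜ x) = c ⊗ₜ x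
      rw [actBase_tmul _ hc, map_one, map_one, one_mul])
    (fun s t => TGWC.tensor_ext_homogeneous fun l c hc x => by
      change actBase D μ E ν σ (s * t) (c ⊗ₜ x) =
        actBase D μ E ν σ s (actBase D μ E ν σ t (c ⊗ₜ x))
      rw [actBase_tmul _ hc, actBase_tmul _ hc, actBase_tmul _ hc, map_mul, map_mul, mul_assoc])

theorem actBaseHom_tmul (s : S) {g : Fin m → ℤ} {c : D.TGWC μ} (hc : c ∈ TGWC.gr D μ g)
    (d : E.TGWC ν) :
    actBaseHom D μ E ν σ s (c ⊗ₜ d) = c ⊗ₜ (TGWC.base E ν (autPow σ (-g) s) * d) :=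
  actBase_tmul s hc d

variable (h : TwistData D E ρ σ q)
include h

theorem commute_autPow (i : Fin n) (g : Fin m → ℤ) : Commute (E.σ i) (autPow σ g) :=
  Commute.autPow_right (fun j => by
    have := ((h.σ_scaling j 1).commute i).symm
    simpa using this) g

/-- The eigenvalue is the product of the scalars picked up when `Yᵢ^-` and `Yᵢ^+` each pass `X_u`.
This agreement makes the relation `Yᵢ^- Yᵢ^+ = hᵢ` hold for the action. -/
theorem autPow_neg_wordDeg_h (i : Fin n) (u : List (Letter m)) :
    autPow σ (-wordDeg u) (E.t i) =
      (((u.map fun a => q i a.1 (-1) a.2).prod * (u.map fun a => q i a.1 1 a.2).prod : kˣ) : k) •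
        E.t i := by
  induction u with
  | nil => simp [autPow_zero]
  | cons a u ih =>
    rw [wordDeg_cons, neg_add_rev, autPow_add h.σ_commute, AlgEquiv.mul_apply, ← Pi.single_neg,
      autPow_single, (h.σ_scaling a.1 a.2).map_t, map_smul, ih, smul_smul]
    simp only [List.map_cons, List.prod_cons, Units.val_mul]
    congr 1
    ring

variable (μ) in
/-- The automorphism of `C` attached to the generator `Yᵢ^δ`. -/
noncomputable def scaleLeft (i : Fin n) (δ : ℤˣ) : D.TGWC μ →ₐ[k] D.TGWC μ :=
  TGWC.scale μ (h.ρ_scaling i δ)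

theorem scaleLeft_apply (i : Fin n) (δ : ℤˣ) (r : R) (u : List (Letter m)) :
    h.scaleLeft μ i δ (TGWC.base D μ r * wordProd (TGWC.X D μ) u) =
      (((u.map fun a => q i a.1 δ a.2).prod : kˣ) : k) •
        (TGWC.base D μ ((ρ i ^ (δ : ℤ)) r) * wordProd (TGWC.X D μ) u) := by
  rw [scaleLeft, map_mul, TGWC.scale_base, TGWC.scale_wordProd, mul_smul_comm]

theorem scaleLeft_mem (i : Fin n) (δ : ℤˣ) {g : Fin m → ℤ} {c : D.TGWC μ}
    (hc : c ∈ TGWC.gr D μ g) : h.scaleLeft μ i δ c ∈ TGWC.gr D μ g :=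
  TGWC.scale_mem μ (h.ρ_scaling i δ) g c hc

/-- Contains all the compatibility needed for the twist to exist: commutation of `σ` with the
automorphisms of `E` for `Y s`, the eigenvalues of `hᵢ` for opposite signs, and commutation of the
`ρᵢ` for `i ≠ j`, where the rescaling factors of the two orders agree and only `ν` remains. -/
theorem satisfies_act : TGWC.Satisfies E ν (actBaseHom D μ E ν σ) fun i δ =>
    TensorProduct.map (h.scaleLeft μ i δ).toLinearMap
      (LinearMap.mulLeft k (TGWC.X E ν i δ)) where
  mul_base i δ s := TGWC.tensor_ext_homogeneous fun l c hc x => by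
    have hcomm := DFunLike.congr_fun ((h.commute_autPow i (-l)).zpow_left (δ : ℤ)).eq s
    simp only [AlgEquiv.mul_apply] at hcomm
    simp only [Module.End.mul_apply, TensorProduct.map_tmul, AlgHom.toLinearMap_apply,
      LinearMap.mulLeft_apply]
    rw [actBaseHom_tmul _ hc, actBaseHom_tmul _ (h.scaleLeft_mem i δ hc),
      TensorProduct.map_tmul, LinearMap.mulLeft_apply, ← mul_assoc, TGWC.X_mul_base, hcomm,
      mul_assoc, AlgHom.toLinearMap_apply]
  neg_pos i := TGWC.tensor_ext fun r u x => by
    rw [Module.End.mul_apply, actBaseHom_tmul _ (TGWC.base_mul_wordProd_mem r u),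
      h.autPow_neg_wordDeg_h]
    simp only [TensorProduct.map_tmul, AlgHom.toLinearMap_apply, LinearMap.mulLeft_apply,
      scaleLeft_apply, map_smul]
    rw [← mul_assoc, (TGWC.satisfies E ν).neg_pos, smul_smul, smul_mul_assoc,
      TensorProduct.tmul_smul, TensorProduct.smul_tmul', ← Units.val_mul, mul_comm]
    simp [← AlgEquiv.mul_apply]
  pos_neg i := TGWC.tensor_ext fun r u x => by
    -- `E.σ i` commutes with the `σⱼ`, so `E.σ i (E.t i)` has the same eigenvalue as `E.t i`.
    have hcomm := DFunLike.congr_fun (h.commute_autPow i (-wordDeg u)).eq (E.t i)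
    have hρ : (ρ i ^ ((1 : ℤˣ) : ℤ)) ((ρ i ^ ((-1 : ℤˣ) : ℤ)) r) = r := by
      rw [← AlgEquiv.mul_apply, ← zpow_add]
      simp
    simp only [AlgEquiv.mul_apply, h.autPow_neg_wordDeg_h, map_smul] at hcomm
    rw [Module.End.mul_apply, actBaseHom_tmul _ (TGWC.base_mul_wordProd_mem r u), ← hcomm]
    simp only [TensorProduct.map_tmul, AlgHom.toLinearMap_apply, LinearMap.mulLeft_apply,
      scaleLeft_apply, map_smul, hρ]
    rw [← mul_assoc, (TGWC.satisfies E ν).pos_neg, smul_smul, smul_mul_assoc,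
      TensorProduct.tmul_smul, TensorProduct.smul_tmul', ← Units.val_mul]
  pos_neg_of_ne i j hij := TGWC.tensor_ext fun r u x => by
    have hcomm := DFunLike.congr_fun (((h.ρ_commute i j).zpow_zpow 1 (-1)).eq) r
    simp only [AlgEquiv.mul_apply] at hcomm
    simp only [LinearMap.smul_apply, Module.End.mul_apply, TensorProduct.map_tmul,
      AlgHom.toLinearMap_apply, LinearMap.mulLeft_apply, scaleLeft_apply, map_smul, smul_smul,
      Units.val_neg, Units.val_one, hcomm]
    rw [← mul_assoc, (TGWC.satisfies E ν).pos_neg_of_ne i j hij, mul_comm, smul_mul_assoc,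
      TensorProduct.tmul_smul, mul_assoc]

variable (μ ν) in
/-- The action of `D` on `C ⊗ D` by left multiplication. -/
noncomputable def act : E.TGWC ν →ₐ[k] Module.End k (D.TGWC μ ⊗[k] E.TGWC ν) :=
  TGWC.lift (h.satisfies_act (μ := μ) (ν := ν))

theorem act_base_tmul (s : S) {g : Fin m → ℤ} {c : D.TGWC μ} (hc : c ∈ TGWC.gr D μ g)
    (d : E.TGWC ν) :
    h.act μ ν (TGWC.base E ν s) (c ⊗ₜ d) = c ⊗ₜ (TGWC.base E ν (autPow σ (-g) s) * d) := by
  rw [act, TGWC.lift_base, actBaseHom_tmul s hc]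

theorem act_X_tmul (i : Fin n) (δ : ℤˣ) (c : D.TGWC μ) (d : E.TGWC ν) :
    h.act μ ν (TGWC.X E ν i δ) (c ⊗ₜ d) = h.scaleLeft μ i δ c ⊗ₜ (TGWC.X E ν i δ * d) := by
  rw [act, TGWC.lift_X]
  rfl

theorem act_wordProd_tmul (v : List (Letter n)) (r : R) (u : List (Letter m)) (d : E.TGWC ν) :
    h.act μ ν (wordProd (TGWC.X E ν) v) ((TGWC.base D μ r * wordProd (TGWC.X D μ) u) ⊗ₜ d) =
      ((wordScalar q v u : kˣ) : k) •
        ((TGWC.base D μ (autPow ρ (wordDeg v) r) * wordProd (TGWC.X D μ) u) ⊗ₜ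
          (wordProd (TGWC.X E ν) v * d)) := by
  induction v with
  | nil => simp [wordScalar, autPow_zero]
  | cons b v ih =>
    rw [wordProd_cons, map_mul, Module.End.mul_apply, ih, map_smul, act_X_tmul, scaleLeft_apply,
      autPow_wordDeg_cons h.ρ_commute, ← TensorProduct.smul_tmul', smul_smul, mul_assoc]
    simp [wordScalar, mul_comm]

/-- Each generator acts on the second factor only by left multiplication, which commutes with right
multiplication. -/
theorem act_mulRight (d d' : E.TGWC ν) (z : D.TGWC μ ⊗[k] E.TGWC ν) :
    h.act μ ν d (TensorProduct.map LinearMap.id (LinearMap.mulRight k d') z) =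
      TensorProduct.map LinearMap.id (LinearMap.mulRight k d') (h.act μ ν d z) := by
  induction d using TGWC.generator_induction generalizing z with
  | hbase s =>
    refine LinearMap.congr_fun
      (f := h.act μ ν (TGWC.base E ν s) ∘ₗ TensorProduct.map LinearMap.id (LinearMap.mulRight k d'))
      (g := TensorProduct.map LinearMap.id (LinearMap.mulRight k d') ∘ₗ h.act μ ν (TGWC.base E ν s))
      (TGWC.tensor_ext_homogeneous fun l c hc x => ?_) z
    simp [h.act_base_tmul _ hc, mul_assoc]
  | hX i δ =>
    refine LinearMap.congr_fun
      (f := h.act μ ν (TGWC.X E ν i δ) ∘ₗ TensorProduct.map LinearMap.id (LinearMap.mulRight k d'))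
      (g := TensorProduct.map LinearMap.id (LinearMap.mulRight k d') ∘ₗ h.act μ ν (TGWC.X E ν i δ))
      (TGWC.tensor_ext_homogeneous fun l c hc x => ?_) z
    simp [h.act_X_tmul, mul_assoc]
  | mul x y hx hy => rw [map_mul, Module.End.mul_apply, hy, hx, Module.End.mul_apply]
  | add x y hx hy => rw [map_add, LinearMap.add_apply, hx, hy, LinearMap.add_apply, map_add]

variable (μ ν) in
/-- The linear map `d ⊗ c ↦ d · (c ⊗ 1)`. -/
noncomputable def twist : E.TGWC ν ⊗[k] D.TGWC μ →ₗ[k] D.TGWC μ ⊗[k] E.TGWC ν :=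
  TensorProduct.lift
    (LinearMap.lcomp k _ ((TensorProduct.mk k (D.TGWC μ) (E.TGWC ν)).flip 1) ∘ₗ
      (h.act μ ν).toLinearMap)

theorem twist_tmul (d : E.TGWC ν) (c : D.TGWC μ) :
    h.twist μ ν (d ⊗ₜ c) = h.act μ ν d (c ⊗ₜ 1) := rfl

theorem twistFormula_twist :
    TwistFormula (TGWC.base D μ) (TGWC.X D μ) (TGWC.base E ν) (TGWC.X E ν) ρ σ q
      (h.twist μ ν) := by
  intro r s u v
  rw [twist_tmul, map_mul, Module.End.mul_apply, act_wordProd_tmul, map_smul,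
    h.act_base_tmul _ (TGWC.base_mul_wordProd_mem _ _), mul_one]

/-- By `act_mulRight`, `d · (c' ⊗ d')` is `d · (c' ⊗ 1)` multiplied on the right by `d'`. Thus the
twisted product is expressed through the action, and associativity becomes linearity. -/
theorem twistedMul_twist (c : D.TGWC μ) (d : E.TGWC ν) (z : D.TGWC μ ⊗[k] E.TGWC ν) :
    twistedMul (h.twist μ ν) ((c ⊗ₜ d) ⊗ₜ z) =
      TensorProduct.map (LinearMap.mulLeft k c) LinearMap.id (h.act μ ν d z) := by
  induction z using TensorProduct.induction_on with
  | zero => simp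
  | tmul c' d' =>
    rw [twistedMul_tmul, twist_tmul]
    have := h.act_mulRight d d' (c' ⊗ₜ 1)
    rw [TensorProduct.map_tmul, LinearMap.mulRight_apply, one_mul, LinearMap.id_apply] at this
    rw [this, ← LinearMap.comp_apply (TensorProduct.map _ _) (TensorProduct.map _ _),
      ← TensorProduct.map_comp]
    rfl
  | add x y hx hy => simp only [TensorProduct.tmul_add, map_add, hx, hy]

theorem twistedMul_mulLeft (c : D.TGWC μ) (y z : D.TGWC μ ⊗[k] E.TGWC ν) :
    twistedMul (h.twist μ ν) (TensorProduct.map (LinearMap.mulLeft k c) LinearMap.id y ⊗ₜ z) =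
      TensorProduct.map (LinearMap.mulLeft k c) LinearMap.id
        (twistedMul (h.twist μ ν) (y ⊗ₜ z)) := by
  induction y using TensorProduct.induction_on with
  | zero => simp
  | tmul c' d' =>
    rw [TensorProduct.map_tmul, twistedMul_twist, twistedMul_twist, LinearMap.mulLeft_apply,
      LinearMap.mulLeft_mul, LinearMap.id_apply,
      ← LinearMap.comp_apply (TensorProduct.map _ _) (TensorProduct.map _ _),
      ← TensorProduct.map_comp]
    rfl
  | add x y hx hy => simp only [TensorProduct.add_tmul, map_add, hx, hy]

/-- For `s ∈ S` this is additivity of degrees, `σ^{-g'}(σ^{-g}(s)) = σ^{-(g + g')}(s)`; for `Yᵢ^δ`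
it is multiplicativity of the rescaling. The statement passes to products and sums of elements of
`D`. -/
theorem twistedMul_act (d : E.TGWC ν) (y z : D.TGWC μ ⊗[k] E.TGWC ν) :
    twistedMul (h.twist μ ν) (h.act μ ν d y ⊗ₜ z) =
      h.act μ ν d (twistedMul (h.twist μ ν) (y ⊗ₜ z)) := by
  induction d using TGWC.generator_induction generalizing y with
  | hbase s =>
    induction y using TensorProduct.induction_on with
    | zero => simp
    | tmul c d' =>
      induction c using TGWC.homogeneous_induction with
      | mem g c hc =>
        rw [h.act_base_tmul s hc, twistedMul_twist, twistedMul_twist, map_mul,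
          Module.End.mul_apply]
        refine LinearMap.congr_fun
          (f := TensorProduct.map (LinearMap.mulLeft k c) LinearMap.id ∘ₗ
            h.act μ ν (TGWC.base E ν (autPow σ (-g) s)))
          (g := h.act μ ν (TGWC.base E ν s) ∘ₗ
            TensorProduct.map (LinearMap.mulLeft k c) LinearMap.id)
          (TGWC.tensor_ext_homogeneous fun l c' hc' x => ?_) _
        simp only [LinearMap.comp_apply, h.act_base_tmul _ hc', TensorProduct.map_tmul,
          LinearMap.mulLeft_apply, LinearMap.id_apply,
          h.act_base_tmul _ (TGWC.mul_mem_gr hc hc')]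
        rw [neg_add_rev, autPow_add h.σ_commute, AlgEquiv.mul_apply]
      | add x y hx hy => simp only [TensorProduct.add_tmul, map_add, hx, hy]
    | add x y hx hy => simp only [TensorProduct.add_tmul, map_add, hx, hy]
  | hX i δ =>
    induction y using TensorProduct.induction_on with
    | zero => simp
    | tmul c d' =>
      rw [h.act_X_tmul, twistedMul_twist, twistedMul_twist, map_mul, Module.End.mul_apply]
      refine LinearMap.congr_fun
        (f := TensorProduct.map (LinearMap.mulLeft k (h.scaleLeft μ i δ c)) LinearMap.id ∘ₗ
          h.act μ ν (TGWC.X E ν i δ))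
        (g := h.act μ ν (TGWC.X E ν i δ) ∘ₗ
          TensorProduct.map (LinearMap.mulLeft k c) LinearMap.id)
        (TensorProduct.ext' fun c' x => ?_) _
      simp [h.act_X_tmul]
    | add x y hx hy => simp only [TensorProduct.add_tmul, map_add, hx, hy]
  | mul a b ha hb => rw [map_mul, Module.End.mul_apply, ha, hb, Module.End.mul_apply]
  | add a b ha hb =>
    rw [map_add, LinearMap.add_apply, LinearMap.add_apply, TensorProduct.add_tmul, map_add, ha, hb]

variable (μ ν) in
/-- The twisting map between twisted generalized Weyl constructions. -/
noncomputable def twistingMap : TwistingMap k (D.TGWC μ) (E.TGWC ν) where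
  toLin := h.twist μ ν
  tmul_one d := by
    have h1 : (1 : D.TGWC μ) ∈ TGWC.gr D μ 0 := by
      rw [← map_one (TGWC.base D μ)]
      exact TGWC.base_mem D μ 1
    induction d using TGWC.generator_induction with
    | hbase s => rw [twist_tmul, h.act_base_tmul s h1, neg_zero, autPow_zero, mul_one]; rfl
    | hX i δ => rw [twist_tmul, act_X_tmul, map_one, mul_one]
    -- `x · (y · (1 ⊗ 1)) = x · (1 ⊗ y)`, which is `x · (1 ⊗ 1) = 1 ⊗ x` multiplied on the right by
    -- `y`.
    | mul x y hx hy =>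
      rw [twist_tmul] at hx hy ⊢
      have := h.act_mulRight (μ := μ) x y (1 ⊗ₜ 1)
      rw [TensorProduct.map_tmul, LinearMap.mulRight_apply, one_mul, LinearMap.id_apply] at this
      rw [map_mul, Module.End.mul_apply, hy, this, hx]
      simp
    | add x y hx hy => rw [TensorProduct.add_tmul, map_add, hx, hy, TensorProduct.tmul_add]
  one_tmul c := by rw [twist_tmul, map_one]; rfl
  assoc x y z := by
    induction x using TensorProduct.induction_on with
    | zero => simp
    | tmul c d =>
      -- Both bracketings become `c (d · (y z))`.
      rw [twistedMul_twist, twistedMul_twist, twistedMul_mulLeft, twistedMul_act]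
    | add x y hx hy => simp only [TensorProduct.add_tmul, map_add, hx, hy]

end Action

end TwistData

end TGWD

/-! ### Tensor products of subspaces, and descent of twisting maps -/

section MapIncl

variable {k : Type*} [Field k] {M N M' N' : Type*} [AddCommGroup M] [Module k M] [AddCommGroup N]
  [Module k N] [AddCommGroup M'] [Module k M'] [AddCommGroup N'] [Module k N']

theorem TensorProduct.tmul_mem_range_mapIncl {P : Submodule k M} {Q : Submodule k N} {x : M} {y : N}
    (hx : x ∈ P) (hy : y ∈ Q) : x ⊗ₜ[k] y ∈ LinearMap.range (mapIncl P Q) :=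
  ⟨⟨x, hx⟩ ⊗ₜ ⟨y, hy⟩, rfl⟩

/-- Induction over the image of `P ⊗ Q`. -/
theorem TensorProduct.range_mapIncl_induction {P : Submodule k M} {Q : Submodule k N}
    {p : M ⊗[k] N → Prop} (zero : p 0) (tmul : ∀ x ∈ P, ∀ y ∈ Q, p (x ⊗ₜ y))
    (add : ∀ z w, p z → p w → p (z + w)) {z : M ⊗[k] N} (hz : z ∈ LinearMap.range (mapIncl P Q)) :
    p z := by
  obtain ⟨z, rfl⟩ := hz
  induction z using TensorProduct.induction_on with
  | zero => rwa [map_zero]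
  | tmul x y => exact tmul _ x.2 _ y.2
  | add x y hx hy => rw [map_add]; exact add _ _ hx hy

theorem TensorProduct.map_mem_range_mapIncl {P : Submodule k M} {Q : Submodule k N}
    {P' : Submodule k M'} {Q' : Submodule k N'} {f : M →ₗ[k] M'} {g : N →ₗ[k] N'}
    (hf : ∀ x ∈ P, f x ∈ P') (hg : ∀ y ∈ Q, g y ∈ Q') {z : M ⊗[k] N}
    (hz : z ∈ LinearMap.range (mapIncl P Q)) :
    TensorProduct.map f g z ∈ LinearMap.range (mapIncl P' Q') := by
  refine range_mapIncl_induction (P := P) (Q := Q)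
    (p := fun z => TensorProduct.map f g z ∈ LinearMap.range (mapIncl P' Q'))
    (by rw [map_zero]; exact zero_mem _) (fun x hx y hy => ?_) (fun z w hz hw => ?_) hz
  · exact tmul_mem_range_mapIncl (hf x hx) (hg y hy)
  · rw [map_add]
    exact add_mem hz hw

end MapIncl

section Descend

variable {k : Type*} [Field k] {A : Type*} [Ring A] [Algebra k A] {B : Type*} [Ring B] [Algebra k B]
  {A' : Type*} [Ring A'] [Algebra k A'] {B' : Type*} [Ring B'] [Algebra k B']

theorem twistedMul_map {f : A →ₐ[k] A'} {g : B →ₐ[k] B'} {τ : B ⊗[k] A →ₗ[k] A ⊗[k] B}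
    {τ' : B' ⊗[k] A' →ₗ[k] A' ⊗[k] B'}
    (h : ∀ b a, τ' (g b ⊗ₜ f a) = TensorProduct.map f.toLinearMap g.toLinearMap (τ (b ⊗ₜ a)))
    (x y : A ⊗[k] B) :
    twistedMul τ' (TensorProduct.map f.toLinearMap g.toLinearMap x ⊗ₜ
      TensorProduct.map f.toLinearMap g.toLinearMap y) =
        TensorProduct.map f.toLinearMap g.toLinearMap (twistedMul τ (x ⊗ₜ y)) := by
  induction x using TensorProduct.induction_on with
  | zero => simp
  | add x x' hx hx' => simp only [map_add, TensorProduct.add_tmul, hx, hx']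
  | tmul a b =>
    induction y using TensorProduct.induction_on with
    | zero => simp
    | add y y' hy hy' => simp only [map_add, TensorProduct.tmul_add, hy, hy']
    | tmul a' b' =>
      simp only [TensorProduct.map_tmul, twistedMul_tmul, AlgHom.toLinearMap_apply, h]
      generalize τ (b ⊗ₜ a') = z
      induction z using TensorProduct.induction_on with
      | zero => simp
      | add y y' hy hy' => simp only [map_add, hy, hy']
      | tmul c d => simp

/-- A twisting map descends to quotients by ideals which it preserves. -/
theorem TwistingMap.exists_descend {f : A →ₐ[k] A'} {g : B →ₐ[k] B'}
    (hf : Function.Surjective f) (hg : Function.Surjective g) (τ : TwistingMap k A B)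
    (hA : ∀ b a, f a = 0 → TensorProduct.map f.toLinearMap g.toLinearMap (τ.toLin (b ⊗ₜ a)) = 0)
    (hB : ∀ b a, g b = 0 → TensorProduct.map f.toLinearMap g.toLinearMap (τ.toLin (b ⊗ₜ a)) = 0) :
    ∃ τ' : TwistingMap k A' B', ∀ b a, τ'.toLin (g b ⊗ₜ f a) =
      TensorProduct.map f.toLinearMap g.toLinearMap (τ.toLin (b ⊗ₜ a)) := by
  -- Over a field the surjections have linear sections; the descended map is defined through them,
  -- and `key` shows that it does not depend on the choice.
  obtain ⟨f', hf'⟩ := f.toLinearMap.exists_rightInverse_of_surjective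
    (LinearMap.range_eq_top.mpr hf)
  obtain ⟨g', hg'⟩ := g.toLinearMap.exists_rightInverse_of_surjective
    (LinearMap.range_eq_top.mpr hg)
  have hf' : ∀ a, f (f' a) = a := fun a => LinearMap.congr_fun hf' a
  have hg' : ∀ b, g (g' b) = b := fun b => LinearMap.congr_fun hg' b
  let τ' : B' ⊗[k] A' →ₗ[k] A' ⊗[k] B' :=
    TensorProduct.map f.toLinearMap g.toLinearMap ∘ₗ τ.toLin ∘ₗ TensorProduct.map g' f'
  have key : ∀ b a, τ' (g b ⊗ₜ f a) =
      TensorProduct.map f.toLinearMap g.toLinearMap (τ.toLin (b ⊗ₜ a)) := by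
    intro b a
    -- The two arguments are replaced one at a time, `a` first and then `b` with `a` already
    -- replaced.
    have h1 := hA b (f' (f a) - a) (by rw [map_sub, hf', sub_self])
    have h2 := hB (g' (g b) - b) (f' (f a)) (by rw [map_sub, hg', sub_self])
    rw [TensorProduct.tmul_sub, map_sub, map_sub, sub_eq_zero] at h1
    rw [TensorProduct.sub_tmul, map_sub, map_sub, sub_eq_zero] at h2
    rw [← h1, ← h2]
    rfl
  have hs : Function.Surjective (TensorProduct.map f.toLinearMap g.toLinearMap) :=
    TensorProduct.map_surjective hf hg
  refine ⟨⟨τ', fun b => ?_, fun a => ?_, fun x y z => ?_⟩, key⟩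
  · obtain ⟨b, rfl⟩ := hg b
    rw [← map_one f, key, τ.tmul_one]
    rfl
  · obtain ⟨a, rfl⟩ := hf a
    rw [← map_one g, key, τ.one_tmul]
    rfl
  · obtain ⟨x, rfl⟩ := hs x
    obtain ⟨y, rfl⟩ := hs y
    obtain ⟨z, rfl⟩ := hs z
    rw [twistedMul_map key, twistedMul_map key, twistedMul_map key, twistedMul_map key, τ.assoc]

end Descend

/-! ### The twisting map on twisted generalized Weyl algebras -/

namespace TGWD

variable {k : Type*} [Field k] {R : Type*} [Ring R] [Algebra k R] {S : Type*} [Ring S]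
  [Algebra k S] {m n : ℕ} {D : TGWD k R m} {μ : Matrix (Fin m) (Fin m) kˣ} {E : TGWD k S n}
  {ν : Matrix (Fin n) (Fin n) kˣ} {ρ : Fin n → (R ≃ₐ[k] R)} {σ : Fin m → (S ≃ₐ[k] S)}
  {q : Fin n → Fin m → ℤˣ → ℤˣ → kˣ}

theorem isGradedTwist_of_twistFormula {f : E.TGWC ν ⊗[k] D.TGWC μ →ₗ[k] D.TGWC μ ⊗[k] E.TGWC ν}
    (hf : TwistFormula (TGWC.base D μ) (TGWC.X D μ) (TGWC.base E ν) (TGWC.X E ν) ρ σ q f) :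
    IsGradedTwist (TGWC.gr D μ) (TGWC.gr E ν) f := by
  intro g g' c hc d hd
  refine TGWC.gr_induction (p := fun c => f (d ⊗ₜ c) ∈
    LinearMap.range (TensorProduct.mapIncl (TGWC.gr D μ g) (TGWC.gr E ν g')))
    (fun r u hu => ?_) (by simp) (fun x y hx hy => ?_) (fun a x hx => ?_) hc
  · refine TGWC.gr_induction (p := fun d => f (d ⊗ₜ (TGWC.base D μ r * wordProd (TGWC.X D μ) u)) ∈
      LinearMap.range (TensorProduct.mapIncl (TGWC.gr D μ g) (TGWC.gr E ν g')))
      (fun s v hv => ?_) (by simp) (fun x y hx hy => ?_) (fun a x hx => ?_) hd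
    · rw [hf]
      exact Submodule.smul_mem _ _ (TensorProduct.tmul_mem_range_mapIncl
        (hu ▸ TGWC.base_mul_wordProd_mem _ _) (hv ▸ TGWC.base_mul_wordProd_mem _ _))
    · rw [TensorProduct.add_tmul, map_add]
      exact add_mem hx hy
    · rw [← TensorProduct.smul_tmul', map_smul]
      exact Submodule.smul_mem _ _ hx
  · rw [TensorProduct.tmul_add, map_add]
    exact add_mem hx hy
  · rw [TensorProduct.tmul_smul, map_smul]
    exact Submodule.smul_mem _ _ hx

/-- On quotients of the constructions, a linear map is determined by the twisting formula. -/
theorem eq_of_twistFormula {A : Type*} [Ring A] [Algebra k A] {B : Type*} [Ring B] [Algebra k B]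
    {p : D.TGWC μ →ₐ[k] A} {p' : E.TGWC ν →ₐ[k] B} (hp : Function.Surjective p)
    (hp' : Function.Surjective p') {f f' : B ⊗[k] A →ₗ[k] A ⊗[k] B}
    (hf : TwistFormula (p.comp (TGWC.base D μ)) (fun i ε => p (TGWC.X D μ i ε))
      (p'.comp (TGWC.base E ν)) (fun i ε => p' (TGWC.X E ν i ε)) ρ σ q f)
    (hf' : TwistFormula (p.comp (TGWC.base D μ)) (fun i ε => p (TGWC.X D μ i ε))
      (p'.comp (TGWC.base E ν)) (fun i ε => p' (TGWC.X E ν i ε)) ρ σ q f') : f = f' := by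
  refine TensorProduct.ext' fun b a => ?_
  obtain ⟨c, rfl⟩ := hp a
  obtain ⟨d, rfl⟩ := hp' b
  induction c using TGWC.span_induction with
  | mem r u =>
    induction d using TGWC.span_induction with
    | mem s v =>
      rw [map_mul, map_mul, map_wordProd, map_wordProd]
      exact (hf r s u v).trans (hf' r s u v).symm
    | add x y hx hy => simp only [map_add, TensorProduct.add_tmul, hx, hy]
    | smul a x hx => simp only [map_smul, ← TensorProduct.smul_tmul', hx]
  | add x y hx hy => simp only [map_add, TensorProduct.tmul_add, hx, hy]
  | smul a x hx => simp only [map_smul, TensorProduct.tmul_smul, hx]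

namespace TwistData

variable (h : TwistData D E ρ σ q)
include h

/-- The image of `J ⊗ D`, with `J` the canonical ideal of `C`, is stable: `s ∈ S` changes only the
second factor of each homogeneous tensor, and `J` is homogeneous; `Yᵢ^δ` acts on `J` by a rescaling.
-/
theorem act_mem_span (d : E.TGWC ν) {z : D.TGWC μ ⊗[k] E.TGWC ν}
    (hz : z ∈ Submodule.span k {z | ∃ c ∈ D.canonicalIdeal μ, ∃ d : E.TGWC ν, c ⊗ₜ[k] d = z}) :
    h.act μ ν d z ∈ Submodule.span k
      {z | ∃ c ∈ D.canonicalIdeal μ, ∃ d : E.TGWC ν, c ⊗ₜ[k] d = z} := by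
  set N := Submodule.span k {z | ∃ c ∈ D.canonicalIdeal μ, ∃ d : E.TGWC ν, c ⊗ₜ[k] d = z} with hN
  have htmul : ∀ c ∈ D.canonicalIdeal μ, ∀ d : E.TGWC ν, c ⊗ₜ[k] d ∈ N := fun c hc d =>
    Submodule.subset_span ⟨c, hc, d, rfl⟩
  have of_tmul : ∀ a, (∀ c ∈ D.canonicalIdeal μ, ∀ d' : E.TGWC ν, h.act μ ν a (c ⊗ₜ d') ∈ N) →
      ∀ z ∈ N, h.act μ ν a z ∈ N := by
    intro a ha z hz
    refine (Submodule.span_le (p := N.comap (h.act μ ν a))).mpr ?_ hz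
    rintro _ ⟨c, hc, d, rfl⟩
    exact ha c hc d
  induction d using TGWC.generator_induction generalizing z with
  | hbase s =>
    refine of_tmul _ (fun c hc d' => ?_) z hz
    refine TGWC.mem_of_forall_proj_mem (N := (N.comap (h.act μ ν (TGWC.base E ν s) ∘ₗ
      (TensorProduct.mk k _ _).flip d')).toAddSubmonoid) fun g => ?_
    change h.act μ ν (TGWC.base E ν s) (TGWC.proj D μ g c ⊗ₜ d') ∈ N
    rw [h.act_base_tmul s (TGWC.proj_mem g c)]
    exact htmul _ (TGWC.proj_mem_canonicalIdeal hc g) _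
  | hX i δ =>
    refine of_tmul _ (fun c hc d' => ?_) z hz
    rw [act_X_tmul]
    exact htmul _ (TGWC.scale_mem_canonicalIdeal μ (h.ρ_scaling i δ) hc) _
  | mul x y hx hy => rw [map_mul]; exact hx (hy hz)
  | add x y hx hy => rw [map_add]; exact add_mem (hx hz) (hy hz)

/-- Right multiplication by the word `X_u` induces an endomorphism of `D` preserving the canonical
ideal. -/
theorem exists_scaleRight (u : List (Letter m)) : ∃ β : E.TGWC ν →ₗ[k] E.TGWC ν,
    (∀ x ∈ E.canonicalIdeal ν, β x ∈ E.canonicalIdeal ν) ∧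
    ∀ s v, β (TGWC.base E ν s * wordProd (TGWC.X E ν) v) = ((wordScalar q v u : kˣ) : k) •
      (TGWC.base E ν (autPow σ (-wordDeg u) s) * wordProd (TGWC.X E ν) v) := by
  induction u with
  | nil => exact ⟨LinearMap.id, fun x hx => hx, fun s v => by simp [wordScalar, autPow_zero]⟩
  | cons a u ih =>
    obtain ⟨β, h1, h2⟩ := ih
    refine ⟨(TGWC.scale ν (h.σ_scaling a.1 a.2)).toLinearMap ∘ₗ β, fun x hx =>
      TGWC.scale_mem_canonicalIdeal ν _ (h1 x hx), fun s v => ?_⟩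
    have hdeg : autPow σ (-wordDeg (a :: u)) s =
        (σ a.1 ^ (-(a.2 : ℤ))) (autPow σ (-wordDeg u) s) := by
      rw [wordDeg_cons, neg_add, autPow_add h.σ_commute, ← Pi.single_neg, autPow_single,
        AlgEquiv.mul_apply]
    have hscal : wordScalar q v (a :: u) =
        wordScalar q v u * (v.map fun b => q b.1 a.1 b.2 a.2).prod := by
      simp only [wordScalar, List.map_cons, List.prod_cons, List.prod_map_mul]
      exact mul_comm _ _
    rw [LinearMap.comp_apply, h2, map_smul, AlgHom.toLinearMap_apply, map_mul, TGWC.scale_base,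
      TGWC.scale_wordProd, mul_smul_comm, smul_smul, hdeg, hscal, Units.val_mul]

theorem map_mk_twist_of_left (d : E.TGWC ν) (c : D.TGWC μ) (hc : TGWA.mk D μ c = 0) :
    TensorProduct.map (TGWA.mk D μ).toLinearMap (TGWA.mk E ν).toLinearMap
      (h.twist μ ν (d ⊗ₜ c)) = 0 := by
  rw [twist_tmul]
  have := h.act_mem_span d (Submodule.subset_span ⟨c, TGWA.mk_eq_zero_iff.mp hc, 1, rfl⟩)
  refine (Submodule.span_le (p := LinearMap.ker _)).mpr ?_ this
  rintro _ ⟨c, hc, d, rfl⟩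
  rw [SetLike.mem_coe, LinearMap.mem_ker, TensorProduct.map_tmul, AlgHom.toLinearMap_apply,
    TGWA.mk_eq_zero_iff.mpr hc, TensorProduct.zero_tmul]

/-- For fixed `r X_u`, the twist acts on the component of degree `g` of `D` as `d ↦ ρ^g(r) X_u ⊗ β
d`, where `β` is a composite of rescalings and so preserves the canonical ideal. Homogeneity of the
ideal reduces to this case. -/
theorem map_mk_twist_of_right (d : E.TGWC ν) (c : D.TGWC μ) (hd : TGWA.mk E ν d = 0) :
    TensorProduct.map (TGWA.mk D μ).toLinearMap (TGWA.mk E ν).toLinearMap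
      (h.twist μ ν (d ⊗ₜ c)) = 0 := by
  induction c using TGWC.span_induction with
  | mem r u =>
    obtain ⟨β, h1, h2⟩ := h.exists_scaleRight (ν := ν) u
    have key : ∀ g, ∀ d ∈ TGWC.gr E ν g,
        h.twist μ ν (d ⊗ₜ (TGWC.base D μ r * wordProd (TGWC.X D μ) u)) =
          (TGWC.base D μ (autPow ρ g r) * wordProd (TGWC.X D μ) u) ⊗ₜ β d := by
      intro g d hd
      refine TGWC.gr_induction (p := fun d =>
        h.twist μ ν (d ⊗ₜ (TGWC.base D μ r * wordProd (TGWC.X D μ) u)) =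
          (TGWC.base D μ (autPow ρ g r) * wordProd (TGWC.X D μ) u) ⊗ₜ β d)
        (fun s v hv => ?_) (by simp) (fun x y hx hy => ?_) (fun a x hx => ?_) hd
      · rw [h.twistFormula_twist, hv, h2, TensorProduct.tmul_smul]
      · rw [TensorProduct.add_tmul, map_add, hx, hy, map_add, TensorProduct.tmul_add]
      · rw [← TensorProduct.smul_tmul', map_smul, hx, map_smul, TensorProduct.tmul_smul]
    refine TGWC.mem_of_forall_proj_mem (N := (LinearMap.ker
      (TensorProduct.map (TGWA.mk D μ).toLinearMap (TGWA.mk E ν).toLinearMap ∘ₗ h.twist μ ν ∘ₗ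
        (TensorProduct.mk k _ _).flip
          (TGWC.base D μ r * wordProd (TGWC.X D μ) u))).toAddSubmonoid) fun g => ?_
    change TensorProduct.map (TGWA.mk D μ).toLinearMap (TGWA.mk E ν).toLinearMap
      (h.twist μ ν (TGWC.proj E ν g d ⊗ₜ (TGWC.base D μ r * wordProd (TGWC.X D μ) u))) = 0
    rw [key g _ (TGWC.proj_mem g d), TensorProduct.map_tmul, AlgHom.toLinearMap_apply,
      AlgHom.toLinearMap_apply, TGWA.mk_eq_zero_iff.mpr
        (h1 _ (TGWC.proj_mem_canonicalIdeal (TGWA.mk_eq_zero_iff.mp hd) g)),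
      TensorProduct.tmul_zero]
  | add x y hx hy => simp only [map_add, TensorProduct.tmul_add, hx, hy, add_zero]
  | smul a x hx => simp only [map_smul, TensorProduct.tmul_smul, hx, smul_zero]

variable (μ ν) in
/-- The twisting map induced on the twisted generalized Weyl algebras. -/
theorem exists_twistingMap_TGWA : ∃ τ : TwistingMap k (D.TGWA μ) (E.TGWA ν),
    ∀ d c, τ.toLin (TGWA.mk E ν d ⊗ₜ TGWA.mk D μ c) =
      TensorProduct.map (TGWA.mk D μ).toLinearMap (TGWA.mk E ν).toLinearMap
        ((h.twistingMap μ ν).toLin (d ⊗ₜ c)) :=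
  TwistingMap.exists_descend (TGWA.mk_surjective D μ) (TGWA.mk_surjective E ν) _
    h.map_mk_twist_of_left h.map_mk_twist_of_right

end TwistData

section Quotient

variable {f₀ : E.TGWC ν ⊗[k] D.TGWC μ →ₗ[k] D.TGWC μ ⊗[k] E.TGWC ν}
  {f : E.TGWA ν ⊗[k] D.TGWA μ →ₗ[k] D.TGWA μ ⊗[k] E.TGWA ν}

theorem twistFormula_TGWA
    (hf : ∀ d c, f (TGWA.mk E ν d ⊗ₜ TGWA.mk D μ c) =
      TensorProduct.map (TGWA.mk D μ).toLinearMap (TGWA.mk E ν).toLinearMap (f₀ (d ⊗ₜ c)))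
    (hf₀ : TwistFormula (TGWC.base D μ) (TGWC.X D μ) (TGWC.base E ν) (TGWC.X E ν) ρ σ q f₀) :
    TwistFormula (TGWA.base D μ) (TGWA.X D μ) (TGWA.base E ν) (TGWA.X E ν) ρ σ q f := by
  intro r s u v
  have := hf (TGWC.base E ν s * wordProd (TGWC.X E ν) v)
    (TGWC.base D μ r * wordProd (TGWC.X D μ) u)
  rw [hf₀, map_smul, TensorProduct.map_tmul] at this
  simp only [AlgHom.toLinearMap_apply, map_mul, map_wordProd] at this
  exact this

theorem isGradedTwist_TGWA
    (hf : ∀ d c, f (TGWA.mk E ν d ⊗ₜ TGWA.mk D μ c) =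
      TensorProduct.map (TGWA.mk D μ).toLinearMap (TGWA.mk E ν).toLinearMap (f₀ (d ⊗ₜ c)))
    (hf₀ : IsGradedTwist (TGWC.gr D μ) (TGWC.gr E ν) f₀) :
    IsGradedTwist (TGWA.gr D μ) (TGWA.gr E ν) f := by
  rintro g g' _ ⟨c, hc, rfl⟩ _ ⟨d, hd, rfl⟩
  simp only [AlgHom.toLinearMap_apply, hf]
  exact TensorProduct.map_mem_range_mapIncl (fun x hx => Submodule.mem_map_of_mem hx)
    (fun y hy => Submodule.mem_map_of_mem hy) (hf₀ g g' c hc d hd)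

end Quotient

end TGWD

theorem AlgEquiv.zpow_apply_tmul {k : Type*} [Field k] {R : Type*} [Ring R] [Algebra k R]
    {S : Type*} [Ring S] [Algebra k S] {φ : R ⊗[k] S ≃ₐ[k] R ⊗[k] S} {a : R ≃ₐ[k] R}
    {b : S ≃ₐ[k] S} (h : ∀ r s, φ (r ⊗ₜ s) = a r ⊗ₜ b s) (z : ℤ) (r : R) (s : S) :
    (φ ^ z) (r ⊗ₜ s) = (a ^ z) r ⊗ₜ (b ^ z) s := by
  -- With `φ` identified as a tensor product of automorphisms, its inverse is known too, as negative
  -- powers require.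
  have hφ : φ = Algebra.TensorProduct.congr a b := by
    ext x
    induction x using TensorProduct.induction_on with
    | zero => simp
    | tmul r s => simp [h]
    | add x y hx hy => rw [map_add, map_add, hx, hy]
  have hinv : ∀ r s, φ⁻¹ (r ⊗ₜ s) = a⁻¹ r ⊗ₜ b⁻¹ s := fun r s => by
    rw [hφ]
    rfl
  induction z generalizing r s with
  | zero => simp
  | succ z ih =>
    rw [zpow_add_one, zpow_add_one, zpow_add_one]; simp only [AlgEquiv.mul_apply, h, ih]
  | pred z ih =>
    rw [zpow_sub_one, zpow_sub_one, zpow_sub_one]; simp only [AlgEquiv.mul_apply, hinv, ih]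

/-! ### Embeddings and grading of the twisted tensor product -/

namespace TwistingMap

variable {k : Type*} [Field k] {A : Type*} [Ring A] [Algebra k A] {B : Type*} [Ring B] [Algebra k B]
  (τ : TwistingMap k A B)

theorem of_mul_of (x y : A ⊗[k] B) : τ.of x * τ.of y = τ.of (twistedMul τ.toLin (x ⊗ₜ y)) := rfl

theorem of_tmul_one_mul (a : A) (z : A ⊗[k] B) :
    τ.of (a ⊗ₜ 1) * τ.of z = τ.of (TensorProduct.map (LinearMap.mulLeft k a) LinearMap.id z) := by
  rw [of_mul_of]
  congr 1
  induction z using TensorProduct.induction_on with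
  | zero => simp
  | tmul a' b => simp [twistedMul_tmul, τ.one_tmul]
  | add x y hx hy => simp only [TensorProduct.tmul_add, map_add, hx, hy]

theorem mul_of_one_tmul (b : B) (z : A ⊗[k] B) :
    τ.of z * τ.of (1 ⊗ₜ b) = τ.of (TensorProduct.map LinearMap.id (LinearMap.mulRight k b) z) := by
  rw [of_mul_of]
  congr 1
  induction z using TensorProduct.induction_on with
  | zero => simp
  | tmul a' b => simp [twistedMul_tmul, τ.tmul_one]
  | add x y hx hy => simp only [TensorProduct.add_tmul, map_add, hx, hy]

theorem of_tmul_one_mul_of_tmul (a a' : A) (b : B) :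
    τ.of (a ⊗ₜ 1) * τ.of (a' ⊗ₜ b) = τ.of ((a * a') ⊗ₜ b) := by
  rw [of_tmul_one_mul]; rfl

theorem of_tmul_mul_of_one_tmul (a : A) (b b' : B) :
    τ.of (a ⊗ₜ b) * τ.of (1 ⊗ₜ b') = τ.of (a ⊗ₜ (b * b')) := by
  rw [mul_of_one_tmul]; rfl

/-- `a ↦ a ⊗ 1` is a homomorphism of algebras. -/
noncomputable def includeLeft : A →ₐ[k] τ.TwistedTensor :=
  AlgHom.ofLinearMap (τ.of.toLinearMap ∘ₗ (TensorProduct.mk k A B).flip 1) rfl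
    fun a a' => (τ.of_tmul_one_mul_of_tmul a a' 1).symm

/-- `b ↦ 1 ⊗ b` is a homomorphism of algebras. -/
noncomputable def includeRight : B →ₐ[k] τ.TwistedTensor :=
  AlgHom.ofLinearMap (τ.of.toLinearMap ∘ₗ TensorProduct.mk k A B 1) rfl
    fun b b' => (τ.of_tmul_mul_of_one_tmul 1 b b').symm

theorem includeLeft_apply (a : A) : τ.includeLeft a = τ.of (a ⊗ₜ 1) := rfl

theorem includeRight_apply (b : B) : τ.includeRight b = τ.of (1 ⊗ₜ b) := rfl

theorem includeLeft_mul_includeRight (a : A) (b : B) :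
    τ.includeLeft a * τ.includeRight b = τ.of (a ⊗ₜ b) := by
  rw [includeLeft_apply, includeRight_apply, of_tmul_mul_of_one_tmul, one_mul]

theorem includeRight_mul_includeLeft (a : A) (b : B) :
    τ.includeRight b * τ.includeLeft a = τ.of (τ.toLin (b ⊗ₜ a)) := by
  rw [includeLeft_apply, includeRight_apply, of_mul_of, twistedMul_tmul]
  simp

/-- In the product of `a ⊗ b` and `a' ⊗ b'` the twist of `b ⊗ a'` preserves both degrees, and the
outer multiplications add them. -/
theorem mul_mem_of_isGradedTwist {α β : Type*} [Add α] [Add β] {𝒜 : α → Submodule k A}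
    {ℬ : β → Submodule k B} (h𝒜 : ∀ i j, ∀ x ∈ 𝒜 i, ∀ y ∈ 𝒜 j, x * y ∈ 𝒜 (i + j))
    (hℬ : ∀ i j, ∀ x ∈ ℬ i, ∀ y ∈ ℬ j, x * y ∈ ℬ (i + j)) (hτ : IsGradedTwist 𝒜 ℬ τ.toLin)
    {i i' : α} {j j' : β} {x y : τ.TwistedTensor}
    (hx : τ.of.symm x ∈ LinearMap.range (TensorProduct.mapIncl (𝒜 i) (ℬ j)))
    (hy : τ.of.symm y ∈ LinearMap.range (TensorProduct.mapIncl (𝒜 i') (ℬ j'))) :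
    τ.of.symm (x * y) ∈ LinearMap.range (TensorProduct.mapIncl (𝒜 (i + i')) (ℬ (j + j'))) := by
  obtain ⟨x, rfl⟩ := τ.of.surjective x
  obtain ⟨y, rfl⟩ := τ.of.surjective y
  rw [LinearEquiv.symm_apply_apply] at hx hy
  rw [of_mul_of, LinearEquiv.symm_apply_apply]
  refine TensorProduct.range_mapIncl_induction (P := 𝒜 i) (Q := ℬ j)
    (p := fun x => twistedMul τ.toLin (x ⊗ₜ y) ∈
      LinearMap.range (TensorProduct.mapIncl (𝒜 (i + i')) (ℬ (j + j'))))
    (by rw [TensorProduct.zero_tmul, map_zero]; exact zero_mem _)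
    (fun a ha b hb => ?_) (fun z w hz hw => ?_) hx
  · refine TensorProduct.range_mapIncl_induction (P := 𝒜 i') (Q := ℬ j')
      (p := fun y => twistedMul τ.toLin ((a ⊗ₜ b) ⊗ₜ y) ∈
        LinearMap.range (TensorProduct.mapIncl (𝒜 (i + i')) (ℬ (j + j'))))
      (by rw [TensorProduct.tmul_zero, map_zero]; exact zero_mem _)
      (fun a' ha' b' hb' => ?_) (fun z w hz hw => ?_) hy
    · rw [twistedMul_tmul]
      exact TensorProduct.map_mem_range_mapIncl (fun x hx => h𝒜 _ _ _ ha _ hx)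
        (fun y hy => hℬ _ _ _ hy _ hb') (hτ i' j a' ha' b hb)
    · rw [TensorProduct.tmul_add, map_add]
      exact add_mem hz hw
  · rw [TensorProduct.add_tmul, map_add]
    exact add_mem hz hw

end TwistingMap

/-! ### Grading, relations and cancellation in the quotient algebra -/

namespace TGWD

variable {k : Type*} [Field k] {R : Type*} [Ring R] [Algebra k R] {n : ℕ} {D : TGWD k R n}
  {μ : Matrix (Fin n) (Fin n) kˣ}

namespace TGWA

theorem mul_mem_gr (g h : Fin n → ℤ) (x : D.TGWA μ) (hx : x ∈ gr D μ g) (y : D.TGWA μ)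
    (hy : y ∈ gr D μ h) : x * y ∈ gr D μ (g + h) := by
  obtain ⟨x, hx, rfl⟩ := hx
  obtain ⟨y, hy, rfl⟩ := hy
  exact ⟨x * y, TGWC.mul_mem_gr hx hy, map_mul (mk D μ) _ _⟩

variable (D μ) in
theorem base_mem (r : R) : base D μ r ∈ gr D μ 0 := ⟨_, TGWC.base_mem D μ r, rfl⟩

variable (D μ) in
theorem X_mem (i : Fin n) (ε : ℤˣ) : X D μ i ε ∈ gr D μ (Pi.single i (ε : ℤ)) :=
  ⟨_, TGWC.X_mem D μ i ε, rfl⟩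

variable (D μ) in
theorem one_mem : (1 : D.TGWA μ) ∈ gr D μ 0 := map_one (base D μ) ▸ base_mem D μ 1

variable (D μ) in
/-- The projection onto the component of degree `0`. -/
theorem exists_proj_zero : ∃ p : D.TGWA μ →ₗ[k] D.TGWA μ, (∀ x ∈ gr D μ 0, p x = x) ∧
    ∀ g ≠ 0, ∀ x ∈ gr D μ g, p x = 0 := by
  obtain ⟨s, hs⟩ := (mk D μ).toLinearMap.exists_rightInverse_of_surjective
    (LinearMap.range_eq_top.mpr (mk_surjective D μ))
  -- The canonical ideal is homogeneous, so the class of the degree `0` component depends only on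
  -- the class of `c`, not on the linear section `s`.
  have key : ∀ c, mk D μ (TGWC.proj D μ 0 (s (mk D μ c))) = mk D μ (TGWC.proj D μ 0 c) := by
    intro c
    rw [← sub_eq_zero, ← map_sub, ← map_sub, mk_eq_zero_iff]
    refine TGWC.proj_mem_canonicalIdeal ?_ 0
    rw [← mk_eq_zero_iff, map_sub, sub_eq_zero]
    exact LinearMap.congr_fun hs (mk D μ c)
  refine ⟨(mk D μ).toLinearMap ∘ₗ TGWC.proj D μ 0 ∘ₗ s, ?_, ?_⟩
  · rintro _ ⟨c, hc, rfl⟩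
    exact (key c).trans (by rw [TGWC.proj_of_mem hc]; rfl)
  · rintro g hg _ ⟨c, hc, rfl⟩
    exact (key c).trans (by rw [TGWC.proj_of_mem_ne hc hg, map_zero])

theorem satisfies : TGWC.Satisfies D μ (base D μ) (X D μ) where
  mul_base i ε r := by
    have := congrArg (mk D μ) ((TGWC.satisfies D μ).mul_base i ε r)
    simp only [map_mul] at this
    exact this
  neg_pos i := by
    have := congrArg (mk D μ) ((TGWC.satisfies D μ).neg_pos i)
    simp only [map_mul] at this
    exact this
  pos_neg i := by
    have := congrArg (mk D μ) ((TGWC.satisfies D μ).pos_neg i)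
    simp only [map_mul] at this
    exact this
  pos_neg_of_ne i j hij := by
    have := congrArg (mk D μ) ((TGWC.satisfies D μ).pos_neg_of_ne i j hij)
    simp only [map_mul, map_smul] at this
    exact this

theorem mulLeft_wordProd_injective (hD : D.IsRegular) (hμ : D.IsConsistent μ)
    (u : List (Letter n)) : Function.Injective (LinearMap.mulLeft k (wordProd (X D μ) u)) := by
  induction u with
  | nil => simpa using Function.injective_id
  | cons a u ih =>
    rw [wordProd_cons, LinearMap.mulLeft_mul, LinearMap.coe_comp]
    refine Function.Injective.comp ?_ ih
    rw [injective_iff_map_eq_zero]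
    intro x hx
    obtain ⟨c, rfl⟩ := mk_surjective D μ x
    rw [LinearMap.mulLeft_apply, X, ← map_mul, mk_eq_zero_iff] at hx
    exact mk_eq_zero_iff.mpr (TGWC.mem_of_X_mul_mem hD hμ hx)

theorem mulRight_wordProd_injective (hD : D.IsRegular) (hμ : D.IsConsistent μ)
    (u : List (Letter n)) : Function.Injective (LinearMap.mulRight k (wordProd (X D μ) u)) := by
  induction u with
  | nil => simpa using Function.injective_id
  | cons a u ih =>
    rw [wordProd_cons, LinearMap.mulRight_mul, LinearMap.coe_comp]
    refine ih.comp ?_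
    rw [injective_iff_map_eq_zero]
    intro x hx
    obtain ⟨c, rfl⟩ := mk_surjective D μ x
    rw [LinearMap.mulRight_apply, X, ← map_mul, mk_eq_zero_iff] at hx
    exact mk_eq_zero_iff.mpr (TGWC.mem_of_mul_X_mem hD hμ hx)

end TGWA

end TGWD

/-! ### The homomorphism from `C_η` to `A ⊗_τ B` and its kernel -/

namespace TGWD

variable {k : Type*} [Field k] {R : Type*} [Ring R] [Algebra k R] {S : Type*} [Ring S]
  [Algebra k S] {m n : ℕ} {D : TGWD k R m} {μ : Matrix (Fin m) (Fin m) kˣ} {E : TGWD k S n}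
  {ν : Matrix (Fin n) (Fin n) kˣ} {ρ : Fin n → (R ≃ₐ[k] R)} {σ : Fin m → (S ≃ₐ[k] S)}
  {q : Fin n → Fin m → ℤˣ → ℤˣ → kˣ}

section Generators

variable {A : Type*} [Ring A] [Algebra k A] {B : Type*} [Ring B] [Algebra k B] {iR : R →ₐ[k] A}
  {X : Fin m → ℤˣ → A} {iS : S →ₐ[k] B} {Y : Fin n → ℤˣ → B} {f : B ⊗[k] A →ₗ[k] A ⊗[k] B}

theorem _root_.TwistFormula.base_base (hf : TwistFormula iR X iS Y ρ σ q f) (r : R) (s : S) :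
    f (iS s ⊗ₜ iR r) = iR r ⊗ₜ iS s := by
  simpa [wordScalar, autPow_zero] using hf r s [] []

theorem _root_.TwistFormula.base_X (hf : TwistFormula iR X iS Y ρ σ q f) (s : S) (j : Fin m)
    (ε : ℤˣ) : f (iS s ⊗ₜ X j ε) = X j ε ⊗ₜ iS ((σ j ^ (-(ε : ℤ))) s) := by
  have := hf 1 s [(j, ε)] []
  rw [wordDeg_singleton, ← Pi.single_neg, autPow_single] at this
  simpa [wordScalar, wordProd_cons] using this

theorem _root_.TwistFormula.Y_base (hf : TwistFormula iR X iS Y ρ σ q f) (i : Fin n) (δ : ℤˣ)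
    (r : R) : f (Y i δ ⊗ₜ iR r) = iR ((ρ i ^ (δ : ℤ)) r) ⊗ₜ Y i δ := by
  have := hf r 1 [] [(i, δ)]
  rw [wordDeg_singleton, autPow_single] at this
  simpa [wordScalar, wordProd_cons] using this

theorem _root_.TwistFormula.Y_X (hf : TwistFormula iR X iS Y ρ σ q f) (i : Fin n) (δ : ℤˣ)
    (j : Fin m) (ε : ℤˣ) : f (Y i δ ⊗ₜ X j ε) = (q i j δ ε : k) • (X j ε ⊗ₜ Y i δ) := by
  simpa [wordScalar, wordProd_cons] using hf 1 1 [(j, ε)] [(i, δ)]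

end Generators

section TensorDatumLemmas

variable {G : Type*} [Group G] (a : Matrix (Fin m) (Fin m) G) (b : Matrix (Fin n) (Fin n) G)
  (p : Fin n → Fin m → ℤˣ → ℤˣ → G) (F : Extension D E)

theorem tensorParameter_castAdd_castAdd (i j : Fin m) :
    tensorParameter a b p (Fin.castAdd n i) (Fin.castAdd n j) = a i j :=
  (congrFun (Fin.append_left _ _ i) _).trans (Fin.append_left _ _ j)

theorem tensorParameter_castAdd_natAdd (i : Fin m) (j : Fin n) :
    tensorParameter a b p (Fin.castAdd n i) (Fin.natAdd m j) = (p j i (-1) 1)⁻¹ :=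
  (congrFun (Fin.append_left _ _ i) _).trans (Fin.append_right _ _ j)

theorem tensorParameter_natAdd_castAdd (i : Fin n) (j : Fin m) :
    tensorParameter a b p (Fin.natAdd m i) (Fin.castAdd n j) = p i j 1 (-1) :=
  (congrFun (Fin.append_right _ _ i) _).trans (Fin.append_left _ _ j)

theorem tensorParameter_natAdd_natAdd (i j : Fin n) :
    tensorParameter a b p (Fin.natAdd m i) (Fin.natAdd m j) = b i j :=
  (congrFun (Fin.append_right _ _ i) _).trans (Fin.append_right _ _ j)

theorem Extension.datum_σ_castAdd (j : Fin m) : F.datum.σ (Fin.castAdd n j) = F.σ j :=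
  Fin.append_left _ _ j

theorem Extension.datum_σ_natAdd (i : Fin n) : F.datum.σ (Fin.natAdd m i) = F.ρ i :=
  Fin.append_right _ _ i

theorem Extension.datum_t_castAdd (j : Fin m) : F.datum.t (Fin.castAdd n j) = D.t j ⊗ₜ 1 :=
  Fin.append_left (fun j => D.t j ⊗ₜ[k] (1 : S)) (fun i => (1 : R) ⊗ₜ[k] E.t i) j

theorem Extension.datum_t_natAdd (i : Fin n) : F.datum.t (Fin.natAdd m i) = 1 ⊗ₜ E.t i :=
  Fin.append_right (fun j => D.t j ⊗ₜ[k] (1 : S)) (fun i => (1 : R) ⊗ₜ[k] E.t i) i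

end TensorDatumLemmas

section TensorHom

variable {τ : TwistingMap k (D.TGWA μ) (E.TGWA ν)}

/-- The homomorphism `R ⊗ S → A ⊗_τ B`. -/
noncomputable def tensorBase
    (hτ : TwistFormula (TGWA.base D μ) (TGWA.X D μ) (TGWA.base E ν) (TGWA.X E ν) ρ σ q τ.toLin) :
    R ⊗[k] S →ₐ[k] τ.TwistedTensor :=
  Algebra.TensorProduct.lift (τ.includeLeft.comp (TGWA.base D μ))
    (τ.includeRight.comp (TGWA.base E ν)) fun r s => by
      simp only [AlgHom.comp_apply, Commute, SemiconjBy]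
      rw [τ.includeLeft_mul_includeRight, τ.includeRight_mul_includeLeft, hτ.base_base]

variable (hτ : TwistFormula (TGWA.base D μ) (TGWA.X D μ) (TGWA.base E ν) (TGWA.X E ν) ρ σ q τ.toLin)

theorem tensorBase_tmul (r : R) (s : S) : tensorBase hτ (r ⊗ₜ s) =
    τ.includeLeft (TGWA.base D μ r) * τ.includeRight (TGWA.base E ν s) :=
  Algebra.TensorProduct.lift_tmul _ _ _ _ _

theorem tensorBase_apply (x : R ⊗[k] S) : tensorBase hτ x =
    τ.of (TensorProduct.map (TGWA.base D μ).toLinearMap (TGWA.base E ν).toLinearMap x) := by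
  induction x using TensorProduct.induction_on with
  | zero => simp
  | tmul r s => rw [tensorBase_tmul, τ.includeLeft_mul_includeRight]; rfl
  | add x y hx hy => simp only [map_add, hx, hy]

/-- A tensor product of injective maps over a field is injective; consistency of both data supplies
the injectivity. -/
theorem tensorBase_injective (hμ : D.IsConsistent μ) (hν : E.IsConsistent ν) :
    Function.Injective (tensorBase hτ) := by
  intro x y hxy
  rw [tensorBase_apply, tensorBase_apply] at hxy
  exact TensorProduct.map_injective_of_flat_flat (TGWA.base D μ).toLinearMap
    (TGWA.base E ν).toLinearMap hμ hν (τ.of.injective hxy)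

variable (τ) in
/-- The generators of `A ⊗_τ B`. -/
noncomputable def tensorX : Fin (m + n) → ℤˣ → τ.TwistedTensor :=
  Fin.append (fun j ε => τ.includeLeft (TGWA.X D μ j ε)) fun i δ => τ.includeRight (TGWA.X E ν i δ)

theorem tensorX_castAdd (j : Fin m) (ε : ℤˣ) :
    tensorX τ (Fin.castAdd n j) ε = τ.includeLeft (TGWA.X D μ j ε) := by
  rw [tensorX, Fin.append_left]

theorem tensorX_natAdd (i : Fin n) (δ : ℤˣ) :
    tensorX τ (Fin.natAdd m i) δ = τ.includeRight (TGWA.X E ν i δ) := by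
  rw [tensorX, Fin.append_right]

variable {F : Extension D E} (hFρ : ∀ i r, F.ρ i (r ⊗ₜ[k] 1) = ρ i r ⊗ₜ[k] (1 : S))
  (hFσ : ∀ j s, F.σ j (1 ⊗ₜ[k] s) = (1 : R) ⊗ₜ[k] σ j s)

theorem _root_.TGWD.Extension.σ_tmul (hFσ : ∀ j s, F.σ j (1 ⊗ₜ[k] s) = (1 : R) ⊗ₜ[k] σ j s)
    (j : Fin m) (r : R) (s : S) : F.σ j (r ⊗ₜ s) = D.σ j r ⊗ₜ σ j s := by
  have : r ⊗ₜ[k] s = (r ⊗ₜ 1) * (1 ⊗ₜ s) := by simp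
  rw [this, map_mul, F.σ_extends, hFσ, Algebra.TensorProduct.tmul_mul_tmul, mul_one, one_mul]

theorem _root_.TGWD.Extension.ρ_tmul (hFρ : ∀ i r, F.ρ i (r ⊗ₜ[k] 1) = ρ i r ⊗ₜ[k] (1 : S))
    (i : Fin n) (r : R) (s : S) : F.ρ i (r ⊗ₜ s) = ρ i r ⊗ₜ E.σ i s := by
  have : r ⊗ₜ[k] s = (r ⊗ₜ 1) * (1 ⊗ₜ s) := by simp
  rw [this, map_mul, F.ρ_extends, hFρ, Algebra.TensorProduct.tmul_mul_tmul, mul_one, one_mul]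

include hFρ hFσ in
-- Relations within one block hold in `A` or `B`. The mixed ones are the twisting formula on
-- generators, which dictates the off-diagonal blocks of `η`.
theorem tensor_satisfies : TGWC.Satisfies F.datum (tensorParameter μ ν q) (tensorBase hτ)
    (tensorX τ) where
  mul_base a ε x := by
    induction x using TensorProduct.induction_on with
    | zero => simp
    | add x y hx hy => simp only [map_add, mul_add, add_mul, hx, hy]
    | tmul r s =>
      induction a using Fin.addCases with
      | left j =>
        have hs : (σ j ^ (-(ε : ℤ))) ((σ j ^ (ε : ℤ)) s) = s := by
          rw [← AlgEquiv.mul_apply, ← zpow_add]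
          simp
        rw [tensorX_castAdd, F.datum_σ_castAdd,
          AlgEquiv.zpow_apply_tmul (F.σ_tmul hFσ j), tensorBase_tmul, tensorBase_tmul, ← mul_assoc,
          ← map_mul, TGWA.satisfies.mul_base, mul_assoc, τ.includeRight_mul_includeLeft,
          hτ.base_X, hs, ← τ.includeLeft_mul_includeRight, map_mul, mul_assoc]
      | right i =>
        rw [tensorX_natAdd, F.datum_σ_natAdd,
          AlgEquiv.zpow_apply_tmul (F.ρ_tmul hFρ i), tensorBase_tmul, tensorBase_tmul, ← mul_assoc,
          τ.includeRight_mul_includeLeft, hτ.Y_base, ← τ.includeLeft_mul_includeRight, mul_assoc,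
          ← map_mul, TGWA.satisfies.mul_base, map_mul, mul_assoc]
  neg_pos a := by
    induction a using Fin.addCases with
    | left j =>
      rw [tensorX_castAdd, tensorX_castAdd, F.datum_t_castAdd, tensorBase_tmul,
        map_one, map_one, mul_one, ← map_mul, TGWA.satisfies.neg_pos]
    | right i =>
      rw [tensorX_natAdd, tensorX_natAdd, F.datum_t_natAdd, tensorBase_tmul,
        map_one, map_one, one_mul, ← map_mul, TGWA.satisfies.neg_pos]
  pos_neg a := by
    induction a using Fin.addCases with
    | left j =>
      rw [tensorX_castAdd, tensorX_castAdd, F.datum_σ_castAdd, F.datum_t_castAdd,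
        F.σ_extends, tensorBase_tmul, map_one, map_one, mul_one, ← map_mul, TGWA.satisfies.pos_neg]
    | right i =>
      rw [tensorX_natAdd, tensorX_natAdd, F.datum_σ_natAdd, F.datum_t_natAdd,
        F.ρ_extends, tensorBase_tmul, map_one, map_one, one_mul, ← map_mul, TGWA.satisfies.pos_neg]
  pos_neg_of_ne a b hab := by
    induction a using Fin.addCases with
    | left j =>
      induction b using Fin.addCases with
      | left j' =>
        rw [tensorX_castAdd, tensorX_castAdd, ← map_mul,
          TGWA.satisfies.pos_neg_of_ne j j' fun e => hab (by rw [e]), map_smul, map_mul,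
          tensorParameter_castAdd_castAdd]
      | right i =>
        -- The twist reorders `Y^- X^+` to `q^{(-,+)} X^+ Y^-`, while the relation expresses `X^+
        -- Y^-` by `Y^- X^+`; hence the inverse in this block of `η`.
        rw [tensorX_castAdd, tensorX_natAdd,
          τ.includeRight_mul_includeLeft, hτ.Y_X, map_smul, smul_smul,
          τ.includeLeft_mul_includeRight, tensorParameter_castAdd_natAdd,
          ← Units.val_mul, inv_mul_cancel, Units.val_one, one_smul]
    | right i =>
      induction b using Fin.addCases with
      | left j =>
        rw [tensorX_castAdd, tensorX_natAdd,
          τ.includeRight_mul_includeLeft, hτ.Y_X, map_smul, τ.includeLeft_mul_includeRight,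
          tensorParameter_natAdd_castAdd]
      | right i' =>
        rw [tensorX_natAdd, tensorX_natAdd, ← map_mul,
          TGWA.satisfies.pos_neg_of_ne i i' fun e => hab (by rw [e]), map_smul, map_mul,
          tensorParameter_natAdd_natAdd]

/-- The homomorphism `C_η(R ⊗ S, π, w) → A ⊗_τ B`. -/
noncomputable def tensorHom : F.datum.TGWC (tensorParameter μ ν q) →ₐ[k] τ.TwistedTensor :=
  TGWC.lift (tensor_satisfies hτ hFρ hFσ)

local notation "Ψ" => tensorHom hτ hFρ hFσ

theorem tensorHom_base (x : R ⊗[k] S) : Ψ (TGWC.base _ _ x) = tensorBase hτ x := TGWC.lift_base _ x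

theorem tensorHom_X (a : Fin (m + n)) (ε : ℤˣ) : Ψ (TGWC.X _ _ a ε) = tensorX τ a ε :=
  TGWC.lift_X _ a ε

theorem tensorHom_surjective : Function.Surjective Ψ := by
  rw [← AlgHom.range_eq_top, eq_top_iff]
  have hA : ∀ a, τ.includeLeft a ∈ (Ψ).range := by
    intro a
    obtain ⟨c, rfl⟩ := TGWA.mk_surjective D μ a
    induction c using TGWC.generator_induction with
    | hbase r =>
      refine ⟨TGWC.base _ _ (r ⊗ₜ 1), (tensorHom_base hτ hFρ hFσ _).trans ?_⟩
      rw [tensorBase_tmul, map_one, map_one, mul_one]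
      rfl
    | hX j ε =>
      exact ⟨TGWC.X _ _ (Fin.castAdd n j) ε, (tensorHom_X hτ hFρ hFσ _ _).trans
        (tensorX_castAdd j ε)⟩
    | mul x y hx hy => rw [map_mul, map_mul]; exact mul_mem hx hy
    | add x y hx hy => rw [map_add, map_add]; exact add_mem hx hy
  have hB : ∀ b, τ.includeRight b ∈ (Ψ).range := by
    intro b
    obtain ⟨d, rfl⟩ := TGWA.mk_surjective E ν b
    induction d using TGWC.generator_induction with
    | hbase s =>
      refine ⟨TGWC.base _ _ (1 ⊗ₜ s), (tensorHom_base hτ hFρ hFσ _).trans ?_⟩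
      rw [tensorBase_tmul, map_one, map_one, one_mul]
      rfl
    | hX i δ =>
      exact ⟨TGWC.X _ _ (Fin.natAdd m i) δ, (tensorHom_X hτ hFρ hFσ _ _).trans
        (tensorX_natAdd i δ)⟩
    | mul x y hx hy => rw [map_mul, map_mul]; exact mul_mem hx hy
    | add x y hx hy => rw [map_add, map_add]; exact add_mem hx hy
  intro z _
  obtain ⟨z, rfl⟩ := τ.of.surjective z
  induction z using TensorProduct.induction_on with
  | zero => rw [map_zero]; exact zero_mem _
  | tmul a b => rw [← τ.includeLeft_mul_includeRight]; exact mul_mem (hA a) (hB b)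
  | add x y hx hy => rw [map_add]; exact add_mem (hx trivial) (hy trivial)

theorem tensorHom_mem (hgr : IsGradedTwist (TGWA.gr D μ) (TGWA.gr E ν) τ.toLin)
    {g : Fin (m + n) → ℤ} {x : F.datum.TGWC (tensorParameter μ ν q)} (hx : x ∈ TGWC.gr _ _ g) :
    τ.of.symm (Ψ x) ∈ LinearMap.range (TensorProduct.mapIncl
      (TGWA.gr D μ fun j => g (Fin.castAdd n j)) (TGWA.gr E ν fun i => g (Fin.natAdd m i))) := by
  have hmul : ∀ (g h : Fin (m + n) → ℤ) (x y : τ.TwistedTensor),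
      τ.of.symm x ∈ LinearMap.range (TensorProduct.mapIncl
        (TGWA.gr D μ fun j => g (Fin.castAdd n j)) (TGWA.gr E ν fun i => g (Fin.natAdd m i))) →
      τ.of.symm y ∈ LinearMap.range (TensorProduct.mapIncl
        (TGWA.gr D μ fun j => h (Fin.castAdd n j)) (TGWA.gr E ν fun i => h (Fin.natAdd m i))) →
      τ.of.symm (x * y) ∈ LinearMap.range (TensorProduct.mapIncl
        (TGWA.gr D μ fun j => (g + h) (Fin.castAdd n j))
        (TGWA.gr E ν fun i => (g + h) (Fin.natAdd m i))) := fun g h x y hx hy =>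
    τ.mul_mem_of_isGradedTwist TGWA.mul_mem_gr TGWA.mul_mem_gr hgr hx hy
  have hbase : ∀ x, τ.of.symm (tensorBase hτ x) ∈ LinearMap.range (TensorProduct.mapIncl
      (TGWA.gr D μ 0) (TGWA.gr E ν 0)) := by
    intro x
    induction x using TensorProduct.induction_on with
    | zero => rw [map_zero, map_zero]; exact zero_mem _
    | tmul r s =>
      rw [tensorBase_tmul, τ.includeLeft_mul_includeRight, LinearEquiv.symm_apply_apply]
      exact TensorProduct.tmul_mem_range_mapIncl (TGWA.base_mem D μ r) (TGWA.base_mem E ν s)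
    | add x y hx hy => rw [map_add, map_add]; exact add_mem hx hy
  have hX : ∀ (a : Fin (m + n)) (ε : ℤˣ), τ.of.symm (tensorX τ a ε) ∈
      LinearMap.range (TensorProduct.mapIncl
        (TGWA.gr D μ fun j => (Pi.single a (ε : ℤ) : Fin (m + n) → ℤ) (Fin.castAdd n j))
        (TGWA.gr E ν fun i => (Pi.single a (ε : ℤ) : Fin (m + n) → ℤ) (Fin.natAdd m i))) := by
    intro a ε
    induction a using Fin.addCases with
    | left j =>
      have h1 : (fun j' => (Pi.single (Fin.castAdd n j) (ε : ℤ) : Fin (m + n) → ℤ)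
          (Fin.castAdd n j')) = Pi.single j (ε : ℤ) := by
        ext j'
        simp [Pi.single_apply]
      have h2 : (fun i => (Pi.single (Fin.castAdd n j) (ε : ℤ) : Fin (m + n) → ℤ)
          (Fin.natAdd m i)) = 0 := by
        ext i
        simp [Pi.single_apply, Fin.ext_iff]
        omega
      rw [h1, h2, tensorX_castAdd, τ.includeLeft_apply, LinearEquiv.symm_apply_apply]
      exact TensorProduct.tmul_mem_range_mapIncl (TGWA.X_mem D μ j ε) (TGWA.one_mem E ν)
    | right i =>
      have h1 : (fun j => (Pi.single (Fin.natAdd m i) (ε : ℤ) : Fin (m + n) → ℤ)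
          (Fin.castAdd n j)) = 0 := by
        ext j
        simp [Pi.single_apply, Fin.ext_iff]
        omega
      have h2 : (fun i' => (Pi.single (Fin.natAdd m i) (ε : ℤ) : Fin (m + n) → ℤ)
          (Fin.natAdd m i')) = Pi.single i (ε : ℤ) := by
        ext i'
        simp [Pi.single_apply]
      rw [h1, h2, tensorX_natAdd, τ.includeRight_apply, LinearEquiv.symm_apply_apply]
      exact TensorProduct.tmul_mem_range_mapIncl (TGWA.one_mem D μ) (TGWA.X_mem E ν i ε)
  have hword : ∀ w, τ.of.symm (wordProd (tensorX τ) w) ∈ LinearMap.range (TensorProduct.mapIncl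
      (TGWA.gr D μ fun j => wordDeg w (Fin.castAdd n j))
      (TGWA.gr E ν fun i => wordDeg w (Fin.natAdd m i))) := by
    intro w
    induction w with
    | nil =>
      have := hbase 1
      rw [map_one] at this
      rw [wordProd_nil, wordDeg_nil]
      exact this
    | cons a w ih =>
      rw [wordProd_cons, wordDeg_cons]
      exact hmul _ _ _ _ (hX _ _) ih
  refine TGWC.gr_induction (p := fun x => τ.of.symm (Ψ x) ∈ LinearMap.range (TensorProduct.mapIncl
      (TGWA.gr D μ fun j => g (Fin.castAdd n j)) (TGWA.gr E ν fun i => g (Fin.natAdd m i))))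
    (fun t w hw => ?_) ?_ (fun x y hx hy => ?_) (fun c x hx => ?_) hx
  · rw [map_mul, map_wordProd, tensorHom_base]
    simp only [tensorHom_X]
    have := hmul 0 (wordDeg w) _ _ (hbase t) (hword w)
    rwa [zero_add, hw] at this
  · rw [map_zero, map_zero]
    exact zero_mem _
  · rw [map_add, map_add]
    exact add_mem hx hy
  · rw [map_smul, map_smul]
    exact Submodule.smul_mem _ _ hx

/-- `Ψ` commutes with projection to degree `0`, so it kills the degree `0` component of `b x c`.
That component comes from `R ⊗ S`, on which `Ψ` is injective. -/
theorem mem_canonicalIdeal_of_tensorHom_eq_zero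
    (hgr : IsGradedTwist (TGWA.gr D μ) (TGWA.gr E ν) τ.toLin)
    (hμ : D.IsConsistent μ) (hν : E.IsConsistent ν)
    {x : F.datum.TGWC (tensorParameter μ ν q)} (hx : Ψ x = 0) :
    x ∈ F.datum.canonicalIdeal (tensorParameter μ ν q) := by
  obtain ⟨p, hp0, hp⟩ := TGWA.exists_proj_zero D μ
  obtain ⟨p', hp0', hp'⟩ := TGWA.exists_proj_zero E ν
  have key : ∀ y, τ.of.symm (Ψ (TGWC.proj _ _ 0 y)) = TensorProduct.map p p' (τ.of.symm (Ψ y)) := by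
    intro y
    induction y using TGWC.homogeneous_induction with
    | add x y hx hy => simp only [map_add, hx, hy]
    | mem g y hy =>
      have hmem := tensorHom_mem hτ hFρ hFσ hgr hy
      by_cases hg : g = 0
      · subst hg
        rw [TGWC.proj_of_mem hy]
        refine TensorProduct.range_mapIncl_induction (P := TGWA.gr D μ 0) (Q := TGWA.gr E ν 0)
          (p := fun z => z = TensorProduct.map p p' z) (by simp) (fun a ha b hb => ?_)
          (fun z w hz hw => ?_) hmem
        · rw [TensorProduct.map_tmul, hp0 a ha, hp0' b hb]
        · rw [map_add, ← hz, ← hw]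
      · rw [TGWC.proj_of_mem_ne hy hg, map_zero, map_zero, eq_comm]
        refine TensorProduct.range_mapIncl_induction
          (P := TGWA.gr D μ fun j => g (Fin.castAdd n j))
          (Q := TGWA.gr E ν fun i => g (Fin.natAdd m i))
          (p := fun z => TensorProduct.map p p' z = 0) (by simp) (fun a ha b hb => ?_)
          (fun z w hz hw => ?_) hmem
        · rw [TensorProduct.map_tmul]
          -- A nonzero degree is nonzero in at least one block, and the projection of that tensor
          -- factor vanishes.
          by_cases h1 : (fun j => g (Fin.castAdd n j)) = 0
          · rw [hp' _ (fun h2 => hg ?_) b hb, TensorProduct.tmul_zero]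
            ext a
            induction a using Fin.addCases with
            | left j => exact congrFun h1 j
            | right i => exact congrFun h2 i
          · rw [hp _ h1 a ha, TensorProduct.zero_tmul]
        · rw [map_add, hz, hw, add_zero]
  rw [TGWC.mem_canonicalIdeal_iff]
  intro b c
  have h0 : Ψ (TGWC.proj _ _ 0 (b * x * c)) = 0 := by
    apply τ.of.symm.injective
    rw [key, map_mul (Ψ), map_mul (Ψ), hx, mul_zero, zero_mul, map_zero, map_zero]
  obtain ⟨t, ht⟩ := TGWC.exists_eq_base (TGWC.proj_mem 0 (b * x * c))
  rw [ht, tensorHom_base, map_eq_zero_iff _ (tensorBase_injective hτ hμ hν)] at h0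
  rw [ht, h0, map_zero]

include hτ hFρ hFσ in
-- The injective map `R ⊗ S → A ⊗_τ B` factors through `C_η`, so `R ⊗ S → C_η` is injective.
theorem tensor_isConsistent (hμ : D.IsConsistent μ) (hν : E.IsConsistent ν) :
    F.datum.IsConsistent (tensorParameter μ ν q) := by
  rw [isConsistent_iff_injective]
  refine Function.Injective.of_comp (f := Ψ) ?_
  convert tensorBase_injective hτ hμ hν
  ext x
  exact tensorHom_base hτ hFρ hFσ x

theorem wordDeg_map_castAdd (u : List (Letter m)) :
    wordDeg (u.map fun a => ((Fin.castAdd n a.1, a.2) : Letter (m + n))) =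
      Fin.append (wordDeg u) 0 := by
  induction u with
  | nil => ext a; induction a using Fin.addCases <;> simp
  | cons a u ih =>
    rw [List.map_cons, wordDeg_cons, ih, wordDeg_cons]
    ext b
    induction b using Fin.addCases with
    | left j => simp [Pi.single_apply]
    | right i =>
      simp [Pi.single_apply, Fin.ext_iff]
      omega

theorem wordDeg_map_natAdd (v : List (Letter n)) :
    wordDeg (v.map fun a => ((Fin.natAdd m a.1, a.2) : Letter (m + n))) =
      Fin.append 0 (wordDeg v) := by
  induction v with
  | nil => ext a; induction a using Fin.addCases <;> simp
  | cons a u ih =>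
    rw [List.map_cons, wordDeg_cons, ih, wordDeg_cons]
    ext b
    induction b using Fin.addCases with
    | left j =>
      simp [Pi.single_apply, Fin.ext_iff]
      omega
    | right i => simp [Pi.single_apply]

/-- A homogeneous element of the ideal is multiplied into degree `0`, where the ideal vanishes, and
the multipliers are then cancelled in `A ⊗_τ B`. This is where regularity enters the isomorphism. -/
theorem tensorHom_eq_zero_of_mem_canonicalIdeal (hD : D.IsRegular) (hE : E.IsRegular)
    (hμ : D.IsConsistent μ) (hν : E.IsConsistent ν)
    {x : F.datum.TGWC (tensorParameter μ ν q)}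
    (hx : x ∈ F.datum.canonicalIdeal (tensorParameter μ ν q)) : Ψ x = 0 := by
  refine TGWC.mem_of_forall_proj_mem (N := (LinearMap.ker (Ψ).toLinearMap).toAddSubmonoid)
    fun g => ?_
  change Ψ (TGWC.proj _ _ g x) = 0
  have hgJ := TGWC.proj_mem_canonicalIdeal hx g
  have hg := TGWC.proj_mem g x
  generalize TGWC.proj _ _ g x = y at hgJ hg
  -- The `X` go to the left and the `Y` to the right because on these sides multiplication in `A ⊗_τ
  -- B` touches a single tensor factor and involves no twist.
  obtain ⟨u, hu⟩ := exists_wordDeg_eq fun j => -g (Fin.castAdd n j)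
  obtain ⟨v, hv⟩ := exists_wordDeg_eq fun i => -g (Fin.natAdd m i)
  set u' := u.map fun a => ((Fin.castAdd n a.1, a.2) : Letter (m + n)) with hu'
  set v' := v.map fun a => ((Fin.natAdd m a.1, a.2) : Letter (m + n)) with hv'
  have hzero : wordProd (TGWC.X _ _) u' * y * wordProd (TGWC.X _ _) v' = 0 := by
    refine TGWC.eq_zero_of_mem_canonicalIdeal
      (Ideal.mul_mem_right _ _ (Ideal.mul_mem_left _ _ hgJ)) ?_
    have h0 : wordDeg u' + g + wordDeg v' = 0 := by
      rw [hu', hv', wordDeg_map_castAdd, wordDeg_map_natAdd, hu, hv]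
      ext a
      induction a using Fin.addCases <;> simp
    rw [← h0]
    exact TGWC.mul_mem_gr (TGWC.mul_mem_gr (TGWC.wordProd_mem _ _ _) hg) (TGWC.wordProd_mem _ _ _)
  have hΨu : Ψ (wordProd (TGWC.X _ _) u') = τ.includeLeft (wordProd (TGWA.X D μ) u) := by
    rw [map_wordProd, map_wordProd]
    simp only [tensorHom_X, hu', wordProd, List.map_map, Function.comp_def, tensorX_castAdd]
  have hΨv : Ψ (wordProd (TGWC.X _ _) v') = τ.includeRight (wordProd (TGWA.X E ν) v) := by
    rw [map_wordProd, map_wordProd]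
    simp only [tensorHom_X, hv', wordProd, List.map_map, Function.comp_def, tensorX_natAdd]
  have hΨ := congrArg Ψ hzero
  obtain ⟨z, hz⟩ := τ.of.surjective (Ψ y)
  rw [map_mul, map_mul, hΨu, hΨv, map_zero, ← hz, τ.includeLeft_apply, τ.includeRight_apply,
    τ.of_tmul_one_mul, τ.mul_of_one_tmul, LinearEquiv.map_eq_zero_iff] at hΨ
  -- Flatness over the field carries the injective multiplications on `A` and `B` over to `A ⊗ B`.
  have h1 := Module.Flat.lTensor_preserves_injective_linearMap (M := D.TGWA μ) _
    (TGWA.mulRight_wordProd_injective hE hν v)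
  have h2 := Module.Flat.rTensor_preserves_injective_linearMap (M := E.TGWA ν) _
    (TGWA.mulLeft_wordProd_injective hD hμ u)
  rw [← hz, LinearEquiv.map_eq_zero_iff]
  exact (map_eq_zero_iff _ h2).mp ((map_eq_zero_iff _ h1).mp hΨ)

end TensorHom

end TGWD

/-! ### Restricting automorphisms to tensor factors; regularity in `R ⊗ S` -/

section Contract

variable {k : Type*} [Field k] {R : Type*} [Ring R] [Algebra k R] {S : Type*} [Ring S] [Algebra k S]

/-- The contraction `R ⊗ S → R` along a linear form on `S`. -/
noncomputable def TensorProduct.contractForm (f : S →ₗ[k] k) : R ⊗[k] S →ₗ[k] R :=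
  (TensorProduct.rid k R).toLinearMap ∘ₗ f.lTensor R

@[simp] theorem TensorProduct.contractForm_tmul (f : S →ₗ[k] k) (r : R) (s : S) :
    contractForm f (r ⊗ₜ s) = f s • r := by simp [contractForm]

variable (k S) in
theorem exists_form_one_eq_one [Nontrivial S] : ∃ f : S →ₗ[k] k, f 1 = 1 := by
  obtain ⟨f, hf⟩ := (Algebra.linearMap k S).exists_leftInverse_of_injective
    (LinearMap.ker_eq_bot.mpr (algebraMap k S).injective)
  exact ⟨f, by simpa using LinearMap.congr_fun hf 1⟩

theorem tmul_one_injective [Nontrivial S] :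
    Function.Injective fun r : R => r ⊗ₜ[k] (1 : S) := by
  obtain ⟨f, hf⟩ := exists_form_one_eq_one k S
  intro r r' h
  simpa [hf] using congrArg (TensorProduct.contractForm f) h

theorem one_tmul_injective [Nontrivial R] :
    Function.Injective fun s : S => (1 : R) ⊗ₜ[k] s := by
  intro s s' h
  exact tmul_one_injective (k := k) (S := R) (by simpa using congrArg (TensorProduct.comm k R S) h)

/-- An automorphism of `R ⊗ S` which restricts to an automorphism of `S` and maps `R` into itself
restricts to an automorphism of `R`. -/
theorem exists_algEquiv_of_tmul_one_stable [Nontrivial S] (φ : R ⊗[k] S ≃ₐ[k] R ⊗[k] S)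
    (b : S ≃ₐ[k] S) (hb : ∀ s, φ (1 ⊗ₜ s) = 1 ⊗ₜ b s) (h : ∀ r, ∃ r', φ (r ⊗ₜ 1) = r' ⊗ₜ 1) :
    ∃ a : R ≃ₐ[k] R, ∀ r, φ (r ⊗ₜ 1) = a r ⊗ₜ 1 := by
  obtain ⟨f, hf⟩ := exists_form_one_eq_one k S
  have hinj := tmul_one_injective (k := k) (R := R) (S := S)
  -- Since `f 1 = 1`, contracting `r' ⊗ 1` along `f` returns `r'`.
  let a₀ : R →ₗ[k] R := TensorProduct.contractForm f ∘ₗ φ.toLinearMap ∘ₗ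
    (TensorProduct.mk k R S).flip 1
  have ha₀ : ∀ r, φ (r ⊗ₜ 1) = a₀ r ⊗ₜ 1 := by
    intro r
    obtain ⟨r', hr'⟩ := h r
    have : a₀ r = TensorProduct.contractForm f (φ (r ⊗ₜ 1)) := rfl
    rw [this, hr', TensorProduct.contractForm_tmul, hf, one_smul]
  let a : R →ₐ[k] R := AlgHom.ofLinearMap a₀
    (hinj (by simp only [← ha₀]; exact map_one φ))
    (fun x y => hinj (by
      simp only [← ha₀]
      have : (x * y) ⊗ₜ[k] (1 : S) = (x ⊗ₜ 1) * (y ⊗ₜ 1) := by simp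
      rw [this, map_mul, ha₀, ha₀, Algebra.TensorProduct.tmul_mul_tmul, mul_one]))
  have ha : ∀ r, φ (r ⊗ₜ 1) = a r ⊗ₜ 1 := ha₀
  -- Stability gives only an injection of `R` into itself. Surjectivity uses the hypothesis on `S`:
  -- `φ (r ⊗ s) = a r ⊗ b s` contracts to a multiple of `a r`, and every `r ⊗ 1` is a value of `φ`.
  have hrange : ∀ x, TensorProduct.contractForm f (φ x) ∈ a.range := by
    intro x
    induction x using TensorProduct.induction_on with
    | zero => simp
    | add x y hx hy => rw [map_add, map_add]; exact add_mem hx hy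
    | tmul r s =>
      have : r ⊗ₜ[k] s = (r ⊗ₜ 1) * (1 ⊗ₜ s) := by simp
      rw [this, map_mul, ha, hb, Algebra.TensorProduct.tmul_mul_tmul, mul_one, one_mul,
        TensorProduct.contractForm_tmul]
      exact Subalgebra.smul_mem a.range (AlgHom.mem_range_self a r) _
  refine ⟨AlgEquiv.ofBijective a ⟨fun x y hxy => hinj (φ.injective ?_), fun r => ?_⟩, ha⟩
  · simp only [ha, hxy]
  · have := hrange (φ.symm (r ⊗ₜ 1))
    rw [AlgEquiv.apply_symm_apply, TensorProduct.contractForm_tmul, hf, one_smul] at this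
    exact this

theorem exists_algEquiv_of_one_tmul_stable [Nontrivial R] (φ : R ⊗[k] S ≃ₐ[k] R ⊗[k] S)
    (a : R ≃ₐ[k] R) (ha : ∀ r, φ (r ⊗ₜ 1) = a r ⊗ₜ 1) (h : ∀ s, ∃ s', φ (1 ⊗ₜ s) = 1 ⊗ₜ s') :
    ∃ b : S ≃ₐ[k] S, ∀ s, φ (1 ⊗ₜ s) = 1 ⊗ₜ b s := by
  let c := Algebra.TensorProduct.comm k R S
  obtain ⟨b, hb⟩ := exists_algEquiv_of_tmul_one_stable ((c.symm.trans φ).trans c) a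
    (fun r => by simp [c, ha]) (fun s => by
      obtain ⟨s', hs'⟩ := h s
      exact ⟨s', by simp [c, hs']⟩)
  refine ⟨b, fun s => c.injective ?_⟩
  simpa [c] using hb s

theorem IsRegular.tmul_one {t : R} (ht : IsRegular t) : IsRegular (t ⊗ₜ[k] (1 : S)) := by
  constructor
  · have h := Module.Flat.rTensor_preserves_injective_linearMap (M := S) (LinearMap.mulLeft k t)
      ht.left
    have e : ∀ x, (LinearMap.mulLeft k t).rTensor S x = (t ⊗ₜ[k] (1 : S)) * x := fun x => by
      induction x using TensorProduct.induction_on with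
      | zero => simp
      | tmul r s => simp
      | add x y hx hy => rw [map_add, hx, hy, mul_add]
    intro x y hxy
    exact h ((e x).trans (Eq.trans hxy (e y).symm))
  · have h := Module.Flat.rTensor_preserves_injective_linearMap (M := S) (LinearMap.mulRight k t)
      ht.right
    have e : ∀ x, (LinearMap.mulRight k t).rTensor S x = x * (t ⊗ₜ[k] (1 : S)) := fun x => by
      induction x using TensorProduct.induction_on with
      | zero => simp
      | tmul r s => simp
      | add x y hx hy => rw [map_add, hx, hy, add_mul]
    intro x y hxy
    exact h ((e x).trans (Eq.trans hxy (e y).symm))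

theorem IsRegular.one_tmul {t : S} (ht : IsRegular t) : IsRegular ((1 : R) ⊗ₜ[k] t) := by
  simpa using (ht.tmul_one (k := k) (S := R)).map_algEquiv (Algebra.TensorProduct.comm k S R)

end Contract

/-! ### Assembly of the theorem -/

namespace TGWD

variable {k : Type*} [Field k] {R : Type*} [Ring R] [Algebra k R] {S : Type*} [Ring S]
  [Algebra k S] {m n : ℕ} {D : TGWD k R m} {μ : Matrix (Fin m) (Fin m) kˣ} {E : TGWD k S n}
  {ν : Matrix (Fin n) (Fin n) kˣ} {ρ : Fin n → (R ≃ₐ[k] R)} {σ : Fin m → (S ≃ₐ[k] S)}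
  {q : Fin n → Fin m → ℤˣ → ℤˣ → kˣ} (F : Extension D E)

theorem Extension.datum_isRegular (hD : D.IsRegular) (hE : E.IsRegular) : F.datum.IsRegular := by
  intro a
  induction a using Fin.addCases with
  | left j => rw [F.datum_t_castAdd]; exact (hD j).tmul_one
  | right i => rw [F.datum_t_natAdd]; exact (hE i).one_tmul

/-- Every identity is checked in `R ⊗ S` and pulled back along the injections of the two nonzero
factors. -/
theorem Extension.twistData [Nontrivial R] [Nontrivial S]
    (hFρ : ∀ i r, F.ρ i (r ⊗ₜ[k] 1) = ρ i r ⊗ₜ[k] (1 : S))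
    (hFσ : ∀ j s, F.σ j (1 ⊗ₜ[k] s) = (1 : R) ⊗ₜ[k] σ j s)
    (hρ : ∀ i j, F.ρ i (D.t j ⊗ₜ[k] 1) =
      ((q i j 1 (-1) * q i j 1 1 : kˣ) : k) • (D.t j ⊗ₜ[k] (1 : S)))
    (hσ : ∀ i j, F.σ j (1 ⊗ₜ[k] E.t i) =
      ((q i j (-1) (-1) * q i j 1 (-1) : kˣ) : k) • ((1 : R) ⊗ₜ[k] E.t i))
    (hq : ∀ i j, q i j (-1) (-1) * q i j (-1) 1 * q i j 1 (-1) * q i j 1 1 = 1) :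
    TwistData D E ρ σ q where
  ρ_scaling i δ :=
    { commute := fun j => by
        refine Commute.zpow_left ?_ _
        ext r
        apply tmul_one_injective (k := k) (S := S)
        have := DFunLike.congr_fun (F.commute_σ_ρ j i).eq (r ⊗ₜ 1)
        simp only [AlgEquiv.mul_apply, hFρ, F.σ_extends] at this
        exact this.symm
      map_t := fun j => by
        have ht : ρ i (D.t j) = ((q i j 1 (-1) * q i j 1 1 : kˣ) : k) • D.t j := by
          apply tmul_one_injective (k := k) (S := S)
          simp only [← hFρ, hρ, TensorProduct.smul_tmul']
        rw [AlgEquiv.zpow_apply_eq_smul ht]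
        congr 2
        rcases Int.units_eq_one_or δ with rfl | rfl
        · simp
        -- The hypotheses give the eigenvalue of `ρᵢ` only; `hq` says that its inverse is `q^{(-,-)}
        -- q^{(-,+)}`, as `ρᵢ⁻¹` requires.
        · rw [Units.val_neg, Units.val_one, zpow_neg_one, inv_eq_iff_mul_eq_one, ← hq i j]
          ac_rfl }
  σ_scaling j ε :=
    { commute := fun i => by
        refine Commute.zpow_left ?_ _
        ext s
        apply one_tmul_injective (k := k) (R := R)
        have := DFunLike.congr_fun (F.commute_σ_ρ j i).eq (1 ⊗ₜ s)
        simp only [AlgEquiv.mul_apply, hFσ, F.ρ_extends] at this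
        exact this
      map_t := fun i => by
        have ht : σ j (E.t i) = ((q i j (-1) (-1) * q i j 1 (-1) : kˣ) : k) • E.t i := by
          apply one_tmul_injective (k := k) (R := R)
          simp only [← hFσ, hσ, TensorProduct.tmul_smul]
        rw [AlgEquiv.zpow_apply_eq_smul ht]
        congr 2
        rcases Int.units_eq_one_or ε with rfl | rfl
        -- For `ε = 1` the automorphism is `σⱼ⁻¹`, and `hq` turns the inverse of `q^{(-,-)}
        -- q^{(+,-)}` into `q^{(-,+)} q^{(+,+)}`.
        · rw [Units.val_one, zpow_neg_one, inv_eq_iff_mul_eq_one, ← hq i j]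
          ac_rfl
        · simp }
  ρ_commute i i' := by
    ext r
    apply tmul_one_injective (k := k) (S := S)
    have := DFunLike.congr_fun (F.commute_ρ i i').eq (r ⊗ₜ 1)
    simp only [AlgEquiv.mul_apply, hFρ] at this
    exact this
  σ_commute j j' := by
    ext s
    apply one_tmul_injective (k := k) (R := R)
    have := DFunLike.congr_fun (F.commute_σ j j').eq (1 ⊗ₜ s)
    simp only [AlgEquiv.mul_apply, hFσ] at this
    exact this

variable {F} in
/-- The isomorphism `A_η(R ⊗ S, π, w) ≃ A ⊗_τ B`. -/
theorem exists_algEquiv_twistedTensor {τ : TwistingMap k (D.TGWA μ) (E.TGWA ν)}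
    (hτ : TwistFormula (TGWA.base D μ) (TGWA.X D μ) (TGWA.base E ν) (TGWA.X E ν) ρ σ q τ.toLin)
    (hgr : IsGradedTwist (TGWA.gr D μ) (TGWA.gr E ν) τ.toLin)
    (hFρ : ∀ i r, F.ρ i (r ⊗ₜ[k] 1) = ρ i r ⊗ₜ[k] (1 : S))
    (hFσ : ∀ j s, F.σ j (1 ⊗ₜ[k] s) = (1 : R) ⊗ₜ[k] σ j s)
    (hD : D.IsRegular) (hE : E.IsRegular) (hμ : D.IsConsistent μ) (hν : E.IsConsistent ν) :
    ∃ e : F.datum.TGWA (tensorParameter μ ν q) ≃ₐ[k] τ.TwistedTensor,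
      ∀ x, e (TGWA.mk _ _ x) = tensorHom hτ hFρ hFσ x := by
  let f : F.datum.TGWA (tensorParameter μ ν q) →ₐ[k] τ.TwistedTensor :=
    Ideal.Quotient.liftₐ (F.datum.canonicalIdeal (tensorParameter μ ν q)) (tensorHom hτ hFρ hFσ)
      fun x hx => tensorHom_eq_zero_of_mem_canonicalIdeal hτ hFρ hFσ hD hE hμ hν hx
  have hf : ∀ x, f (TGWA.mk _ _ x) = tensorHom hτ hFρ hFσ x := fun x => rfl
  refine ⟨AlgEquiv.ofBijective f ⟨?_, fun z => ?_⟩, hf⟩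
  · rw [injective_iff_map_eq_zero]
    intro x hx
    obtain ⟨x, rfl⟩ := TGWA.mk_surjective _ _ x
    exact TGWA.mk_eq_zero_iff.mpr
      (mem_canonicalIdeal_of_tensorHom_eq_zero hτ hFρ hFσ hgr hμ hν ((hf x).symm.trans hx))
  · obtain ⟨x, rfl⟩ := tensorHom_surjective hτ hFρ hFσ z
    exact ⟨_, hf x⟩

theorem TGWC.subsingleton [h : Subsingleton R] : Subsingleton (D.TGWC μ) :=
  subsingleton_of_zero_eq_one (by
    rw [← map_zero (base D μ), ← map_one (base D μ), Subsingleton.elim (0 : R) 1])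

theorem TGWA.subsingleton [h : Subsingleton R] : Subsingleton (D.TGWA μ) :=
  subsingleton_of_zero_eq_one (by
    rw [← map_zero (base D μ), ← map_one (base D μ), Subsingleton.elim (0 : R) 1])

end TGWD

theorem TensorProduct.subsingleton_of_or {k : Type*} [Field k] {M N : Type*} [AddCommGroup M]
    [Module k M] [AddCommGroup N] [Module k N] (h : Subsingleton M ∨ Subsingleton N) :
    Subsingleton (M ⊗[k] N) := by
  refine subsingleton_of_forall_eq 0 fun x => ?_
  induction x using TensorProduct.induction_on with
  | zero => rfl
  | tmul x y =>
    rcases h with h | h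
    · rw [Subsingleton.elim x 0, zero_tmul]
    · rw [Subsingleton.elim y 0, tmul_zero]
  | add x y hx hy => rw [hx, hy, add_zero]

/-- The zero twisting map, if the tensor product is trivial. -/
def TwistingMap.ofSubsingleton {k : Type*} [Field k] {A : Type*} [Ring A] [Algebra k A]
    {B : Type*} [Ring B] [Algebra k B] (h : Subsingleton (A ⊗[k] B)) : TwistingMap k A B where
  toLin := 0
  tmul_one _ := Subsingleton.elim _ _
  one_tmul _ := Subsingleton.elim _ _
  assoc _ _ _ := Subsingleton.elim _ _

theorem theorem3p7 {k : Type*} [Field k] {R : Type*} [Ring R] [Algebra k R]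
    {S : Type*} [Ring S] [Algebra k S] {m n : ℕ}
    (D : TGWD k R m) (μ : Matrix (Fin m) (Fin m) kˣ)
    (E : TGWD k S n) (ν : Matrix (Fin n) (Fin n) kˣ)
    (hD : D.IsRegular) (hDμ : D.IsConsistent μ)
    (hE : E.IsRegular) (hEν : E.IsConsistent ν)
    (F : TGWD.Extension D E)
    (q : Fin n → Fin m → ℤˣ → ℤˣ → kˣ)
    (hρ : ∀ i j, F.ρ i (D.t j ⊗ₜ[k] 1) =
      ((q i j 1 (-1) * q i j 1 1 : kˣ) : k) • (D.t j ⊗ₜ[k] (1 : S)))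
    (hσ : ∀ i j, F.σ j (1 ⊗ₜ[k] E.t i) =
      ((q i j (-1) (-1) * q i j 1 (-1) : kˣ) : k) • ((1 : R) ⊗ₜ[k] E.t i))
    (hq : ∀ i j, q i j (-1) (-1) * q i j (-1) 1 * q i j 1 (-1) * q i j 1 1 = 1) :
    -- the extended automorphisms restrict to automorphisms of `R` and of `S`
    ∃ (ρR : Fin n → (R ≃ₐ[k] R)) (σS : Fin m → (S ≃ₐ[k] S)),
      (∀ i r, F.ρ i (r ⊗ₜ[k] 1) = ρR i r ⊗ₜ[k] (1 : S)) ∧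
      (∀ j s, F.σ j (1 ⊗ₜ[k] s) = (1 : R) ⊗ₜ[k] σS j s) ∧
      -- the twisting map between the twisted generalized Weyl constructions
      ∃ τ₀ : TwistingMap k (D.TGWC μ) (E.TGWC ν),
        TwistFormula (TGWD.TGWC.base D μ) (TGWD.TGWC.X D μ) (TGWD.TGWC.base E ν)
          (TGWD.TGWC.X E ν) ρR σS q τ₀.toLin ∧
        (∀ f, TwistFormula (TGWD.TGWC.base D μ) (TGWD.TGWC.X D μ) (TGWD.TGWC.base E ν)
          (TGWD.TGWC.X E ν) ρR σS q f → f = τ₀.toLin) ∧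
        IsGradedTwist (TGWD.TGWC.gr D μ) (TGWD.TGWC.gr E ν) τ₀.toLin ∧
        -- the twisting map between the twisted generalized Weyl algebras
        ∃ τ : TwistingMap k (D.TGWA μ) (E.TGWA ν),
          (∀ d c, τ.toLin (TGWD.TGWA.mk E ν d ⊗ₜ TGWD.TGWA.mk D μ c) =
            TensorProduct.map (TGWD.TGWA.mk D μ).toLinearMap (TGWD.TGWA.mk E ν).toLinearMap
              (τ₀.toLin (d ⊗ₜ c))) ∧
          TwistFormula (TGWD.TGWA.base D μ) (TGWD.TGWA.X D μ) (TGWD.TGWA.base E ν)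
            (TGWD.TGWA.X E ν) ρR σS q τ.toLin ∧
          (∀ f, TwistFormula (TGWD.TGWA.base D μ) (TGWD.TGWA.X D μ) (TGWD.TGWA.base E ν)
            (TGWD.TGWA.X E ν) ρR σS q f → f = τ.toLin) ∧
          IsGradedTwist (TGWD.TGWA.gr D μ) (TGWD.TGWA.gr E ν) τ.toLin ∧
          -- the twisted tensor product is a regular, `η`-consistent TGWA of rank `m + n`
          F.datum.IsRegular ∧
          F.datum.IsConsistent (TGWD.tensorParameter μ ν q) ∧
          ∃ e : F.datum.TGWA (TGWD.tensorParameter μ ν q) ≃ₐ[k] τ.TwistedTensor,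
            (∀ r s, e (TGWD.TGWA.base F.datum (TGWD.tensorParameter μ ν q) (r ⊗ₜ[k] s)) =
              τ.of (TGWD.TGWA.base D μ r ⊗ₜ TGWD.TGWA.base E ν s)) ∧
            (∀ j ε, e (TGWD.TGWA.X F.datum (TGWD.tensorParameter μ ν q) (Fin.castAdd n j) ε) =
              τ.of (TGWD.TGWA.X D μ j ε ⊗ₜ 1)) ∧
            (∀ i ε, e (TGWD.TGWA.X F.datum (TGWD.tensorParameter μ ν q) (Fin.natAdd m i) ε) =
              τ.of (1 ⊗ₜ TGWD.TGWA.X E ν i ε)) := by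
  -- If one factor is zero, the other does not embed in `R ⊗ S`, so the restrictions cannot be
  -- extracted from the extended automorphisms.
  by_cases hRS : Nontrivial R ∧ Nontrivial S
  · obtain ⟨_, _⟩ := hRS
    choose ρR hρR using fun i => exists_algEquiv_of_tmul_one_stable (F.ρ i) (E.σ i)
      (F.ρ_extends i) (F.ρ_stable i)
    choose σS hσS using fun j => exists_algEquiv_of_one_tmul_stable (F.σ j) (D.σ j)
      (F.σ_extends j) (F.σ_stable j)
    have h : TGWD.TwistData D E ρR σS q := F.twistData hρR hσS hρ hσ hq
    obtain ⟨τ, hτ⟩ := h.exists_twistingMap_TGWA μ ν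
    have hformula₀ := h.twistFormula_twist (μ := μ) (ν := ν)
    have hgr₀ := TGWD.isGradedTwist_of_twistFormula hformula₀
    have hformula := TGWD.twistFormula_TGWA hτ hformula₀
    have hgr := TGWD.isGradedTwist_TGWA hτ hgr₀
    obtain ⟨e, he⟩ := TGWD.exists_algEquiv_twistedTensor hformula hgr hρR hσS hD hE hDμ hEν
    refine ⟨ρR, σS, hρR, hσS, h.twistingMap μ ν, hformula₀, fun f hf =>
      TGWD.eq_of_twistFormula (p := AlgHom.id k _) (p' := AlgHom.id k _) Function.surjective_id
        Function.surjective_id hf hformula₀, hgr₀, τ, hτ, hformula, fun f hf =>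
      TGWD.eq_of_twistFormula (TGWD.TGWA.mk_surjective D μ) (TGWD.TGWA.mk_surjective E ν) hf
        hformula, hgr, F.datum_isRegular hD hE,
      TGWD.tensor_isConsistent hformula hρR hσS hDμ hEν, e, fun r s => ?_, fun j ε => ?_,
      fun i ε => ?_⟩
    · exact (he _).trans ((TGWD.tensorHom_base hformula hρR hσS _).trans
        ((TGWD.tensorBase_tmul hformula r s).trans (τ.includeLeft_mul_includeRight _ _)))
    · exact (he _).trans ((TGWD.tensorHom_X hformula hρR hσS _ _).trans
        (TGWD.tensorX_castAdd j ε))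
    · exact (he _).trans ((TGWD.tensorHom_X hformula hρR hσS _ _).trans
        (TGWD.tensorX_natAdd i ε))
  · rw [not_and_or, not_nontrivial_iff_subsingleton, not_nontrivial_iff_subsingleton] at hRS
    have hT : Subsingleton (R ⊗[k] S) := TensorProduct.subsingleton_of_or hRS
    have hC : Subsingleton (D.TGWC μ ⊗[k] E.TGWC ν) := TensorProduct.subsingleton_of_or
      (hRS.imp (fun h => TGWD.TGWC.subsingleton (h := h)) fun h => TGWD.TGWC.subsingleton (h := h))
    have hA : Subsingleton (D.TGWA μ ⊗[k] E.TGWA ν) := TensorProduct.subsingleton_of_or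
      (hRS.imp (fun h => TGWD.TGWA.subsingleton (h := h)) fun h => TGWD.TGWA.subsingleton (h := h))
    let τ := TwistingMap.ofSubsingleton hA
    have hτ : Subsingleton τ.TwistedTensor := hA
    have hη : Subsingleton (F.datum.TGWA (TGWD.tensorParameter μ ν q)) := TGWD.TGWA.subsingleton
    -- Identity automorphisms and zero maps serve, since every equation lives in a zero space. Only
    -- regularity is proved as before.
    refine ⟨fun _ => 1, fun _ => 1, fun _ _ => Subsingleton.elim _ _,
      fun _ _ => Subsingleton.elim _ _, TwistingMap.ofSubsingleton hC,
      fun _ _ _ _ => Subsingleton.elim _ _, fun _ _ => LinearMap.ext fun _ => Subsingleton.elim _ _,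
      fun _ _ _ _ _ _ => ⟨0, Subsingleton.elim _ _⟩, τ, fun _ _ => Subsingleton.elim _ _,
      fun _ _ _ _ => Subsingleton.elim _ _, fun _ _ => LinearMap.ext fun _ => Subsingleton.elim _ _,
      fun _ _ _ _ _ _ => ⟨0, Subsingleton.elim _ _⟩, F.datum_isRegular hD hE,
      fun _ _ _ => Subsingleton.elim _ _,
      AlgEquiv.ofLinearEquiv 0 (Subsingleton.elim _ _) fun _ _ => Subsingleton.elim _ _,
      fun _ _ => Subsingleton.elim _ _, fun _ _ => Subsingleton.elim _ _,
      fun _ _ => Subsingleton.elim _ _⟩
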